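/- **Setting.** Fix an integer $k\ge 1$ and a family of densities (or mass functions) $p(\cdot\mid\theta)$, $\theta\in\mathbb R$, on $\mathbb R$ with respect to a common measure $\nu$. Write $\ell(\theta;x)=\log p(x\mid\theta)$ and $\mu(\theta)=\int x\,p(x\mid\theta)\,\nu(dx)$. For $Z^\star\in\mathbb R^{n\times k}$ with rows $z_i^\star$ and $\alpha^\star\in\mathbb R^n$, put $\Theta^\star_{ij}=\alpha^\star_i+\alpha^\star_j+\langle z^\star_i,z^\star_j\rangle$. Observe a symmetric $n\times n$ matrix $A$ with $A_{ii}=0$ and independent entries $A_{ij}\sim p(\cdot\mid\Theta^\star_{ij})$, $i<j$. Let $\|X\|_{2\to\infty}=\sup_{\|v\|_2=1}\|Xv\|_\infty$, $\operatorname{dist}(\hat Z,Z)=\min_{Q\in\mathcal O(k)}\|\hat Z-ZQ\|_{\mathrm F}$, and, for $\hat Y=[\hat Z,\hat\alpha]$, $Y=[Z,\alpha]$, $\operatorname{dist}^2(\hat Y,Y)=\operatorname{dist}^2(\hat Z,Z)+\|\hat\alpha-\alpha\|_2^2$. Write $Y^\star=[Z^\star,\alpha^\star]$; $g_n\ll h_n$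 means $g_n/h_n\to0$, and $g_n\asymp h_n$ means that the two are of the same order. **Estimator.** Given $\tau_n>0$ and integers $\gamma_n$: from a singular value decomposition $A=\sum_i\sigma_iu_iv_i^\top$ form $\tilde E=\sum_{\sigma_i>\tau_n}\sigma_iu_iv_i^\top$; let $\tilde E_{(1)}\le\dots\le\tilde E_{(n^2)}$ be its ordered entries, and $l_1,l_2$ the smallest and largest index $l$ with $\tilde E_{(l)}\in\mu(\mathbb R)$. Project $\tilde E$ entrywise onto $[\tilde E_{(\gamma_n)},\tilde E_{(n^2-\gamma_n)}]\cap[\tilde E_{(l_1)},\tilde E_{(l_2)}]$ to get $\mathring E$; let $\mathring\Theta_{ij}=\mu^{-1}(\mathring E_{ij})$, $\mathring\alpha=(n\mathrm I_n+1_n1_n^\top)^{-1}\mathring\Theta1_n$, and $\mathring Z=[\sqrt{\max(\lambda_1,0)}\,w_1,\dots,\sqrt{\max(\lambda_k,0)}\,w_k]$, where $\lambda_1\ge\dots\ge\lambda_n$ and $w_1,\dots,w_n$ are eigenvalues and orthonormal eigenvectors of $\mathring\Theta-\mathring\alpha1_n^\top-1_n\mathring\alpha^\top$. Put $\mathring Y=[\mathring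 Z,\mathring\alpha]$. **Assumptions**, with positive constants $M_1,M_2,K,s$: 1. $1_n^\top Z^\star=0$, $Z^{\star\top}Z^\star$ is diagonal, $\|Z^\star\|_{2\to\infty}\le M_1$, $\|\alpha^\star\|_\infty\le M_1$, and the smallest singular value of $Z^{\star\top}Z^\star/n$ is at least $M_2$. 2. The support $\mathcal X=\{x:p(x\mid\theta)>0\}$ does not depend on $\theta$; for $x\in\mathcal X$, $\ell(\cdot;x)$ is three times differentiable, and for every $b>0$ there are $\kappa_1,\kappa_2,\kappa_3>0$ with $\kappa_1\le-\ell''(\theta;x)\le\kappa_2$ and $|\ell'''(\theta;x)|\le\kappa_3$ for all $|\theta|\le b$, $x\in\mathcal X$. Moreover $\Pr(|\ell'(\Theta^\star_{ij};A_{ij})|>t)\le2\exp(-(t/K)^s)$ for all $t\ge0$, $i<j$. 3. The expectation $\mu(\theta)$ exists for every $\theta\in\mathbb R$, $\mu$ is continuously differentiable, and for every $b>0$ there are $\kappa_4,\kappa_5>0$ with $\kappa_4\le\mu'(\theta)\le\kappa_5$ for $|\theta|\le b$. Moreover $\Pr(|A_{ij}-\mu(\Theta^\star_{ij})|>t)\le2\exp(-(t/K)^s)$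 for all $t\ge0$, $i<j$. 4. $n^{1/2}\ll\tau_n\ll n^{1/2+1/(k+3)}$ and $\tau_nn^{3/2-1/(k+3)}\ll\gamma_n\ll n^2$. **Theorem.** Under these assumptions: (a) For every $\varepsilon>0$ there are $C>0$ and $N_\varepsilon\in\mathbb N$ such that for $n\ge N_\varepsilon$, with probability $1-O(n^{-\varepsilon})$, $$\operatorname{dist}^2(\mathring Y,Y^\star)\le\frac{C\gamma_n}{n}\quad\text{and}\quad\|\mathring Y\|_{2\to\infty}\le C.$$ (b) If moreover $\gamma_n=O(n^{2-\varsigma_0})$ for a constant $\varsigma_0\in(0,1/2)$, then $\mathring Y$ meets the requirements on an initial estimate: for every $\varepsilon>0$ there are $C,b_0>0$ and $N_\varepsilon\in\mathbb N$ such that for $n\ge N_\varepsilon$, with probability $1-O(n^{-\varepsilon})$, $1_n^\top\mathring Z=0$, $\operatorname{dist}^2(\mathring Y,Y^\star)\le Cn^{1-\varsigma_0}$ and $\|\mathring Y\|_{2\to\infty}\le b_0$. (c) Such tuning parameters exist: for every $\varsigma_0\in(0,1/(k+3))$ there are $\tau_n,\gamma_n$ that satisfy Assumption 4 with $\gamma_n\asymp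 n^{2-\varsigma_0}$, and any $\gamma_n\asymp n^{2-\varsigma_0}$ and $n^{1/2}\ll\tau_n\ll n^{1/2+1/(k+3)-\varsigma_0}$ satisfy Assumption 4. The constants $C$, $b_0$, $N_\varepsilon$ and the one in $O(n^{-\varepsilon})$ depend only on $k$, the family $p$, $M_1,M_2,K,s$, the sequences $\tau_n,\gamma_n$, $\varepsilon$ and, in (b), $\varsigma_0$. -/

import Mathlib

open MeasureTheory ProbabilityTheory Filter Asymptotics Topology
open scoped Matrix

universe u

namespace LatentSpace

noncomputable section

/-! ### Matrix norms and distances -/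

/-- The Frobenius norm. -/
def frobNorm {m n : Type*} [Fintype m] [Fintype n] (X : Matrix m n ℝ) : ℝ :=
  √(∑ i, ∑ j, X i j ^ 2)

/-- The two-to-infinity norm `sup_{‖v‖₂ = 1} ‖X v‖_∞`
(the norm of `m → ℝ` is the maximum of the absolute values of the coordinates). -/
def twoToInfNorm {m n : Type*} [Fintype m] [Fintype n] (X : Matrix m n ℝ) : ℝ :=
  sSup ((fun v : EuclideanSpace ℝ n => ‖X *ᵥ v.ofLp‖) '' Metric.sphere 0 1)

/-- The smallest singular value of a square matrix, singular values being the square roots of the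
eigenvalues of `Xᵀ X`. -/
def sigmaMin {n : Type*} [Fintype n] [DecidableEq n] (X : Matrix n n ℝ) : ℝ :=
  ⨅ i, √((Matrix.isHermitian_conjTranspose_mul_self X).eigenvalues i)

/-- The matrix `[Z, α]` with the `k + 1` columns formed by those of `Z` followed by `α`. -/
def joinCols {n k : ℕ} (Z : Matrix (Fin n) (Fin k) ℝ) (α : Fin n → ℝ) :
    Matrix (Fin n) (Fin k ⊕ Unit) ℝ :=
  Matrix.fromCols Z (Matrix.replicateCol Unit α)

/-- `dist(Zhat, Z) = min_{Q ∈ O(k)} ‖Zhat - Z Q‖_F`. -/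
def procrustesDist {n k : ℕ} (Zhat Z : Matrix (Fin n) (Fin k) ℝ) : ℝ :=
  ⨅ Q : Matrix.orthogonalGroup (Fin k) ℝ, frobNorm (Zhat - Z * (Q : Matrix (Fin k) (Fin k) ℝ))

/-- `dist²([Zhat, αhat], [Z, α]) = dist²(Zhat, Z) + ‖αhat - α‖₂²`. -/
def distSq {n k : ℕ} (Zhat : Matrix (Fin n) (Fin k) ℝ) (αhat : Fin n → ℝ)
    (Z : Matrix (Fin n) (Fin k) ℝ) (α : Fin n → ℝ) : ℝ :=
  procrustesDist Zhat Z ^ 2 + ∑ i, (αhat i - α i) ^ 2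

/-! ### The latent space model -/

/-- A family `p(· ∣ θ)`, `θ ∈ ℝ`, of probability densities on `ℝ` with respect to a common base
measure (Lebesgue measure for densities, a counting measure for mass functions). -/
structure EdgeFamily where
  /-- the dominating measure -/
  base : Measure ℝ
  /-- `p θ x` is `p(x ∣ θ)` -/
  p : ℝ → ℝ → ℝ
  measurable_p : ∀ θ, Measurable (p θ)
  p_nonneg : ∀ θ x, 0 ≤ p θ x
  lintegral_p : ∀ θ, ∫⁻ x, ENNReal.ofReal (p θ x) ∂base = 1

namespace EdgeFamily

/-- The distribution with density `p(· ∣ θ)`. -/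
def law (F : EdgeFamily) (θ : ℝ) : Measure ℝ :=
  F.base.withDensity fun x => ENNReal.ofReal (F.p θ x)

/-- `ℓ(θ; x) = log p(x ∣ θ)`. -/
def logLik (F : EdgeFamily) (x θ : ℝ) : ℝ := Real.log (F.p θ x)

/-- The support `{x : p(x ∣ θ) > 0}`; it is only used where it does not depend on `θ`. -/
def support (F : EdgeFamily) : Set ℝ := {x | ∀ θ, 0 < F.p θ x}

/-- The mean function `μ(θ)`, the expectation under `p(· ∣ θ)`. -/
def mean (F : EdgeFamily) (θ : ℝ) : ℝ := ∫ x, x ∂(F.law θ)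

end EdgeFamily

/-- `Θ_ij = α_i + α_j + ⟨z_i, z_j⟩`, for all `i, j`, where `z_i` is the `i`-th row of `Z`. -/
def thetaMat {n k : ℕ} (Z : Matrix (Fin n) (Fin k) ℝ) (α : Fin n → ℝ) :
    Matrix (Fin n) (Fin n) ℝ :=
  Matrix.of fun i j => α i + α j + Z i ⬝ᵥ Z j

/-- The random adjacency matrix `A` is symmetric with zero diagonal and its entries above the
diagonal are independent with `A_ij ∼ p(· ∣ Θ_ij)`. -/
structure IsLatentSpaceModel (F : EdgeFamily) {n k : ℕ} (Z : Matrix (Fin n) (Fin k) ℝ)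
    (α : Fin n → ℝ) {Ω : Type u} [MeasurableSpace Ω] (P : Measure Ω)
    (A : Ω → Matrix (Fin n) (Fin n) ℝ) : Prop where
  measurable_entry : ∀ i j, Measurable fun ω => A ω i j
  symm : ∀ ω, (A ω).IsSymm
  diag_zero : ∀ ω i, A ω i i = 0
  law_entry : ∀ i j, i < j → P.map (fun ω => A ω i j) = F.law (thetaMat Z α i j)
  indep : iIndepFun (fun (e : {e : Fin n × Fin n // e.1 < e.2}) ω => A ω e.1.1 e.1.2) P

/-! ### Regularity conditions -/

/-- The condition on the true parameters `(Z, α)`, with constants `M₁`, `M₂`. -/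
structure TrueParameterCondition (M₁ M₂ : ℝ) {n k : ℕ} (Z : Matrix (Fin n) (Fin k) ℝ)
    (α : Fin n → ℝ) : Prop where
  centered : ∀ j, ∑ i, Z i j = 0
  gram_diag : (Zᵀ * Z).IsDiag
  bound_Z : twoToInfNorm Z ≤ M₁
  bound_α : ‖α‖ ≤ M₁
  well_conditioned : M₂ ≤ sigmaMin ((n : ℝ)⁻¹ • (Zᵀ * Z))

/-- The smoothness and curvature condition on the edgewise log-likelihood. -/
structure EdgewiseCondition (F : EdgeFamily) : Prop where
  /-- the support does not depend on the parameter -/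
  common_support : ∀ θ θ' x, 0 < F.p θ x → 0 < F.p θ' x
  differentiable : ∀ x ∈ F.support, ∀ m < 3, Differentiable ℝ (iteratedDeriv m (F.logLik x))
  bounds : ∀ b > 0, ∃ κ₁ > 0, ∃ κ₂ > 0, ∃ κ₃ > 0, ∀ θ ∈ Set.Icc (-b) b, ∀ x ∈ F.support,
    κ₁ ≤ -iteratedDeriv 2 (F.logLik x) θ ∧ -iteratedDeriv 2 (F.logLik x) θ ≤ κ₂ ∧
      |iteratedDeriv 3 (F.logLik x) θ| ≤ κ₃

/-- The tail condition on the edgewise scores. -/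
def ScoreTailCondition (F : EdgeFamily) (K s : ℝ) {n k : ℕ} (Z : Matrix (Fin n) (Fin k) ℝ)
    (α : Fin n → ℝ) {Ω : Type u} [MeasurableSpace Ω] (P : Measure Ω)
    (A : Ω → Matrix (Fin n) (Fin n) ℝ) : Prop :=
  ∀ i j, i < j → ∀ t : ℝ, 0 ≤ t →
    P {ω | t < |deriv (F.logLik (A ω i j)) (thetaMat Z α i j)|} ≤
      ENNReal.ofReal (2 * Real.exp (-(t / K) ^ s))

/-- The regularity condition on the mean function `μ`. -/
structure LinkCondition (F : EdgeFamily) : Prop where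
  /-- the expectation defining `μ θ` exists -/
  integrable : ∀ θ, Integrable (fun x => x) (F.law θ)
  contDiff : ContDiff ℝ 1 F.mean
  bounds : ∀ b > 0, ∃ κ₄ > 0, ∃ κ₅ > 0, ∀ θ ∈ Set.Icc (-b) b,
    κ₄ ≤ deriv F.mean θ ∧ deriv F.mean θ ≤ κ₅

/-- The tail condition on the centered edges. -/
def EdgeTailCondition (F : EdgeFamily) (K s : ℝ) {n k : ℕ} (Z : Matrix (Fin n) (Fin k) ℝ)
    (α : Fin n → ℝ) {Ω : Type u} [MeasurableSpace Ω] (P : Measure Ω)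
    (A : Ω → Matrix (Fin n) (Fin n) ℝ) : Prop :=
  ∀ i j, i < j → ∀ t : ℝ, 0 ≤ t →
    P {ω | t < |A ω i j - F.mean (thetaMat Z α i j)|} ≤
      ENNReal.ofReal (2 * Real.exp (-(t / K) ^ s))

/-- The condition on the tuning parameters:
`n^{1/2} ≪ τ_n ≪ n^{1/2 + 1/(k+3)}` and `τ_n n^{3/2 - 1/(k+3)} ≪ γ_n ≪ n²`. -/
structure TuningCondition (k : ℕ) (τ : ℕ → ℝ) (γ : ℕ → ℕ) : Prop where
  τ_pos : ∀ᶠ n in atTop, 0 < τ n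
  τ_lower : (fun n : ℕ => (n : ℝ) ^ (1 / 2 : ℝ)) =o[atTop] τ
  τ_upper : τ =o[atTop] fun n : ℕ => (n : ℝ) ^ (1 / 2 + 1 / ((k : ℝ) + 3))
  γ_lower : (fun n : ℕ => τ n * (n : ℝ) ^ (3 / 2 - 1 / ((k : ℝ) + 3))) =o[atTop]
    fun n => (γ n : ℝ)
  γ_upper : (fun n => (γ n : ℝ)) =o[atTop] fun n : ℕ => (n : ℝ) ^ 2

/-! ### Range-adaptive singular value thresholding -/

/-- The order statistic `E_(m)`, `1 ≤ m ≤ n²`: the `m`-th smallest entry of `E` (counted with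
multiplicity), that is, the least `x` such that at least `m` entries are `≤ x`. -/
def orderStat {n : ℕ} (E : Matrix (Fin n) (Fin n) ℝ) (m : ℕ) : ℝ :=
  sInf {x | m ≤ (Finset.univ.filter fun e : Fin n × Fin n => E e.1 e.2 ≤ x).card}

/-- The indices `1 ≤ l ≤ n²` for which the inverse of `μ` is defined at `E_(l)`. -/
def admissibleIndices {n : ℕ} (μ : ℝ → ℝ) (E : Matrix (Fin n) (Fin n) ℝ) : Set ℕ :=
  {l | 1 ≤ l ∧ l ≤ n ^ 2 ∧ orderStat E l ∈ Set.range μ}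

/-- The left endpoint of the adaptive interval `[E_(γ), E_(n²-γ)] ∩ [E_(l₁), E_(l₂)]`, with `l₁`
the smallest admissible index. -/
def adaptiveLo {n : ℕ} (μ : ℝ → ℝ) (γ : ℕ) (E : Matrix (Fin n) (Fin n) ℝ) : ℝ :=
  max (orderStat E γ) (orderStat E (sInf (admissibleIndices μ E)))

/-- The right endpoint of the adaptive interval `[E_(γ), E_(n²-γ)] ∩ [E_(l₁), E_(l₂)]`, with `l₂`
the largest admissible index. -/
def adaptiveHi {n : ℕ} (μ : ℝ → ℝ) (γ : ℕ) (E : Matrix (Fin n) (Fin n) ℝ) : ℝ :=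
  min (orderStat E (n ^ 2 - γ)) (orderStat E (sSup (admissibleIndices μ E)))

/-- The elementwise projection of `E` onto its adaptive interval. -/
def adaptiveProj {n : ℕ} (μ : ℝ → ℝ) (γ : ℕ) (E : Matrix (Fin n) (Fin n) ℝ) :
    Matrix (Fin n) (Fin n) ℝ :=
  E.map fun x => max (adaptiveLo μ γ E) (min (adaptiveHi μ γ E) x)

/-- `B` is obtained from a singular value decomposition `A = ∑ i, σ i • u_i v_iᵀ` by keeping the
terms with `σ i > τ`. The `u_i`, `v_i` are the columns of `U`, `V`. -/
def IsSVThreshold {n : ℕ} (τ : ℝ) (A B : Matrix (Fin n) (Fin n) ℝ) : Prop :=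
  ∃ U ∈ Matrix.orthogonalGroup (Fin n) ℝ, ∃ V ∈ Matrix.orthogonalGroup (Fin n) ℝ,
    ∃ σ : Fin n → ℝ, (∀ i, 0 ≤ σ i) ∧ A = U * Matrix.diagonal σ * Vᵀ ∧
      B = U * Matrix.diagonal (fun i => if τ < σ i then σ i else 0) * Vᵀ

/-- `Z` is a top-`k` positively truncated square root of the symmetric matrix `X`: for an
eigendecomposition `X = ∑ i, d i • u_i u_iᵀ` with `d` nonincreasing, the `j`-th column of `Z` is
`(max (d j) 0)^{1/2} u_j`, for `j = 1, …, k` (a zero column if `j > n`). -/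
def IsTopSqrt {n k : ℕ} (X : Matrix (Fin n) (Fin n) ℝ) (Z : Matrix (Fin n) (Fin k) ℝ) : Prop :=
  ∃ U ∈ Matrix.orthogonalGroup (Fin n) ℝ, ∃ d : Fin n → ℝ, Antitone d ∧
    X = U * Matrix.diagonal d * Uᵀ ∧
      ∀ i (j : Fin k), Z i j =
        if h : (j : ℕ) < n then √(max (d ⟨j, h⟩) 0) * U i ⟨j, h⟩ else 0

/-- `(n I + 1 1ᵀ)⁻¹ T 1`. -/
def alphaInit {n : ℕ} (T : Matrix (Fin n) (Fin n) ℝ) : Fin n → ℝ :=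
  ((n : ℝ) • (1 : Matrix (Fin n) (Fin n) ℝ) + Matrix.of fun _ _ => (1 : ℝ))⁻¹ *ᵥ
    (T *ᵥ fun _ => 1)

/-- `T - a 1ᵀ - 1 aᵀ`. -/
def residual {n : ℕ} (T : Matrix (Fin n) (Fin n) ℝ) (a : Fin n → ℝ) :
    Matrix (Fin n) (Fin n) ℝ :=
  Matrix.of fun i j => T i j - a i - a j

/-- `[Z, α]` is an output of range-adaptive singular value thresholding on the data `A`, with link
`μ`, threshold `τ` and trimming quantile `γ`. The output is determined up to the choice of
eigenvectors in the last step. -/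
def IsRASVT {n k : ℕ} (μ : ℝ → ℝ) (τ : ℝ) (γ : ℕ) (A : Matrix (Fin n) (Fin n) ℝ)
    (Z : Matrix (Fin n) (Fin k) ℝ) (α : Fin n → ℝ) : Prop :=
  ∃ E, IsSVThreshold τ A E ∧
    ∃ T, T = (adaptiveProj μ γ E).map (Function.invFun μ) ∧
      α = alphaInit T ∧ IsTopSqrt (residual T α) Z

/-- Every symmetric matrix has an eigendecomposition with nonincreasing eigenvalues. -/
theorem exists_eigen {n : ℕ} {X : Matrix (Fin n) (Fin n) ℝ} (hX : X.IsSymm) :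
    ∃ U ∈ Matrix.orthogonalGroup (Fin n) ℝ, ∃ d : Fin n → ℝ, Antitone d ∧
      X = U * Matrix.diagonal d * Uᵀ := by
  have hH : X.IsHermitian := by
    rw [Matrix.IsHermitian, Matrix.conjTranspose_eq_transpose_of_trivial]; exact hX
  set U₀ : Matrix (Fin n) (Fin n) ℝ := (hH.eigenvectorUnitary : Matrix (Fin n) (Fin n) ℝ) with hU₀
  set d₀ := hH.eigenvalues
  have h1 : X = U₀ * Matrix.diagonal d₀ * U₀ᵀ := by
    have h := hH.spectral_theorem
    rw [Unitary.conjStarAlgAut_apply] at h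
    simpa [Function.comp_def, Matrix.star_eq_conjTranspose] using h
  have h2 : U₀ * U₀ᵀ = 1 := by
    have := Matrix.mem_orthogonalGroup_iff (A := U₀) |>.1 hH.eigenvectorUnitary.2
    simpa [Matrix.star_eq_conjTranspose] using this
  let p : Equiv.Perm (Fin n) := Tuple.sort fun i => -d₀ i
  have hp : Monotone ((fun i => -d₀ i) ∘ p) := Tuple.monotone_sort _
  refine ⟨U₀.submatrix id p, ?_, d₀ ∘ p, fun i j hij => by simpa using hp hij, ?_⟩
  · rw [Matrix.mem_orthogonalGroup_iff, Matrix.transpose_submatrix,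
      Matrix.submatrix_mul_equiv, h2, Matrix.submatrix_id_id]
  · rw [← Matrix.submatrix_diagonal_equiv, Matrix.transpose_submatrix,
      Matrix.submatrix_mul_equiv, Matrix.submatrix_mul_equiv, Matrix.submatrix_id_id]
    exact h1

/-- The algorithm has an output on every symmetric matrix. -/
theorem exists_isRASVT {n : ℕ} (k : ℕ) (μ : ℝ → ℝ) (τ : ℝ) (γ : ℕ)
    {A : Matrix (Fin n) (Fin n) ℝ} (hA : A.IsSymm) :
    ∃ (Z : Matrix (Fin n) (Fin k) ℝ) (α : Fin n → ℝ), IsRASVT μ τ γ A Z α := by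
  obtain ⟨U, hU, d, -, hd⟩ := exists_eigen hA
  have hUU' : U * Uᵀ = 1 := by
    simpa [Matrix.star_eq_conjTranspose] using Matrix.mem_orthogonalGroup_iff (A := U) |>.1 hU
  let e : Fin n → ℝ := fun i => if 0 ≤ d i then 1 else -1
  have he : ∀ i, e i * e i = 1 := fun i => by simp only [e]; split_ifs <;> norm_num
  have hde : ∀ i, |d i| * e i = d i := fun i => by
    simp only [e]; split_ifs with h
    · simp [abs_of_nonneg h]
    · simp [abs_of_neg (not_le.1 h)]
  have key : ∀ c : Fin n → ℝ, U * Matrix.diagonal c * (U * Matrix.diagonal e)ᵀ =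
      U * Matrix.diagonal (fun i => c i * e i) * Uᵀ := fun c => by
    rw [Matrix.transpose_mul, Matrix.diagonal_transpose, ← Matrix.mul_assoc,
      Matrix.mul_assoc U, Matrix.diagonal_mul_diagonal]
  let c : Fin n → ℝ := fun i => if τ < |d i| then |d i| else 0
  let E := U * Matrix.diagonal (fun i => c i * e i) * Uᵀ
  have hE : Eᵀ = E := by
    simp only [E, Matrix.transpose_mul, Matrix.diagonal_transpose, Matrix.transpose_transpose,
      Matrix.mul_assoc]
  have hT : IsSVThreshold τ A E := by
    refine ⟨U, hU, U * Matrix.diagonal e, ?_, fun i => |d i|, fun i => abs_nonneg _, ?_, ?_⟩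
    · rw [Matrix.mem_orthogonalGroup_iff, key]
      simp [he, hUU']
    · rw [key]; simpa only [hde] using hd
    · rw [key]
  have hEs : ∀ i j, E i j = E j i := fun i j => by
    conv_lhs => rw [← hE]
    rfl
  let T := (adaptiveProj μ γ E).map (Function.invFun μ)
  have hR : (residual T (alphaInit T)).IsSymm := by
    ext i j
    simp only [residual, T, adaptiveProj, Matrix.transpose_apply, Matrix.of_apply, Matrix.map_apply,
      hEs i j]
    ring
  obtain ⟨W, hW, f, hf, hX⟩ := exists_eigen hR
  exact ⟨Matrix.of fun i j => if h : (j : ℕ) < n then √(max (f ⟨j, h⟩) 0) * W i ⟨j, h⟩ else 0,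
    alphaInit T, E, hT, T, rfl, rfl, W, hW, f, hf, hX, fun _ _ => rfl⟩

/-! ### High-probability statements -/

/-- With probability `1 - O(n^{-ε})`, every output `[Zr, αr]` of range-adaptive singular value
thresholding satisfies `Good n Z α Zr αr`, where `(Z, α)` are the true parameters. The threshold
`N` and the constant `B` in `O(n^{-ε})` are uniform over all models that satisfy the conditions on
the true parameters and the tail conditions with the given constants. -/
def RASVTHighProb (k : ℕ) (F : EdgeFamily) (M₁ M₂ K s : ℝ) (τ : ℕ → ℝ) (γ : ℕ → ℕ) (ε : ℝ)
    (Good : ∀ n : ℕ, Matrix (Fin n) (Fin k) ℝ → (Fin n → ℝ) →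
      Matrix (Fin n) (Fin k) ℝ → (Fin n → ℝ) → Prop) : Prop :=
  ∃ N : ℕ, ∃ B > 0, ∀ n ≥ N,
    ∀ (Z : Matrix (Fin n) (Fin k) ℝ) (α : Fin n → ℝ)
      (Ω : Type u) [MeasurableSpace Ω] (P : Measure Ω) [IsProbabilityMeasure P]
      (A : Ω → Matrix (Fin n) (Fin n) ℝ),
      TrueParameterCondition M₁ M₂ Z α → IsLatentSpaceModel F Z α P A →
      ScoreTailCondition F K s Z α P A → EdgeTailCondition F K s Z α P A →
      P {ω | ∃ Zr αr, IsRASVT F.mean (τ n) (γ n) (A ω) Zr αr ∧ ¬ Good n Z α Zr αr} ≤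
        ENNReal.ofReal (B * (n : ℝ) ^ (-ε))

end

end LatentSpace

open LatentSpace

namespace LatentSpace

/-! Randomness enters through one event: the noise W = A - μ(Θ*) has spectral norm at most τ_n/2.
The rest is deterministic on that event.

The event. Above the diagonal W has independent centered entries with stretched exponential tails,
so ‖W‖ = O(√n) outside an event of probability O(n^{-ε}), for every ε
(`exists_measure_not_opBound_le`), and τ_n ≫ √n. After truncation at n^{1/32}, Bernstein's
inequality beats the entropy of a net only for vectors with small coordinates. Each unit vector is
therefore split into a flat part and a part supported on at most n^{3/4} coordinates. Pairs of flat
vectors are treated by Bernstein. For a sparse x and a strictly triangular M, the squared length of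
xᵀM is a sum of independent squares, and only exp(O(n^{3/4} log n)) lattice vectors x have to be
considered.

The signal. The nuclear norm of μ(Θ*) is O(n^{3/2-1/(k+3)}) (`exists_nuclear_bound`), because its
rows are Lipschitz functions of k+1 latent coordinates and hence nearly constant on the cells of a
grid. The squared Frobenius error of thresholding is at most a multiple of τ_n times this norm
(`sum_sq_svThreshold_sub_le`), which is o(γ_n) by the tuning condition.

Trimming. So fewer than γ_n entries are off by a fixed η. Both trimming quantiles then lie within η
of [μ(-b), μ(b)], where b bounds |Θ*|; there the inverse of μ is defined and Lipschitz. Clipping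
alters at most 2γ_n entries (`adaptiveProj_spec`). The estimate of Θ* is thus bounded entrywise,
with squared error O(γ_n).

Factors. The map T ↦ (nI + 11ᵀ)⁻¹T1 has norm O(n^{-1/2}) and sends Θ* to α*, so the squared error of
the estimate of α* is O(γ_n/n), and the residual matrix is within O(√γ_n) = o(n) of Z*Z*ᵀ, whose
nonzero eigenvalues are of order n. Passing to the spectral square root gains a factor n^{-1/2}
(`topSqrt_perturbation`). The rows of the estimated factor are bounded through the eigenvector
equation, and its columns are centered because the residual annihilates 1. -/

/-! ### Lattice points and rounding -/

open Finset in
/-- Exponential weighting bounds the number of lattice points in a Euclidean ball. -/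
theorem card_lattice_le (n L : ℕ) (R lam : ℝ) (hlam : 1 ≤ lam) :
    (((Fintype.piFinset fun _ : Fin n => Finset.Icc (-(L : ℤ)) L).filter
      fun k => ∑ i, (k i : ℝ) ^ 2 ≤ R).card : ℝ) ≤
      Real.exp (lam * R + 4 * Real.exp (-lam) * n) := by
  set S := Fintype.piFinset fun _ : Fin n => Finset.Icc (-(L : ℤ)) L with hS
  set q := Real.exp (-lam) with hq
  have hq0 : 0 < q := Real.exp_pos _
  have hq2 : q ≤ 1 / 2 := by
    have h1 : q ≤ Real.exp (-1) := Real.exp_le_exp.2 (by linarith)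
    have h2 : Real.exp (-1) ≤ 1 / 2 := by
      rw [Real.exp_neg, inv_eq_one_div]
      apply one_div_le_one_div_of_le (by norm_num)
      linarith [Real.add_one_le_exp (1 : ℝ)]
    linarith
  -- Since `j ^ 2 ≥ |j|`, the sum over one coordinate is dominated by a two-sided geometric series
  -- of ratio `q ≤ 1/2`.
  have hone : ∑ j ∈ Finset.Icc (-(L : ℤ)) L, Real.exp (-lam * (j : ℝ) ^ 2) ≤ Real.exp (4 * q) := by
    have hterm : ∀ j : ℤ, Real.exp (-lam * (j : ℝ) ^ 2) ≤ q ^ j.natAbs := by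
      intro j
      rw [hq, ← Real.exp_nat_mul]
      apply Real.exp_le_exp.2
      have h1 : (j.natAbs : ℝ) ≤ (j : ℝ) ^ 2 := by
        have : (j.natAbs : ℤ) ≤ j ^ 2 := by
          rw [← Int.natAbs_sq]
          exact Int.le_self_sq _
        have h2 : ((j.natAbs : ℤ) : ℝ) ≤ ((j ^ 2 : ℤ) : ℝ) := by exact_mod_cast this
        push_cast at h2
        simpa using h2
      nlinarith
    -- The subtracted term closes the induction: passing to `M + 1` adds `2 * q ^ (M + 1)`, and `q ≤
    -- 1/2` gives `4 * q ^ (M + 2) ≤ 2 * q ^ (M + 1)`.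
    have hgeo : ∀ M : ℕ, ∑ j ∈ Finset.Icc (-(M : ℤ)) M, q ^ j.natAbs ≤ 1 + 2 * (2 * q) - 4 * q ^ (M + 1) := by
      intro M
      induction M with
      | zero => simp; linarith
      | succ M ih =>
        have : Finset.Icc (-((M + 1 : ℕ) : ℤ)) ((M + 1 : ℕ) : ℤ) =
            insert (-((M + 1 : ℕ) : ℤ)) (insert ((M + 1 : ℕ) : ℤ) (Finset.Icc (-(M : ℤ)) M)) := by
          ext x; simp only [Finset.mem_Icc, Finset.mem_insert]; push_cast; omega
        rw [this, Finset.sum_insert, Finset.sum_insert]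
        · have h1 : (-((M + 1 : ℕ) : ℤ)).natAbs = M + 1 := by omega
          have h2 : (((M + 1 : ℕ) : ℤ)).natAbs = M + 1 := by omega
          rw [h1, h2, pow_succ q (M + 1)]
          have : 0 < q ^ (M + 1) := by positivity
          nlinarith
        · simp
        · simp only [Finset.mem_Icc, Finset.mem_insert]; push_cast; omega
    calc _ ≤ ∑ j ∈ Finset.Icc (-(L : ℤ)) L, q ^ j.natAbs := Finset.sum_le_sum fun j _ => hterm j
      _ ≤ 1 + 4 * q := by
        have := hgeo L
        have : 0 < q ^ (L + 1) := by positivity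
        linarith
      _ ≤ _ := by linarith [Real.add_one_le_exp (4 * q)]
  have hprod : ∑ k ∈ S, Real.exp (-lam * ∑ i, (k i : ℝ) ^ 2) ≤ Real.exp (4 * q * n) := by
    have : ∀ k : Fin n → ℤ, Real.exp (-lam * ∑ i, (k i : ℝ) ^ 2) =
        ∏ i, Real.exp (-lam * (k i : ℝ) ^ 2) := by
      intro k; rw [Finset.mul_sum, Real.exp_sum]
    simp_rw [this]
    rw [hS, ← Finset.prod_univ_sum (fun _ : Fin n => Finset.Icc (-(L : ℤ)) L)
      fun _ j => Real.exp (-lam * (j : ℝ) ^ 2)]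
    simp only [Finset.prod_const, Finset.card_univ, Fintype.card_fin]
    rw [mul_comm (4 * q), Real.exp_nat_mul]
    exact pow_le_pow_left₀ (Finset.sum_nonneg fun _ _ => (Real.exp_pos _).le) hone n
  calc _ = ∑ k ∈ S.filter (fun k => ∑ i, (k i : ℝ) ^ 2 ≤ R), (1 : ℝ) := by simp
    _ ≤ ∑ k ∈ S.filter (fun k => ∑ i, (k i : ℝ) ^ 2 ≤ R),
        Real.exp (lam * R) * Real.exp (-lam * ∑ i, (k i : ℝ) ^ 2) := by
      apply Finset.sum_le_sum
      intro k hk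
      rw [← Real.exp_add]
      apply Real.one_le_exp
      have := (Finset.mem_filter.1 hk).2
      nlinarith
    _ = Real.exp (lam * R) * ∑ k ∈ S.filter (fun k => ∑ i, (k i : ℝ) ^ 2 ≤ R),
        Real.exp (-lam * ∑ i, (k i : ℝ) ^ 2) := by rw [Finset.mul_sum]
    _ ≤ Real.exp (lam * R) * ∑ k ∈ S, Real.exp (-lam * ∑ i, (k i : ℝ) ^ 2) := by
      apply mul_le_mul_of_nonneg_left _ (Real.exp_pos _).le
      exact Finset.sum_le_sum_of_subset_of_nonneg (Finset.filter_subset _ _)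
        fun _ _ _ => (Real.exp_pos _).le
    _ ≤ _ := by
      rw [Real.exp_add]
      gcongr

/-- Rounding towards zero on the lattice `h⁻¹ ℤ`. -/
theorem exists_round (h x : ℝ) (hh : 0 < h) :
    ∃ k : ℤ, |(k : ℝ) / h| ≤ |x| ∧ |x - k / h| ≤ 1 / h ∧ |x - k / h| ≤ |x| := by
  rcases le_total 0 x with hx | hx
  · refine ⟨⌊h * x⌋, ?_⟩
    have h1 := Int.floor_le (h * x)
    have h2 := (Int.lt_floor_add_one (h * x)).le
    have h3 : (0 : ℝ) ≤ ⌊h * x⌋ := by exact_mod_cast Int.floor_nonneg.2 (by positivity)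
    have h4 : (⌊h * x⌋ : ℝ) / h ≤ x := by rw [div_le_iff₀ hh]; linarith
    have h5 : x - ⌊h * x⌋ / h ≤ 1 / h := by
      rw [sub_le_iff_le_add, ← add_div, le_div_iff₀ hh]; linarith
    have h6 : 0 ≤ (⌊h * x⌋ : ℝ) / h := by positivity
    rw [abs_of_nonneg h6, abs_of_nonneg hx, abs_of_nonneg (by linarith)]
    exact ⟨h4, h5, by linarith⟩
  · refine ⟨⌈h * x⌉, ?_⟩
    have h1 := Int.le_ceil (h * x)
    have h2 := (Int.ceil_lt_add_one (h * x)).le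
    have h3 : (⌈h * x⌉ : ℝ) ≤ 0 := by
      exact_mod_cast Int.ceil_le.2 (by simpa using mul_nonpos_of_nonneg_of_nonpos hh.le hx)
    have h4 : x ≤ (⌈h * x⌉ : ℝ) / h := by rw [le_div_iff₀ hh]; linarith
    have h5 : ⌈h * x⌉ / h - x ≤ 1 / h := by
      rw [sub_le_iff_le_add, div_le_iff₀ hh, add_mul, div_mul_cancel₀ _ hh.ne']; linarith
    have h6 : (⌈h * x⌉ : ℝ) / h ≤ 0 := div_nonpos_of_nonpos_of_nonneg h3 hh.le
    rw [abs_of_nonpos h6, abs_of_nonpos hx, abs_of_nonpos (by linarith)]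
    exact ⟨by linarith, by linarith, by linarith⟩

/-! ### Spectral norm bounds from nets -/

/-- The spectral norm of `M` is at most `c`. -/
def OpBound {m n : Type*} [Fintype m] [Fintype n] (M : Matrix m n ℝ) (c : ℝ) : Prop :=
  ∀ (u : m → ℝ) (v : n → ℝ), u ⬝ᵥ M *ᵥ v ≤ c * √(u ⬝ᵥ u) * √(v ⬝ᵥ v)

theorem dotProduct_self_nonneg' {m : Type*} [Fintype m] (u : m → ℝ) : 0 ≤ u ⬝ᵥ u :=
  Finset.sum_nonneg fun i _ => mul_self_nonneg (u i)

theorem dotProduct_le_sqrt {m : Type*} [Fintype m] (u v : m → ℝ) :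
    u ⬝ᵥ v ≤ √(u ⬝ᵥ u) * √(v ⬝ᵥ v) := by
  have := Finset.sum_mul_sq_le_sq_mul_sq Finset.univ u v
  rw [← Real.sqrt_mul (dotProduct_self_nonneg' u)]
  apply Real.le_sqrt_of_sq_le
  simpa [dotProduct, sq] using this

theorem OpBound.of_unit {m n : Type*} [Fintype m] [Fintype n] {M : Matrix m n ℝ} {c : ℝ}
    (h : ∀ u v, u ⬝ᵥ u ≤ 1 → v ⬝ᵥ v ≤ 1 → u ⬝ᵥ M *ᵥ v ≤ c) : OpBound M c := by
  intro u v
  by_cases hu : u ⬝ᵥ u = 0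
  · have : u = 0 := by simpa [dotProduct_self_eq_zero] using hu
    simp [this]
  by_cases hv : v ⬝ᵥ v = 0
  · have : v = 0 := by simpa [dotProduct_self_eq_zero] using hv
    simp [this]
  have hu' : 0 < √(u ⬝ᵥ u) := Real.sqrt_pos.2 (lt_of_le_of_ne (dotProduct_self_nonneg' u) (Ne.symm hu))
  have hv' : 0 < √(v ⬝ᵥ v) := Real.sqrt_pos.2 (lt_of_le_of_ne (dotProduct_self_nonneg' v) (Ne.symm hv))
  have key := h ((√(u ⬝ᵥ u))⁻¹ • u) ((√(v ⬝ᵥ v))⁻¹ • v)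
    (by
      rw [smul_dotProduct, dotProduct_smul, smul_eq_mul, smul_eq_mul, ← mul_assoc, ← mul_inv,
        Real.mul_self_sqrt (dotProduct_self_nonneg' u), inv_mul_cancel₀ hu])
    (by
      rw [smul_dotProduct, dotProduct_smul, smul_eq_mul, smul_eq_mul, ← mul_assoc, ← mul_inv,
        Real.mul_self_sqrt (dotProduct_self_nonneg' v), inv_mul_cancel₀ hv])
  rw [Matrix.mulVec_smul, smul_dotProduct, dotProduct_smul, smul_eq_mul, smul_eq_mul,
    ← mul_assoc, ← mul_inv, inv_mul_le_iff₀ (by positivity)] at key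
  linarith

theorem OpBound.mono {m n : Type*} [Fintype m] [Fintype n] {M : Matrix m n ℝ} {c c' : ℝ}
    (h : OpBound M c) (hc : c ≤ c') : OpBound M c' := fun u v =>
  (h u v).trans (by gcongr)

theorem OpBound.add {m n : Type*} [Fintype m] [Fintype n] {M N : Matrix m n ℝ} {c d : ℝ}
    (h : OpBound M c) (h' : OpBound N d) : OpBound (M + N) (c + d) := fun u v => by
  rw [Matrix.add_mulVec, dotProduct_add]
  linarith [h u v, h' u v]

theorem OpBound.neg {m n : Type*} [Fintype m] [Fintype n] {M : Matrix m n ℝ} {c : ℝ}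
    (h : OpBound M c) : OpBound (-M) c := fun u v => by
  have := h (-u) v
  simpa [Matrix.neg_mulVec] using this

theorem OpBound.transpose {m n : Type*} [Fintype m] [Fintype n] {M : Matrix m n ℝ} {c : ℝ}
    (h : OpBound M c) : OpBound Mᵀ c := fun u v => by
  have := h v u
  rw [Matrix.mulVec_transpose, dotProduct_comm, ← Matrix.dotProduct_mulVec]
  linarith

/-- Let s be the supremum over S × S', finite because both sets lie in the unit ball. With x = x' +
e/4 and y = y' + f/4, the form is x'My' + (x'Mf + eMy)/4 ≤ T + s/2, whence s ≤ 2T. The remainders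
must stay in S and S'; this makes the argument work for flat or sparse vectors as well as for balls.
-/
theorem bilin_le_of_net {n : ℕ} {M : Matrix (Fin n) (Fin n) ℝ} {S N S' N' : Set (Fin n → ℝ)}
    (hS : ∀ x ∈ S, ∃ x' ∈ N, ∃ e ∈ S, x = x' + (1 / 4 : ℝ) • e)
    (hS' : ∀ x ∈ S', ∃ x' ∈ N', ∃ e ∈ S', x = x' + (1 / 4 : ℝ) • e) (hN : N ⊆ S)
    (hSb : ∀ x ∈ S, x ⬝ᵥ x ≤ 1) (hSb' : ∀ x ∈ S', x ⬝ᵥ x ≤ 1) {T : ℝ}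
    (h : ∀ x ∈ N, ∀ y ∈ N', x ⬝ᵥ M *ᵥ y ≤ T) :
    ∀ x ∈ S, ∀ y ∈ S', x ⬝ᵥ M *ᵥ y ≤ 2 * T := by
  intro x hx y hy
  set A : Set ℝ := {r | ∃ x ∈ S, ∃ y ∈ S', r = x ⬝ᵥ M *ᵥ y} with hA
  have hcoord : ∀ x : Fin n → ℝ, x ⬝ᵥ x ≤ 1 → ∀ i, |x i| ≤ 1 := by
    intro x hx i
    have : x i * x i ≤ x ⬝ᵥ x :=
      Finset.single_le_sum (f := fun i => x i * x i) (fun i _ => mul_self_nonneg (x i))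
        (Finset.mem_univ i)
    rw [← sq_le_one_iff_abs_le_one]; nlinarith
  have hbdd : BddAbove A := by
    refine ⟨∑ i, ∑ j, |M i j|, ?_⟩
    rintro r ⟨x, hx, y, hy, rfl⟩
    simp only [dotProduct, Matrix.mulVec, Finset.mul_sum]
    refine Finset.sum_le_sum fun i _ => Finset.sum_le_sum fun j _ => ?_
    refine (le_abs_self _).trans ?_
    rw [abs_mul, abs_mul]
    have h1 := hcoord x (hSb x hx) i
    have h2 := hcoord y (hSb' y hy) j
    calc |x i| * (|M i j| * |y j|) ≤ 1 * (|M i j| * 1) := by gcongr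
      _ = _ := by ring
  have hmem : ∀ x ∈ S, ∀ y ∈ S', x ⬝ᵥ M *ᵥ y ≤ sSup A := fun x hx y hy =>
    le_csSup hbdd ⟨x, hx, y, hy, rfl⟩
  have hsup : sSup A ≤ T + sSup A / 2 := by
    refine csSup_le ⟨_, x, hx, y, hy, rfl⟩ ?_
    rintro r ⟨x, hx, y, hy, rfl⟩
    obtain ⟨x', hx', e, he, hxe⟩ := hS x hx
    obtain ⟨y', hy', f, hf, hyf⟩ := hS' y hy
    have h1 := h x' hx' y' hy'
    have h2 := hmem x' (hN hx') f hf
    have h3 := hmem e he y hy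
    have : x ⬝ᵥ M *ᵥ y = x' ⬝ᵥ M *ᵥ y' + 1 / 4 * (x' ⬝ᵥ M *ᵥ f) + 1 / 4 * (e ⬝ᵥ M *ᵥ y) := by
      conv_lhs => rw [hxe, add_dotProduct, smul_dotProduct, smul_eq_mul]
      conv_lhs => enter [1]; rw [hyf, Matrix.mulVec_add, Matrix.mulVec_smul, dotProduct_add,
        dotProduct_smul, smul_eq_mul]
    rw [this]; linarith
  linarith [hmem x hx y hy]

-- Rounding towards zero with mesh 1/(4√m) errs by at most the mesh, and only on the support, which
-- has at most m elements; the error vector therefore has length at most 1/4. No coordinate grows in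
-- absolute value, so length, flatness and sparsity of `x` pass to the rounded vector. The remainder
-- `e` is flat at level 1/√m and keeps the support.
open Finset in
theorem exists_round_vec {n : ℕ} (m : ℝ) (hm : 0 < m) (x : Fin n → ℝ)
    (hsupp : ((univ.filter fun i => x i ≠ 0).card : ℝ) ≤ m) :
    ∃ (k : Fin n → ℤ) (e : Fin n → ℝ), (x = (fun i => (k i : ℝ) / (4 * √m)) + (1 / 4 : ℝ) • e) ∧
      e ⬝ᵥ e ≤ 1 ∧ (∀ i, |e i| ≤ 1 / √m) ∧ (∀ i, x i = 0 → e i = 0) ∧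
      ∀ i, |(k i : ℝ) / (4 * √m)| ≤ |x i| := by
  have hs : 0 < √m := Real.sqrt_pos.2 hm
  choose k hk1 hk2 hk3 using fun i => exists_round (4 * √m) (x i) (by positivity)
  have he : ∀ i, |4 * (x i - k i / (4 * √m))| ≤ 1 / √m := fun i => by
    rw [abs_mul, abs_of_nonneg (by norm_num : (0 : ℝ) ≤ 4)]
    have := hk2 i
    calc _ ≤ 4 * (1 / (4 * √m)) := by gcongr
      _ = _ := by field_simp
  have h0 : ∀ i, x i = 0 → 4 * (x i - k i / (4 * √m)) = 0 := fun i hi => by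
    have := hk3 i
    rw [hi, abs_zero] at this
    have := abs_nonpos_iff.1 this
    rw [hi, this, mul_zero]
  refine ⟨k, fun i => 4 * (x i - k i / (4 * √m)), ?_, ?_, he, h0, hk1⟩
  · ext i; simp
  · have : ∀ i, 4 * (x i - k i / (4 * √m)) * (4 * (x i - k i / (4 * √m))) ≤
        if x i ≠ 0 then 1 / m else 0 := by
      intro i
      split_ifs with hi
      · have h2 := sq_le_sq' (by linarith [abs_nonneg (4 * (x i - k i / (4 * √m))), he i]) (he i)
        rw [div_pow, Real.sq_sqrt hm.le, ← sq, one_pow, sq_abs] at *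
        exact h2
      · push Not at hi
        rw [h0 i hi]; simp
    calc _ ≤ ∑ i, if x i ≠ 0 then 1 / m else 0 := Finset.sum_le_sum fun i _ => this i
      _ = (univ.filter fun i => x i ≠ 0).card * (1 / m) := by
        rw [← Finset.sum_filter, Finset.sum_const, nsmul_eq_mul]
      _ ≤ m * (1 / m) := by gcongr
      _ = 1 := by field_simp

theorem sum_sq_le_of_abs_le {n : ℕ} {m : ℝ} (hm : 0 < m) {x : Fin n → ℝ} (hx : x ⬝ᵥ x ≤ 1)
    {k : Fin n → ℤ} (hk : ∀ i, |(k i : ℝ) / (4 * √m)| ≤ |x i|) :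
    ∑ i, (k i : ℝ) ^ 2 ≤ 16 * m := by
  have h : ∀ i, (k i : ℝ) ^ 2 ≤ 16 * m * (x i * x i) := fun i => by
    have := sq_le_sq.2 (hk i)
    rw [div_pow, mul_pow, Real.sq_sqrt hm.le, div_le_iff₀ (by positivity)] at this
    nlinarith
  calc _ ≤ ∑ i, 16 * m * (x i * x i) := Finset.sum_le_sum fun i _ => h i
    _ = 16 * m * (x ⬝ᵥ x) := by rw [← Finset.mul_sum]; rfl
    _ ≤ 16 * m * 1 := by gcongr
    _ = _ := mul_one _

theorem dotProduct_self_le_of_abs_le {n : ℕ} {x y : Fin n → ℝ} (h : ∀ i, |x i| ≤ |y i|) :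
    x ⬝ᵥ x ≤ y ⬝ᵥ y :=
  Finset.sum_le_sum fun i _ => by nlinarith [sq_le_sq.2 (h i)]

open Finset in
/-- The part of a unit vector with large coordinates is sparse. -/
theorem card_large_le {n : ℕ} {m : ℝ} (hm : 0 < m) {x : Fin n → ℝ} (hx : x ⬝ᵥ x ≤ 1) :
    ((univ.filter fun i => 1 / √m < |x i|).card : ℝ) ≤ m := by
  have hs : 0 < √m := Real.sqrt_pos.2 hm
  have : ((univ.filter fun i => 1 / √m < |x i|).card : ℝ) * (1 / m) ≤ 1 := by
    calc _ = ∑ i ∈ univ.filter (fun i => 1 / √m < |x i|), 1 / m := by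
          rw [Finset.sum_const, nsmul_eq_mul]
      _ ≤ ∑ i ∈ univ.filter (fun i => 1 / √m < |x i|), x i * x i := by
        refine Finset.sum_le_sum fun i hi => ?_
        have h1 := (Finset.mem_filter.1 hi).2
        have h2 : (1 / √m) ^ 2 ≤ |x i| ^ 2 := by gcongr
        rw [div_pow, Real.sq_sqrt hm.le, sq_abs] at h2
        nlinarith
      _ ≤ x ⬝ᵥ x := Finset.sum_le_sum_of_subset_of_nonneg (Finset.filter_subset _ _)
        fun i _ _ => mul_self_nonneg (x i)
      _ ≤ 1 := hx
  rw [mul_one_div, div_le_one hm] at this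
  exact this

/-- A bilinear form is controlled by its values at pairs of flat lattice vectors, together with the
lengths of the images of sparse lattice vectors. -/
theorem OpBound.of_lattice {n : ℕ} {M : Matrix (Fin n) (Fin n) ℝ} {m T : ℝ} (hm : 0 < m)
    (hmn : m ≤ n) (hT : 0 ≤ T)
    (h1 : ∀ k l : Fin n → ℤ, ∑ i, (k i : ℝ) ^ 2 ≤ 16 * n → ∑ i, (l i : ℝ) ^ 2 ≤ 16 * n →
      (∀ i, |(k i : ℝ) / (4 * √n)| ≤ 1 / √m) → (∀ i, |(l i : ℝ) / (4 * √n)| ≤ 1 / √m) →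
      (fun i => (k i : ℝ) / (4 * √n)) ⬝ᵥ M *ᵥ (fun i => (l i : ℝ) / (4 * √n)) ≤ T)
    (h2 : ∀ k : Fin n → ℤ, ∑ i, (k i : ℝ) ^ 2 ≤ 16 * m →
      ((fun i => (k i : ℝ) / (4 * √m)) ᵥ* M) ⬝ᵥ ((fun i => (k i : ℝ) / (4 * √m)) ᵥ* M) ≤ T ^ 2)
    (h3 : ∀ k : Fin n → ℤ, ∑ i, (k i : ℝ) ^ 2 ≤ 16 * m →
      (M *ᵥ (fun i => (k i : ℝ) / (4 * √m))) ⬝ᵥ (M *ᵥ (fun i => (k i : ℝ) / (4 * √m))) ≤ T ^ 2) :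
    OpBound M (6 * T) := by
  have hn : (0 : ℝ) < n := hm.trans_le hmn
  have hsm : 0 < √m := Real.sqrt_pos.2 hm
  have hmn' : 1 / √(n : ℝ) ≤ 1 / √m := one_div_le_one_div_of_le hsm (Real.sqrt_le_sqrt hmn)
  let Ball : Set (Fin n → ℝ) := {x | x ⬝ᵥ x ≤ 1}
  let Flat : Set (Fin n → ℝ) := {x | x ⬝ᵥ x ≤ 1 ∧ ∀ i, |x i| ≤ 1 / √m}
  let Sparse : Set (Fin n → ℝ) :=
    {x | x ⬝ᵥ x ≤ 1 ∧ ((Finset.univ.filter fun i => x i ≠ 0).card : ℝ) ≤ m}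
  let Lat (r : ℝ) : Set (Fin n → ℝ) := {x | ∃ k : Fin n → ℤ, ∑ i, (k i : ℝ) ^ 2 ≤ 16 * r ∧
    x = fun i => (k i : ℝ) / (4 * √r)}
  have netFlat : ∀ x ∈ Flat, ∃ x' ∈ Flat ∩ Lat n, ∃ e ∈ Flat, x = x' + (1 / 4 : ℝ) • e := by
    rintro x ⟨hx, hxm⟩
    -- At mesh 1/(4√n) no sparsity is needed, a support having at most n elements; the remainder is
    -- flat at level 1/√n ≤ 1/√m.
    obtain ⟨k, e, hxe, he1, he2, -, hk⟩ := exists_round_vec n hn x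
      (by exact_mod_cast (Finset.card_le_univ _).trans_eq (by simp))
    exact ⟨_, ⟨⟨(dotProduct_self_le_of_abs_le hk).trans hx, fun i => (hk i).trans (hxm i)⟩,
      k, sum_sq_le_of_abs_le hn hx hk, rfl⟩, e, ⟨he1, fun i => (he2 i).trans hmn'⟩, hxe⟩
  have netSparse : ∀ x ∈ Sparse, ∃ x' ∈ Sparse ∩ Lat m, ∃ e ∈ Sparse,
      x = x' + (1 / 4 : ℝ) • e := by
    rintro x ⟨hx, hxm⟩
    obtain ⟨k, e, hxe, he1, -, he2, hk⟩ := exists_round_vec m hm x hxm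
    have hle : ∀ z : Fin n → ℝ, (∀ i, x i = 0 → z i = 0) →
        ((Finset.univ.filter fun i => z i ≠ 0).card : ℝ) ≤ m := fun z hz =>
      (Nat.cast_le.2 (Finset.card_le_card fun i hi => by
        simp only [Finset.mem_filter, Finset.mem_univ, true_and] at hi ⊢
        exact fun h => hi (hz i h))).trans hxm
    exact ⟨_, ⟨⟨(dotProduct_self_le_of_abs_le hk).trans hx, hle _ fun i hi => by
      simpa [hi] using hk i⟩,
      k, sum_sq_le_of_abs_le hm hx hk, rfl⟩, e, ⟨he1, hle e he2⟩, hxe⟩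
  -- The ball is its own net, with remainder 0: once one argument is a sparse lattice vector,
  -- Cauchy–Schwarz covers all choices of the other.
  have netBall : ∀ x ∈ Ball, ∃ x' ∈ Ball, ∃ e ∈ Ball, x = x' + (1 / 4 : ℝ) • e := fun x hx =>
    ⟨x, hx, 0, by simp [Ball], by simp⟩
  have hFF := bilin_le_of_net (M := M) (T := T) netFlat netFlat Set.inter_subset_left
    (fun x hx => hx.1) (fun x hx => hx.1) (by
      rintro x ⟨⟨-, hx⟩, k, hk, rfl⟩ y ⟨⟨-, hy⟩, l, hl, rfl⟩
      exact h1 k l hk hl hx hy)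
  have hSB := bilin_le_of_net (M := M) (T := T) netSparse netBall Set.inter_subset_left
    (fun x hx => hx.1) (fun x hx => hx) (by
      rintro x ⟨⟨-, hx⟩, k, hk, rfl⟩ y hy
      rw [Matrix.dotProduct_mulVec]
      refine (dotProduct_le_sqrt _ _).trans ?_
      calc _ ≤ √(T ^ 2) * √1 := by
            gcongr
            · exact h2 k hk
            · exact hy
        _ = T := by simp [Real.sqrt_sq hT])
  have hBS := bilin_le_of_net (M := Mᵀ) (T := T) netSparse netBall Set.inter_subset_left
    (fun x hx => hx.1) (fun x hx => hx) (by
      rintro x ⟨⟨-, hx⟩, k, hk, rfl⟩ y hy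
      rw [Matrix.dotProduct_mulVec, Matrix.vecMul_transpose]
      refine (dotProduct_le_sqrt _ _).trans ?_
      calc _ ≤ √(T ^ 2) * √1 := by
            gcongr
            · exact h3 k hk
            · exact hy
        _ = T := by simp [Real.sqrt_sq hT])
  have split : ∀ x ∈ Ball, ∃ xs ∈ Flat, ∃ xb ∈ Sparse, x = xs + xb := by
    intro x hx
    refine ⟨fun i => if 1 / √m < |x i| then 0 else x i, ⟨?_, ?_⟩,
      fun i => if 1 / √m < |x i| then x i else 0, ⟨?_, ?_⟩, ?_⟩
    · exact (dotProduct_self_le_of_abs_le fun i => by split_ifs <;> simp).trans hx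
    · intro i
      dsimp only
      split_ifs with h
      · simp
      · exact not_lt.1 h
    · exact (dotProduct_self_le_of_abs_le fun i => by split_ifs <;> simp).trans hx
    · refine le_trans ?_ (card_large_le hm hx)
      exact_mod_cast Finset.card_le_card fun i hi => by
        simp only [Finset.mem_filter, Finset.mem_univ, true_and] at hi ⊢
        by_contra h
        exact hi (if_neg h)
    · ext i; simp only [Pi.add_apply]; split_ifs <;> simp
  refine OpBound.of_unit fun x y hx hy => ?_
  obtain ⟨xs, hxs, xb, hxb, rfl⟩ := split x hx
  obtain ⟨ys, hys, yb, hyb, hy'⟩ := split y hy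
  have e1 := hFF xs hxs ys hys
  have e2 := hSB xb hxb y hy
  have e3 := hBS yb hyb xs hxs.1
  rw [Matrix.mulVec_transpose, dotProduct_comm, ← Matrix.dotProduct_mulVec] at e3
  -- Only the flat-flat pairing needs both nets; the other two terms have a sparse argument. Three
  -- terms of size `2 * T` give the factor 6.
  have : (xs + xb) ⬝ᵥ M *ᵥ y = xs ⬝ᵥ M *ᵥ ys + xs ⬝ᵥ M *ᵥ yb + xb ⬝ᵥ M *ᵥ y := by
    rw [add_dotProduct]
    conv_lhs => enter [1]; rw [hy', Matrix.mulVec_add, dotProduct_add]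
  rw [this]; linarith

/-! ### Exponential moments of weighted sums -/

section Concentration

set_option linter.unusedSectionVars false

variable {Ω : Type*} [MeasurableSpace Ω] {P : Measure Ω} [IsProbabilityMeasure P]

theorem integrable_of_abs_le {X : Ω → ℝ} (hX : Measurable X) {B : ℝ} (hB : ∀ ω, |X ω| ≤ B) :
    Integrable X P :=
  Integrable.of_mem_Icc (-B) B hX.aemeasurable (ae_of_all _ fun ω => abs_le.1 (hB ω))

theorem integrable_exp_of_abs_le {X : Ω → ℝ} (hX : Measurable X) {B : ℝ} (hB : ∀ ω, |X ω| ≤ B)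
    (t : ℝ) : Integrable (fun ω => Real.exp (t * X ω)) P :=
  integrable_exp_mul_of_mem_Icc hX.aemeasurable (ae_of_all _ fun ω => abs_le.1 (hB ω))

/-- The Bernstein bound on the moment generating function of a centered bounded variable. -/
theorem mgf_le_exp_variance {X : Ω → ℝ} (hX : Measurable X) {B V a : ℝ} (hB : ∀ ω, |X ω| ≤ B)
    (hmean : ∫ ω, X ω ∂P = 0) (hvar : ∫ ω, X ω ^ 2 ∂P ≤ V) (ha : |a| * B ≤ 1) :
    mgf X P a ≤ Real.exp (V * a ^ 2) := by
  have hi := integrable_of_abs_le (P := P) hX hB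
  have hi2 : Integrable (fun ω => X ω ^ 2) P :=
    integrable_of_abs_le (hX.pow_const 2) (B := B ^ 2) fun ω => by
      rw [abs_of_nonneg (sq_nonneg _), ← sq_abs]
      exact pow_le_pow_left₀ (abs_nonneg _) (hB ω) 2
  calc mgf X P a ≤ ∫ ω, (1 + a * X ω + a ^ 2 * X ω ^ 2) ∂P := by
        refine integral_mono (integrable_exp_of_abs_le hX hB a)
          (((integrable_const _).add (hi.const_mul a)).add (hi2.const_mul (a ^ 2))) fun ω => ?_
        have h1 : |a * X ω| ≤ 1 := by
          rw [abs_mul]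
          exact (mul_le_mul_of_nonneg_left (hB ω) (abs_nonneg a)).trans ha
        have := (abs_le.1 (Real.abs_exp_sub_one_sub_id_le h1)).2
        dsimp only
        nlinarith
    _ = 1 + a ^ 2 * ∫ ω, X ω ^ 2 ∂P := by
        rw [integral_add, integral_add, integral_const_mul, integral_const_mul, hmean]
        · simp
        · exact integrable_const _
        · exact hi.const_mul a
        · exact (integrable_const _).add (hi.const_mul a)
        · exact hi2.const_mul _
    _ ≤ 1 + V * a ^ 2 := by nlinarith [sq_nonneg a]
    _ ≤ _ := by linarith [Real.add_one_le_exp (V * a ^ 2)]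

variable {ι : Type*} [Fintype ι] {Y : ι → Ω → ℝ}

theorem mgf_weighted_sum (hind : iIndepFun Y P) (hY : ∀ e, Measurable (Y e)) (w : ι → ℝ)
    (s : Finset ι) (t : ℝ) :
    mgf (fun ω => ∑ e ∈ s, w e * Y e ω) P t = ∏ e ∈ s, mgf (Y e) P (w e * t) := by
  have h := (hind.comp (fun e x => w e * x) fun e => measurable_const_mul _).mgf_sum (t := t)
    (fun e => (hY e).const_mul (w e)) s
  have : (∑ e ∈ s, (fun x => w e * x) ∘ Y e) = fun ω => ∑ e ∈ s, w e * Y e ω := by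
    ext ω; simp
  rw [← this, h]
  exact Finset.prod_congr rfl fun e _ => mgf_const_mul _

theorem abs_weighted_sum_le {B : ℝ} (hB : ∀ e ω, |Y e ω| ≤ B) (w : ι → ℝ) (s : Finset ι)
    (ω : Ω) : |∑ e ∈ s, w e * Y e ω| ≤ ∑ e ∈ s, |w e| * B := by
  refine (Finset.abs_sum_le_sum_abs _ _).trans (Finset.sum_le_sum fun e _ => ?_)
  rw [abs_mul]
  exact mul_le_mul_of_nonneg_left (hB e ω) (abs_nonneg _)

/-- The Bernstein tail bound for weighted sums with small weights. -/
theorem measure_weighted_sum_ge_le (hind : iIndepFun Y P) (hY : ∀ e, Measurable (Y e))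
    {B V lam T : ℝ} (hB : ∀ e ω, |Y e ω| ≤ B) (hV : 0 ≤ V)
    (hmean : ∀ e, ∫ ω, Y e ω ∂P = 0) (hvar : ∀ e, ∫ ω, Y e ω ^ 2 ∂P ≤ V) (hlam : 0 ≤ lam)
    {w : ι → ℝ} (hw : ∀ e, |w e| * lam * B ≤ 1) (hw1 : ∑ e, w e ^ 2 ≤ 1) :
    P.real {ω | T ≤ ∑ e, w e * Y e ω} ≤ Real.exp (-lam * T + V * lam ^ 2) := by
  have hm : Measurable fun ω => ∑ e, w e * Y e ω :=
    Finset.measurable_sum _ fun e _ => (hY e).const_mul _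
  refine (measure_ge_le_exp_mul_mgf T hlam
    (integrable_exp_of_abs_le hm (abs_weighted_sum_le hB w _) lam)).trans ?_
  rw [Real.exp_add, mgf_weighted_sum hind hY]
  gcongr
  calc _ ≤ ∏ e, Real.exp (V * (w e * lam) ^ 2) := by
        refine Finset.prod_le_prod (fun e _ => mgf_nonneg) fun e _ => ?_
        refine mgf_le_exp_variance (hY e) (hB e) (hmean e) (hvar e) ?_
        rw [abs_mul, abs_of_nonneg hlam]
        exact hw e
    _ = Real.exp (V * lam ^ 2 * ∑ e, w e ^ 2) := by
        rw [← Real.exp_sum, Finset.mul_sum]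
        congr 1
        exact Finset.sum_congr rfl fun e _ => by ring
    _ ≤ _ := by
        apply Real.exp_le_exp.2
        nlinarith [mul_nonneg hV (sq_nonneg lam)]

/-- The exact value is √2, since the integrand times the normal density is a multiple of exp(-g²/4).
This is the constant left over by the Gaussian linearization in `integral_exp_sq_le`. -/
theorem lintegral_exp_sq_gaussian :
    ∫⁻ g, ENNReal.ofReal (Real.exp (g ^ 2 / 4)) ∂(gaussianReal 0 1) ≤ 2 := by
  rw [gaussianReal_of_var_ne_zero _ one_ne_zero,
    lintegral_withDensity_eq_lintegral_mul _ (measurable_gaussianPDF _ _) (by fun_prop)]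
  have : ∀ x : ℝ, (gaussianPDF 0 1 * fun g => ENNReal.ofReal (Real.exp (g ^ 2 / 4))) x =
      ENNReal.ofReal ((√(2 * Real.pi))⁻¹ * Real.exp (-(1 / 4) * x ^ 2)) := by
    intro x
    simp only [Pi.mul_apply, gaussianPDF]
    rw [← ENNReal.ofReal_mul (gaussianPDFReal_nonneg _ _ _), gaussianPDFReal, mul_assoc,
      ← Real.exp_add]
    congr 3
    · simp
    · simp; ring
  simp_rw [this]
  rw [← ofReal_integral_eq_lintegral_ofReal
    ((integrable_exp_neg_mul_sq (by norm_num)).const_mul _)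
    (ae_of_all _ fun x => by positivity), integral_const_mul, integral_gaussian,
    ← Real.sqrt_inv, ← Real.sqrt_mul (by positivity)]
  have : (2 * Real.pi)⁻¹ * (Real.pi / (1 / 4)) = 2 := by field_simp; norm_num
  rw [this]
  refine ENNReal.ofReal_le_of_le_toReal ?_
  norm_num [Real.sqrt_le_left]

/-- A bounded variable whose moment generating function is sub-Gaussian has a square-exponential
moment. -/
theorem integral_exp_sq_le {G : Ω → ℝ} (hG : Measurable G) {B D : ℝ} (hB : 0 < B)
    (hD : ∀ ω, |G ω| ≤ D) (hsub : ∀ t, mgf G P t ≤ Real.exp (B ^ 2 * t ^ 2 / 2)) :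
    ∫ ω, Real.exp (G ω ^ 2 / (4 * B ^ 2)) ∂P ≤ 2 := by
  set c := √(2 * (1 / (4 * B ^ 2))) with hc
  have hc2 : c ^ 2 = 1 / (2 * B ^ 2) := by
    rw [hc, Real.sq_sqrt (by positivity)]; field_simp; norm_num
  -- Gaussian linearization: exp(c²G²/2) is the mean of exp(cGg) over a standard normal g. Swapping
  -- the integrals replaces the square by the moment generating function of G at cg, which is at
  -- most exp(g²/4) for c² = 1/(2B²).
  have h1 : ∀ ω, ENNReal.ofReal (Real.exp (G ω ^ 2 / (4 * B ^ 2))) =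
      ∫⁻ g, ENNReal.ofReal (Real.exp (c * G ω * g)) ∂(gaussianReal 0 1) := by
    intro ω
    rw [← ofReal_integral_eq_lintegral_ofReal (integrable_exp_mul_gaussianReal _)
      (ae_of_all _ fun _ => (Real.exp_pos _).le)]
    have := congrFun (mgf_id_gaussianReal (μ := 0) (v := 1)) (c * G ω)
    simp only [mgf, id] at this
    rw [this]
    congr 2
    rw [mul_pow, hc2]; simp; field_simp; norm_num
  have h2 : ∫⁻ ω, ENNReal.ofReal (Real.exp (G ω ^ 2 / (4 * B ^ 2))) ∂P ≤ 2 := by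
    simp_rw [h1]
    rw [lintegral_lintegral_swap (by fun_prop)]
    refine (lintegral_mono fun g => ?_).trans lintegral_exp_sq_gaussian
    have h3 : (fun ω => Real.exp (c * G ω * g)) = fun ω => Real.exp (c * g * G ω) := by
      ext ω; ring_nf
    rw [← ofReal_integral_eq_lintegral_ofReal, h3]
    · refine ENNReal.ofReal_le_ofReal ((hsub (c * g)).trans (Real.exp_le_exp.2 ?_))
      rw [mul_pow, hc2]; apply le_of_eq; field_simp; ring
    · rw [h3]; exact integrable_exp_of_abs_le hG hD _
    · exact ae_of_all _ fun _ => (Real.exp_pos _).le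
  rw [integral_eq_lintegral_of_nonneg_ae (ae_of_all _ fun _ => (Real.exp_pos _).le)
    (by fun_prop)]
  exact ENNReal.toReal_le_of_le_ofReal (by norm_num) (by simpa using h2)

/-- Interpolation between the second moment and a square-exponential moment. -/
theorem mgf_sq_le {G : Ω → ℝ} (hG : Measurable G) {B D V : ℝ} (hB : 1 ≤ B)
    (hD : ∀ ω, |G ω| ≤ D) (hsub : ∀ t, mgf G P t ≤ Real.exp (B ^ 2 * t ^ 2 / 2))
    (hvar : ∫ ω, G ω ^ 2 ∂P ≤ V) :
    mgf (fun ω => G ω ^ 2) P (1 / (16 * B ^ 4)) ≤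
      Real.exp (1 / (16 * B ^ 4) * (V + 16)) := by
  set r := 1 / (4 * B ^ 2) with hr
  have hr0 : 0 < r := by positivity
  have hr1 : r ≤ 1 / 4 := one_div_le_one_div_of_le (by norm_num) (by nlinarith)
  have hη : 1 / (16 * B ^ 4) = r ^ 2 := by rw [hr]; field_simp; norm_num
  have hpt : ∀ ω, Real.exp (r ^ 2 * G ω ^ 2) ≤
      1 + r ^ 2 * G ω ^ 2 + 8 * r ^ 2 * Real.exp (G ω ^ 2 / (4 * B ^ 2)) := by
    intro ω
    set u := G ω ^ 2 / (4 * B ^ 2) with hu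
    have hu0 : 0 ≤ u := by positivity
    have hru : r ^ 2 * G ω ^ 2 = r * u := by rw [hu, hr]; field_simp
    rw [hru]
    -- With y = ru ≥ 0, apply (1 - y)eʸ ≤ 1 twice: eʸ ≤ 1 + y eʸ ≤ 1 + y + y² eʸ.
    have h1 : Real.exp (r * u) ≤ 1 + r * u + (r * u) ^ 2 * Real.exp (r * u) := by
      have h := Real.add_one_le_exp (-(r * u))
      rw [Real.exp_neg] at h
      have hpos := Real.exp_pos (r * u)
      have h2 : (-(r * u) + 1) * Real.exp (r * u) ≤ 1 := by
        calc _ ≤ (Real.exp (r * u))⁻¹ * Real.exp (r * u) := by gcongr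
          _ = 1 := inv_mul_cancel₀ hpos.ne'
      have h3 : 0 ≤ r * u := by positivity
      nlinarith
    have h2 : u ^ 2 ≤ 8 * Real.exp (u / 2) := by
      have := Real.quadratic_le_exp_of_nonneg (x := u / 2) (by positivity)
      nlinarith
    -- Here u² is absorbed by exp(u/2), and r ≤ 1/4 keeps the total exponent below u. The 8, times
    -- the bound 2 for the square-exponential moment, is the 16 in the statement.
    have h3 : u ^ 2 * Real.exp (r * u) ≤ 8 * Real.exp u := by
      calc u ^ 2 * Real.exp (r * u) ≤ 8 * Real.exp (u / 2) * Real.exp (r * u) := by gcongr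
        _ = 8 * Real.exp (u / 2 + r * u) := by rw [mul_assoc, ← Real.exp_add]
        _ ≤ _ := by gcongr; nlinarith
    nlinarith [sq_nonneg r]
  have hGsq : ∀ ω, |G ω ^ 2| ≤ D ^ 2 := fun ω => by
    rw [abs_of_nonneg (sq_nonneg _), ← sq_abs]
    exact pow_le_pow_left₀ (abs_nonneg _) (hD ω) 2
  have hi2 : Integrable (fun ω => G ω ^ 2) P := integrable_of_abs_le (hG.pow_const 2) hGsq
  have hie : Integrable (fun ω => Real.exp (G ω ^ 2 / (4 * B ^ 2))) P := by
    have := integrable_exp_of_abs_le (P := P) (hG.pow_const 2) hGsq (1 / (4 * B ^ 2))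
    refine this.congr (ae_of_all _ fun ω => ?_)
    dsimp only; congr 1; ring
  have hexp := integral_exp_sq_le hG (zero_lt_one.trans_le hB) hD hsub
  rw [hη]
  calc mgf (fun ω => G ω ^ 2) P (r ^ 2) ≤ ∫ ω, (1 + r ^ 2 * G ω ^ 2 +
        8 * r ^ 2 * Real.exp (G ω ^ 2 / (4 * B ^ 2))) ∂P :=
        integral_mono (integrable_exp_of_abs_le (hG.pow_const 2) hGsq _)
          (((integrable_const _).add (hi2.const_mul _)).add (hie.const_mul _)) hpt
    _ = 1 + r ^ 2 * ∫ ω, G ω ^ 2 ∂P + 8 * r ^ 2 * ∫ ω, Real.exp (G ω ^ 2 / (4 * B ^ 2)) ∂P := by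
        rw [integral_add, integral_add, integral_const_mul, integral_const_mul]
        · simp
        · exact integrable_const _
        · exact hi2.const_mul _
        · exact (integrable_const _).add (hi2.const_mul _)
        · exact hie.const_mul _
    _ ≤ r ^ 2 * (V + 16) + 1 := by nlinarith [sq_nonneg r]
    _ ≤ _ := Real.add_one_le_exp _

theorem integral_weighted_sum_sq_le (hind : iIndepFun Y P) (hY : ∀ e, Measurable (Y e))
    {B V : ℝ} (hB : ∀ e ω, |Y e ω| ≤ B) (hV : 0 ≤ V)
    (hmean : ∀ e, ∫ ω, Y e ω ∂P = 0) (hvar : ∀ e, ∫ ω, Y e ω ^ 2 ∂P ≤ V)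
    (w : ι → ℝ) (s : Finset ι) (hw : ∑ e ∈ s, w e ^ 2 ≤ 1) :
    ∫ ω, (∑ e ∈ s, w e * Y e ω) ^ 2 ∂P ≤ V := by
  have hm : Measurable fun ω => ∑ e ∈ s, w e * Y e ω :=
    Finset.measurable_sum _ fun e _ => (hY e).const_mul _
  have hi : ∀ e, Integrable (Y e) P := fun e => integrable_of_abs_le (hY e) (hB e)
  have hmean' : ∫ ω, ∑ e ∈ s, w e * Y e ω ∂P = 0 := by
    rw [integral_finsetSum _ fun e _ => (hi e).const_mul _]
    simp [integral_const_mul, hmean]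
  rw [← variance_of_integral_eq_zero hm.aemeasurable hmean']
  have heq : (fun ω => ∑ e ∈ s, w e * Y e ω) = ∑ e ∈ s, fun ω => w e * Y e ω := by
    ext ω; simp
  have hind' := hind.comp (fun e x => w e * x) fun e => measurable_const_mul (w e)
  rw [heq, IndepFun.variance_sum]
  · calc _ ≤ ∑ e ∈ s, V * w e ^ 2 := by
          refine Finset.sum_le_sum fun e _ => ?_
          rw [variance_const_mul, variance_of_integral_eq_zero (hY e).aemeasurable (hmean e)]
          nlinarith [hvar e, sq_nonneg (w e)]
      _ = V * ∑ e ∈ s, w e ^ 2 := by rw [Finset.mul_sum]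
      _ ≤ _ := by nlinarith
  · intro e _
    refine MemLp.of_bound ((hY e).const_mul _).aestronglyMeasurable (|w e| * B)
      (ae_of_all _ fun ω => ?_)
    rw [Real.norm_eq_abs, abs_mul]
    exact mul_le_mul_of_nonneg_left (hB e ω) (abs_nonneg _)
  · intro e _ f _ hef
    exact hind'.indepFun hef

/-- Sums over disjoint blocks of independent variables: the moment generating function of the sum
of squares factorizes. -/
theorem mgf_sum_blocks {κ : Type*} [DecidableEq κ] (hind : iIndepFun Y P)
    (hY : ∀ e, Measurable (Y e)) (w : ι → ℝ) (c : ι → κ) (s : Finset κ) (t : ℝ) :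
    mgf (fun ω => ∑ j ∈ s, (∑ e with c e = j, w e * Y e ω) ^ 2) P t =
      ∏ j ∈ s, mgf (fun ω => (∑ e with c e = j, w e * Y e ω) ^ 2) P t := by
  classical
  induction s using Finset.induction_on with
  | empty => simp
  | insert j s hj ih =>
    rw [Finset.prod_insert hj, ← ih]
    simp only [Finset.sum_insert hj]
    let S : Finset ι := Finset.univ.filter fun e => c e = j
    let T : Finset ι := Finset.univ.filter fun e => c e ∈ s
    have hST : Disjoint S T := by
      rw [Finset.disjoint_left]
      intro e he he'
      simp only [S, T, Finset.mem_filter, Finset.mem_univ, true_and] at he he'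
      exact hj (he ▸ he')
    have hI := hind.indepFun_finset S T hST hY
    let φ : (S → ℝ) → ℝ := fun y => (∑ e : S, w e * y e) ^ 2
    let ψ : (T → ℝ) → ℝ := fun y => ∑ i ∈ s, (∑ e : T, (if c e = i then w e else 0) * y e) ^ 2
    have hφ : Measurable φ := by fun_prop
    have hψ : Measurable ψ := by fun_prop
    have h1 : (φ ∘ fun a (i : S) => Y i a) = fun ω => (∑ e with c e = j, w e * Y e ω) ^ 2 := by
      ext ω
      simp only [φ, Function.comp]
      rw [← Finset.sum_coe_sort (Finset.univ.filter fun e => c e = j)]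
    have h2 : (ψ ∘ fun a (i : T) => Y i a) =
        fun ω => ∑ i ∈ s, (∑ e with c e = i, w e * Y e ω) ^ 2 := by
      ext ω
      simp only [ψ, Function.comp]
      refine Finset.sum_congr rfl fun i hi => ?_
      congr 1
      rw [Finset.sum_coe_sort T (fun e => (if c e = i then w e else 0) * Y e ω),
        Finset.sum_filter, Finset.sum_filter]
      refine Finset.sum_congr rfl fun e _ => ?_
      by_cases h : c e = i
      · simp [h, hi]
      · simp [h]
    have hI' := hI.comp hφ hψ
    rw [h1, h2] at hI'
    have m1 : Measurable fun ω => (∑ e with c e = j, w e * Y e ω) ^ 2 := by fun_prop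
    have m2 : Measurable fun ω => ∑ i ∈ s, (∑ e with c e = i, w e * Y e ω) ^ 2 := by fun_prop
    exact hI'.mgf_add (by fun_prop) (by fun_prop)

/-- The tail of a sum of squares of block sums. -/
theorem measure_sum_sq_blocks_ge_le {κ : Type*} [Fintype κ] [DecidableEq κ]
    (hind : iIndepFun Y P) (hY : ∀ e, Measurable (Y e))
    {B V T : ℝ} (hB1 : 1 ≤ B) (hB : ∀ e ω, |Y e ω| ≤ B) (hV : 0 ≤ V)
    (hmean : ∀ e, ∫ ω, Y e ω ∂P = 0) (hvar : ∀ e, ∫ ω, Y e ω ^ 2 ∂P ≤ V)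
    (w : ι → ℝ) (c : ι → κ) (hw : ∀ j, ∑ e with c e = j, w e ^ 2 ≤ 1) :
    P.real {ω | T ≤ ∑ j, (∑ e with c e = j, w e * Y e ω) ^ 2} ≤
      Real.exp (-(1 / (16 * B ^ 4)) * (T - Fintype.card κ * (V + 16))) := by
  have hη : 0 < 1 / (16 * B ^ 4) := by positivity
  have hG : ∀ j, Measurable fun ω => ∑ e with c e = j, w e * Y e ω := fun j => by fun_prop
  have hm : Measurable fun ω => ∑ j, (∑ e with c e = j, w e * Y e ω) ^ 2 := by fun_prop
  have hbd : ∀ ω, |∑ j, (∑ e with c e = j, w e * Y e ω) ^ 2| ≤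
      ∑ j, (∑ e with c e = j, |w e| * B) ^ 2 := fun ω => by
    rw [abs_of_nonneg (Finset.sum_nonneg fun _ _ => sq_nonneg _)]
    refine Finset.sum_le_sum fun j _ => ?_
    rw [← sq_abs]
    exact pow_le_pow_left₀ (abs_nonneg _) (abs_weighted_sum_le hB w _ ω) 2
  -- Hoeffding's lemma, with variance proxy B². The true variance V enters separately, through the
  -- second moment in `mgf_sq_le`; this keeps the mean term V + 16 free of B.
  have hsub : ∀ j t, mgf (fun ω => ∑ e with c e = j, w e * Y e ω) P t ≤
      Real.exp (B ^ 2 * t ^ 2 / 2) := by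
    intro j t
    rw [mgf_weighted_sum hind hY]
    calc _ ≤ ∏ e with c e = j, Real.exp (B ^ 2 * (w e * t) ^ 2 / 2) := by
          refine Finset.prod_le_prod (fun e _ => mgf_nonneg) fun e _ => ?_
          have := (hasSubgaussianMGF_of_mem_Icc_of_integral_eq_zero (hY e).aemeasurable
            (ae_of_all P fun ω => abs_le.1 (hB e ω)) (hmean e)).mgf_le (w e * t)
          refine this.trans (le_of_eq ?_)
          congr 3
          push_cast
          rw [Real.norm_eq_abs, show B - -B = 2 * B by ring, abs_of_nonneg (by linarith)]
          ring
      _ = Real.exp (B ^ 2 * t ^ 2 / 2 * ∑ e with c e = j, w e ^ 2) := by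
          rw [← Real.exp_sum, Finset.mul_sum]
          congr 1
          exact Finset.sum_congr rfl fun e _ => by ring
      _ ≤ _ := by
          apply Real.exp_le_exp.2
          have : 0 ≤ B ^ 2 * t ^ 2 / 2 := by positivity
          nlinarith [hw j]
  refine (measure_ge_le_exp_mul_mgf T hη.le (integrable_exp_of_abs_le hm hbd _)).trans ?_
  rw [mgf_sum_blocks hind hY]
  calc _ ≤ Real.exp (-(1 / (16 * B ^ 4)) * T) *
        ∏ _j : κ, Real.exp (1 / (16 * B ^ 4) * (V + 16)) := by
        gcongr with j hj
        · exact fun _ _ => mgf_nonneg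
        rename_i j _
        exact mgf_sq_le (hG j) hB1 (abs_weighted_sum_le hB w _) (hsub j)
          (integral_weighted_sum_sq_le hind hY hB hV hmean hvar w _ (hw j))
    _ = _ := by
        rw [Finset.prod_const, Finset.card_univ, ← Real.exp_nat_mul, ← Real.exp_add]
        congr 1; ring

end Concentration

/-! ### Random strictly upper triangular matrices -/

/-- The pairs `i < j` indexing the entries above the diagonal. -/
abbrev UpperPair (n : ℕ) : Type := {e : Fin n × Fin n // e.1 < e.2}

/-- The strictly upper triangular matrix with given entries. -/
def upperMat {n : ℕ} (y : UpperPair n → ℝ) : Matrix (Fin n) (Fin n) ℝ :=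
  Matrix.of fun i j => if h : i < j then y ⟨(i, j), h⟩ else 0

theorem sum_upperPair {n : ℕ} (f : Fin n → Fin n → ℝ) (y : UpperPair n → ℝ) :
    ∑ e : UpperPair n, f e.1.1 e.1.2 * y e = ∑ i, ∑ j, f i j * upperMat y i j := by
  rw [← Finset.sum_product', Finset.univ_product_univ]
  have h1 : ∑ p : Fin n × Fin n, f p.1 p.2 * upperMat y p.1 p.2 =
      ∑ p : Fin n × Fin n with p.1 < p.2, f p.1 p.2 * upperMat y p.1 p.2 := by
    rw [Finset.sum_filter]
    refine Finset.sum_congr rfl fun p _ => ?_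
    split_ifs with h
    · rfl
    · simp [upperMat, h]
  rw [h1, Finset.sum_subtype (p := fun p : Fin n × Fin n => p.1 < p.2) _ (by simp)]
  refine Finset.sum_congr rfl fun e _ => ?_
  simp [upperMat, e.2]

theorem dotProduct_upperMat {n : ℕ} (x z : Fin n → ℝ) (y : UpperPair n → ℝ) :
    x ⬝ᵥ upperMat y *ᵥ z = ∑ e : UpperPair n, x e.1.1 * z e.1.2 * y e := by
  rw [sum_upperPair fun i j => x i * z j]
  simp only [dotProduct, Matrix.mulVec, Finset.mul_sum]
  exact Finset.sum_congr rfl fun i _ => Finset.sum_congr rfl fun j _ => by ring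

/-- Distinct columns use disjoint sets of pairs, so for independent entries the coordinates of this
vector are independent. For a symmetric matrix they would share entries, which is why one triangle
is treated at a time. -/
theorem vecMul_upperMat {n : ℕ} (x : Fin n → ℝ) (y : UpperPair n → ℝ) (j : Fin n) :
    (x ᵥ* upperMat y) j = ∑ e : UpperPair n with e.1.2 = j, x e.1.1 * y e := by
  rw [Finset.sum_filter]
  have := sum_upperPair (fun i l => if l = j then x i else 0) y
  simp only [ite_mul, zero_mul] at this
  rw [this]
  simp [Matrix.vecMul, dotProduct]

theorem upperMat_mulVec {n : ℕ} (x : Fin n → ℝ) (y : UpperPair n → ℝ) (i : Fin n) :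
    (upperMat y *ᵥ x) i = ∑ e : UpperPair n with e.1.1 = i, x e.1.2 * y e := by
  rw [Finset.sum_filter]
  have := sum_upperPair (fun l j => if l = i then x j else 0) y
  simp only [ite_mul, zero_mul] at this
  rw [this, Finset.sum_comm]
  simp [Matrix.mulVec, dotProduct, mul_comm]

theorem sum_sq_div {n : ℕ} {m : ℝ} (hm : 0 < m) {k : Fin n → ℤ}
    (hk : ∑ i, (k i : ℝ) ^ 2 ≤ 16 * m) : ∑ i, ((k i : ℝ) / (4 * √m)) ^ 2 ≤ 1 := by
  have : ∑ i, ((k i : ℝ) / (4 * √m)) ^ 2 = (∑ i, (k i : ℝ) ^ 2) / (16 * m) := by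
    rw [Finset.sum_div]
    refine Finset.sum_congr rfl fun i _ => ?_
    rw [div_pow, mul_pow, Real.sq_sqrt hm.le]; norm_num
  rw [this, div_le_one (by positivity)]
  exact hk

theorem measureReal_biUnion_le_card {Ω : Type*} [MeasurableSpace Ω] {P : Measure Ω}
    [IsProbabilityMeasure P] {β : Type*} (s : Finset β) (f : β → Set Ω) {c : ℝ}
    (h : ∀ b ∈ s, P.real (f b) ≤ c) : P.real (⋃ b ∈ s, f b) ≤ s.card * c :=
  (measureReal_biUnion_finset_le s f).trans
    ((Finset.sum_le_sum h).trans_eq (by simp))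

-- Union bound over the lattice vectors of `OpBound.of_lattice`. The first term is exp(36n) flat
-- pairs times a Bernstein tail. The second is the number of sparse lattice vectors, counted with
-- the free weight `lam`, times the tail of the squared length of an image, once for rows and once
-- for columns.
open Finset in
theorem measure_not_opBound_upperMat_le {n : ℕ} {Ω : Type*} [MeasurableSpace Ω] {P : Measure Ω}
    [IsProbabilityMeasure P] {Y : UpperPair n → Ω → ℝ} (hind : iIndepFun Y P)
    (hY : ∀ e, Measurable (Y e)) {B V T m lam : ℝ} (hB1 : 1 ≤ B) (hB : ∀ e ω, |Y e ω| ≤ B)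
    (hV : 0 ≤ V) (hmean : ∀ e, ∫ ω, Y e ω ∂P = 0) (hvar : ∀ e, ∫ ω, Y e ω ^ 2 ∂P ≤ V)
    (hm : 0 < m) (hmn : m ≤ n) (hT : 0 ≤ T) (hlam : 1 ≤ lam) (hbern : √n * B ≤ m) :
    P.real {ω | ¬ OpBound (upperMat fun e => Y e ω) (6 * (T * √n))} ≤
      Real.exp (36 * n + V * n - T * n) +
      2 * Real.exp (lam * (16 * m) + 4 * Real.exp (-lam) * n -
        1 / (16 * B ^ 4) * (T ^ 2 * n - n * (V + 16))) := by
  have hn : (0 : ℝ) < n := hm.trans_le hmn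
  have hsm : 0 < √m := Real.sqrt_pos.2 hm
  have hsn : 0 < √(n : ℝ) := Real.sqrt_pos.2 hn
  -- The box only serves to make the family finite: an integer satisfies |k i| ≤ (k i)² ≤ 16n.
  let Box (r : ℝ) : Finset (Fin n → ℤ) :=
    (Fintype.piFinset fun _ : Fin n => Finset.Icc (-((16 * n : ℕ) : ℤ)) ((16 * n : ℕ) : ℤ)).filter
      fun k => ∑ i, (k i : ℝ) ^ 2 ≤ 16 * r
  have memBox : ∀ {r : ℝ}, r ≤ n → ∀ k : Fin n → ℤ, ∑ i, (k i : ℝ) ^ 2 ≤ 16 * r → k ∈ Box r := by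
    intro r hr k hk
    refine Finset.mem_filter.2 ⟨Fintype.mem_piFinset.2 fun i => ?_, hk⟩
    have h1 : (k i : ℝ) ^ 2 ≤ 16 * n :=
      ((Finset.single_le_sum (f := fun i => (k i : ℝ) ^ 2) (fun i _ => sq_nonneg _)
        (Finset.mem_univ i)).trans hk).trans (by linarith)
    have h2 : (k i) ^ 2 ≤ ((16 * n : ℕ) : ℤ) := by exact_mod_cast h1
    rw [Finset.mem_Icc]
    have h3 := Int.le_self_sq (k i)
    have h4 := Int.le_self_sq (-k i)
    rw [neg_sq] at h4
    constructor <;> linarith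
  let vec (r : ℝ) (k : Fin n → ℤ) : Fin n → ℝ := fun i => (k i : ℝ) / (4 * √r)
  let FlatBox := (Box n).filter fun k => ∀ i, |vec n k i| ≤ 1 / √m
  let ev1 (p : (Fin n → ℤ) × (Fin n → ℤ)) : Set Ω :=
    {ω | T * √n ≤ ∑ e : UpperPair n, vec n p.1 e.1.1 * vec n p.2 e.1.2 * Y e ω}
  let ev2 (k : Fin n → ℤ) : Set Ω :=
    {ω | T ^ 2 * n ≤ ∑ j, (∑ e : UpperPair n with e.1.2 = j, vec m k e.1.1 * Y e ω) ^ 2}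
  let ev3 (k : Fin n → ℤ) : Set Ω :=
    {ω | T ^ 2 * n ≤ ∑ i, (∑ e : UpperPair n with e.1.1 = i, vec m k e.1.2 * Y e ω) ^ 2}
  have hsub : {ω | ¬ OpBound (upperMat fun e => Y e ω) (6 * (T * √n))} ⊆
      (⋃ p ∈ FlatBox ×ˢ FlatBox, ev1 p) ∪ ((⋃ k ∈ Box m, ev2 k) ∪ ⋃ k ∈ Box m, ev3 k) := by
    intro ω hω
    by_contra hcon
    simp only [Set.mem_union, Set.mem_iUnion, not_or, not_exists] at hcon
    obtain ⟨c1, c2, c3⟩ := hcon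
    refine hω (OpBound.of_lattice hm hmn (by positivity) ?_ ?_ ?_)
    · intro k l hk hl hk' hl'
      have := c1 (k, l) (Finset.mem_product.2 ⟨Finset.mem_filter.2 ⟨memBox le_rfl k hk, hk'⟩,
        Finset.mem_filter.2 ⟨memBox le_rfl l hl, hl'⟩⟩)
      rw [dotProduct_upperMat]
      exact (not_le.1 this).le
    · intro k hk
      have := c2 k (memBox hmn k hk)
      rw [mul_pow, Real.sq_sqrt hn.le]
      refine le_trans (le_of_eq ?_) (not_le.1 this).le
      rw [dotProduct]
      refine Finset.sum_congr rfl fun j _ => ?_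
      rw [vecMul_upperMat, sq]
    · intro k hk
      have := c3 k (memBox hmn k hk)
      rw [mul_pow, Real.sq_sqrt hn.le]
      refine le_trans (le_of_eq ?_) (not_le.1 this).le
      rw [dotProduct]
      refine Finset.sum_congr rfl fun j _ => ?_
      rw [upperMat_mulVec, sq]
  have hvecm : ∀ k ∈ Box m, ∑ i, vec m k i ^ 2 ≤ 1 := fun k hk =>
    sum_sq_div hm (Finset.mem_filter.1 hk).2
  have hvecn : ∀ k ∈ Box n, ∑ i, vec n k i ^ 2 ≤ 1 := fun k hk =>
    sum_sq_div hn (Finset.mem_filter.1 hk).2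
  have p1 : ∀ p ∈ FlatBox ×ˢ FlatBox, P.real (ev1 p) ≤ Real.exp (V * n - T * n) := by
    intro p hp
    obtain ⟨hp1, hp2⟩ := Finset.mem_product.1 hp
    obtain ⟨hp1, hf1⟩ := Finset.mem_filter.1 hp1
    obtain ⟨hp2, hf2⟩ := Finset.mem_filter.1 hp2
    -- Bernstein at parameter √n. Flatness bounds every weight by 1/m, so `hbern` is the required
    -- smallness of weight times √n times B.
    have := measure_weighted_sum_ge_le (T := T * √n) hind hY hB hV hmean hvar hsn.le
      (w := fun e => vec n p.1 e.1.1 * vec n p.2 e.1.2) (fun e => by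
        rw [abs_mul]
        calc _ ≤ 1 / √m * (1 / √m) * √n * B := by
              gcongr
              · exact hf1 _
              · exact hf2 _
          _ = (√n * B) / m := by
              rw [div_mul_div_comm, Real.mul_self_sqrt hm.le]; ring
          _ ≤ 1 := (div_le_one hm).2 hbern) (by
        calc ∑ e : UpperPair n, (vec n p.1 e.1.1 * vec n p.2 e.1.2) ^ 2
            = ∑ e : UpperPair n, (fun q : Fin n × Fin n => vec n p.1 q.1 ^ 2 * vec n p.2 q.2 ^ 2) e :=
              Finset.sum_congr rfl fun e _ => by rw [mul_pow]
          _ = ∑ q : Fin n × Fin n with q.1 < q.2, vec n p.1 q.1 ^ 2 * vec n p.2 q.2 ^ 2 := by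
              rw [Finset.sum_subtype (p := fun p : Fin n × Fin n => p.1 < p.2) _ (by simp)]
          _ ≤ ∑ q : Fin n × Fin n, vec n p.1 q.1 ^ 2 * vec n p.2 q.2 ^ 2 :=
              Finset.sum_le_sum_of_subset_of_nonneg (Finset.filter_subset _ _)
                fun _ _ _ => by positivity
          _ = (∑ i, vec n p.1 i ^ 2) * ∑ i, vec n p.2 i ^ 2 := by
              rw [Finset.sum_mul_sum, ← Finset.sum_product', Finset.univ_product_univ]
          _ ≤ 1 * 1 := mul_le_mul (hvecn _ hp1) (hvecn _ hp2)
              (Finset.sum_nonneg fun _ _ => sq_nonneg _) zero_le_one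
          _ = 1 := one_mul 1)
    refine this.trans (le_of_eq ?_)
    congr 1
    rw [Real.sq_sqrt hn.le]
    have := Real.mul_self_sqrt hn.le
    linear_combination (-T) * this
  have blockle : ∀ (c d : UpperPair n → Fin n), Function.Injective (fun e => (c e, d e)) →
      ∀ k ∈ Box m, ∀ j, ∑ e with c e = j, vec m k (d e) ^ 2 ≤ 1 := by
    intro c d hcd k hk j
    refine le_trans ?_ (hvecm k hk)
    rw [← Finset.sum_image (s := Finset.univ.filter fun e => c e = j) (g := d)
      (f := fun i => vec m k i ^ 2)]
    · exact Finset.sum_le_sum_of_subset_of_nonneg (Finset.subset_univ _)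
        fun _ _ _ => sq_nonneg _
    · intro e he f hf hef
      simp only [Finset.coe_filter, Finset.mem_univ, true_and, Set.mem_ofPred_eq] at he hf
      exact hcd (by simp [he, hf, hef])
  have p2 : ∀ k ∈ Box m, P.real (ev2 k) ≤
      Real.exp (-(1 / (16 * B ^ 4)) * (T ^ 2 * n - n * (V + 16))) := by
    intro k hk
    have := measure_sum_sq_blocks_ge_le (T := T ^ 2 * n) hind hY hB1 hB hV hmean hvar
      (fun e => vec m k e.1.1) (fun e : UpperPair n => e.1.2)
      (blockle _ _ (fun e f h => by
        simp only [Prod.mk.injEq] at h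
        exact Subtype.ext (Prod.ext h.2 h.1)) k hk)
    rwa [Fintype.card_fin] at this
  have p3 : ∀ k ∈ Box m, P.real (ev3 k) ≤
      Real.exp (-(1 / (16 * B ^ 4)) * (T ^ 2 * n - n * (V + 16))) := by
    intro k hk
    have := measure_sum_sq_blocks_ge_le (T := T ^ 2 * n) hind hY hB1 hB hV hmean hvar
      (fun e => vec m k e.1.2) (fun e : UpperPair n => e.1.1)
      (blockle _ _ (fun e f h => by
        simp only [Prod.mk.injEq] at h
        exact Subtype.ext (Prod.ext h.1 h.2)) k hk)
    rwa [Fintype.card_fin] at this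
  -- The counting bound at weight 1: 16n + 4n/e ≤ 18n. Pairs then account for the 36n.
  have c1 : ((Box n).card : ℝ) ≤ Real.exp (18 * n) := by
    refine (card_lattice_le n (16 * n) (16 * n) 1 le_rfl).trans (Real.exp_le_exp.2 ?_)
    have h2 : Real.exp (-1) ≤ 1 / 2 := by
      rw [Real.exp_neg, inv_eq_one_div]
      apply one_div_le_one_div_of_le (by norm_num)
      linarith [Real.add_one_le_exp (1 : ℝ)]
    nlinarith
  have c2 : ((Box m).card : ℝ) ≤ Real.exp (lam * (16 * m) + 4 * Real.exp (-lam) * n) :=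
    card_lattice_le n (16 * n) (16 * m) lam hlam
  have q1 : P.real (⋃ p ∈ FlatBox ×ˢ FlatBox, ev1 p) ≤ Real.exp (36 * n + V * n - T * n) := by
    refine (measureReal_biUnion_le_card _ _ p1).trans ?_
    have : ((FlatBox ×ˢ FlatBox).card : ℝ) ≤ Real.exp (18 * n) * Real.exp (18 * n) := by
      rw [Finset.card_product, Nat.cast_mul]
      have : (FlatBox.card : ℝ) ≤ Real.exp (18 * n) :=
        (Nat.cast_le.2 (Finset.card_filter_le _ _)).trans c1
      gcongr
    calc _ ≤ Real.exp (18 * n) * Real.exp (18 * n) * Real.exp (V * n - T * n) := by gcongr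
      _ = _ := by rw [← Real.exp_add, ← Real.exp_add]; congr 1; ring
  have q23 : ∀ ev : (Fin n → ℤ) → Set Ω, (∀ k ∈ Box m, P.real (ev k) ≤
      Real.exp (-(1 / (16 * B ^ 4)) * (T ^ 2 * n - n * (V + 16)))) →
      P.real (⋃ k ∈ Box m, ev k) ≤ Real.exp (lam * (16 * m) + 4 * Real.exp (-lam) * n -
        1 / (16 * B ^ 4) * (T ^ 2 * n - n * (V + 16))) := by
    intro ev hev
    refine (measureReal_biUnion_le_card _ _ hev).trans ?_
    calc _ ≤ Real.exp (lam * (16 * m) + 4 * Real.exp (-lam) * n) *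
          Real.exp (-(1 / (16 * B ^ 4)) * (T ^ 2 * n - n * (V + 16))) := by gcongr
      _ = _ := by rw [← Real.exp_add]; congr 1; ring
  calc _ ≤ P.real ((⋃ p ∈ FlatBox ×ˢ FlatBox, ev1 p) ∪
        ((⋃ k ∈ Box m, ev2 k) ∪ ⋃ k ∈ Box m, ev3 k)) := measureReal_mono hsub
    _ ≤ _ := by
      have e1 := measureReal_union_le (μ := P) (⋃ p ∈ FlatBox ×ˢ FlatBox, ev1 p)
        ((⋃ k ∈ Box m, ev2 k) ∪ ⋃ k ∈ Box m, ev3 k)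
      have e2 := measureReal_union_le (μ := P) (⋃ k ∈ Box m, ev2 k) (⋃ k ∈ Box m, ev3 k)
      linarith [q23 ev2 p2, q23 ev3 p3]

theorem OpBound.of_abs_entry_le {n : ℕ} {M : Matrix (Fin n) (Fin n) ℝ} {c : ℝ}
    (h : ∀ i j, |M i j| ≤ c) : OpBound M (c * n) := by
  rcases Nat.eq_zero_or_pos n with hn | hn
  · subst hn; intro u v; simp [dotProduct]
  have hc : 0 ≤ c := (abs_nonneg _).trans (h ⟨0, hn⟩ ⟨0, hn⟩)
  have hsum : ∀ x : Fin n → ℝ, ∑ i, |x i| ≤ √n * √(x ⬝ᵥ x) := fun x => by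
    have := dotProduct_le_sqrt (fun _ : Fin n => (1 : ℝ)) fun i => |x i|
    simpa [dotProduct] using this
  intro u v
  calc u ⬝ᵥ M *ᵥ v ≤ ∑ i, ∑ j, c * (|u i| * |v j|) := by
        simp only [dotProduct, Matrix.mulVec, Finset.mul_sum]
        refine Finset.sum_le_sum fun i _ => Finset.sum_le_sum fun j _ => ?_
        refine (le_abs_self _).trans ?_
        rw [abs_mul, abs_mul]
        have := h i j
        calc |u i| * (|M i j| * |v j|) ≤ |u i| * (c * |v j|) := by gcongr
          _ = _ := by ring
    _ = c * ((∑ i, |u i|) * ∑ j, |v j|) := by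
        rw [Finset.sum_mul_sum, Finset.mul_sum]
        exact Finset.sum_congr rfl fun i _ => by rw [Finset.mul_sum]
    _ ≤ c * ((√n * √(u ⬝ᵥ u)) * (√n * √(v ⬝ᵥ v))) := by
        exact mul_le_mul_of_nonneg_left (mul_le_mul (hsum u) (hsum v)
          (Finset.sum_nonneg fun _ _ => abs_nonneg _) (by positivity)) hc
    _ = c * (√n * √n) * √(u ⬝ᵥ u) * √(v ⬝ᵥ v) := by ring
    _ = _ := by rw [Real.mul_self_sqrt (Nat.cast_nonneg n)]

theorem OpBound.diagonal {n : ℕ} {d : Fin n → ℝ} {c : ℝ} (h : ∀ i, |d i| ≤ c) :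
    OpBound (Matrix.diagonal d) c := by
  rcases Nat.eq_zero_or_pos n with hn | hn
  · subst hn; intro u v; simp [dotProduct]
  have hc : 0 ≤ c := (abs_nonneg _).trans (h ⟨0, hn⟩)
  intro u v
  calc u ⬝ᵥ Matrix.diagonal d *ᵥ v ≤ c * ((fun i => |u i|) ⬝ᵥ fun i => |v i|) := by
        simp only [dotProduct, Matrix.mulVec_diagonal, Finset.mul_sum]
        refine Finset.sum_le_sum fun i _ => ?_
        refine (le_abs_self _).trans ?_
        rw [abs_mul, abs_mul]
        have := h i
        calc |u i| * (|d i| * |v i|) ≤ |u i| * (c * |v i|) := by gcongr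
          _ = _ := by ring
    _ ≤ c * (√(u ⬝ᵥ u) * √(v ⬝ᵥ v)) := by
        gcongr
        have := dotProduct_le_sqrt (fun i => |u i|) fun i => |v i|
        simpa [dotProduct] using this
    _ = _ := by ring

theorem tendsto_rpow_mul_exp_neg_rpow (p : ℝ) {c q : ℝ} (hc : 0 < c) (hq : 0 < q) :
    Tendsto (fun x : ℝ => x ^ p * Real.exp (-c * x ^ q)) atTop (𝓝 0) := by
  have h := (tendsto_rpow_mul_exp_neg_mul_atTop_nhds_zero (p / q) c hc).comp (tendsto_rpow_atTop hq)
  refine h.congr' ?_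
  filter_upwards [eventually_ge_atTop 0] with x hx
  simp only [Function.comp]
  rw [← Real.rpow_mul hx, mul_div_cancel₀ _ hq.ne']

theorem eventually_exp_neg_rpow_le (p D ε : ℝ) {c q : ℝ} (hc : 0 < c) (hq : 0 < q) :
    ∀ᶠ n : ℕ in atTop, D * (n : ℝ) ^ p * Real.exp (-c * (n : ℝ) ^ q) ≤ (n : ℝ) ^ (-ε) := by
  have h := ((tendsto_rpow_mul_exp_neg_rpow (p + ε) hc hq).const_mul D).comp
    tendsto_natCast_atTop_atTop
  rw [mul_zero] at h
  filter_upwards [h.eventually (ge_mem_nhds zero_lt_one), eventually_gt_atTop 0] with n hn h0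
  have h0' : (0 : ℝ) < n := Nat.cast_pos.2 h0
  simp only [Function.comp] at hn
  rw [Real.rpow_add h0'] at hn
  rw [Real.rpow_neg h0'.le, ← one_div, le_div_iff₀ (Real.rpow_pos_of_pos h0' _)]
  linarith

/-- Upper triangular matrices with centered entries of bounded variance and slowly growing range
have spectral norm `O(√n)`. -/
theorem eventually_measure_not_opBound_upperMat_le (V ε : ℝ) (hV : 0 ≤ V) :
    ∀ᶠ n : ℕ in atTop, ∀ (Ω : Type u) [MeasurableSpace Ω] (P : Measure Ω) [IsProbabilityMeasure P]
      (Y : UpperPair n → Ω → ℝ), iIndepFun Y P → (∀ e, Measurable (Y e)) →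
      (∀ e ω, |Y e ω| ≤ 2 * (n : ℝ) ^ (1 / 32 : ℝ)) → (∀ e, ∫ ω, Y e ω ∂P = 0) →
      (∀ e, ∫ ω, Y e ω ^ 2 ∂P ≤ V) →
      P.real {ω | ¬ OpBound (upperMat fun e => Y e ω) (6 * ((V + 37) * √n))} ≤ (n : ℝ) ^ (-ε) := by
  have hlarge : ∀ᶠ n : ℕ in atTop, (69 * 256 : ℝ) ≤ (n : ℝ) ^ (1 / 16 : ℝ) :=
    ((tendsto_rpow_atTop (by norm_num)).comp tendsto_natCast_atTop_atTop).eventually_ge_atTop _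
  have hlog : ∀ᶠ n : ℕ in atTop, 4 ≤ Real.log n :=
    (Real.tendsto_log_atTop.comp tendsto_natCast_atTop_atTop).eventually_ge_atTop _
  filter_upwards [hlarge, hlog, eventually_gt_atTop 0,
    eventually_exp_neg_rpow_le 0 3 ε one_pos (q := 1 / 16) (by norm_num)] with n hx hlog hn0 hfin
  intro Ω _ P _ Y hind hY hB hmean hvar
  have hn : (0 : ℝ) < n := Nat.cast_pos.2 hn0
  -- All sizes become powers of x = n^{1/16}: √n = x⁸, m = x¹², and the truncation level is √x. With
  -- `lam = log n / 4` the entropy of sparse vectors is O(x¹³), against a tail exponent of at least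
  -- x¹⁴/256, where 256 = 16 · 2⁴ comes from 16(2b)⁴. The 69 = 64 + 4 + 1 collects the two entropy
  -- terms and the target exponent.
  set x : ℝ := (n : ℝ) ^ (1 / 16 : ℝ) with hxdef
  have hx1 : 1 ≤ x := by linarith
  have hpow : ∀ j : ℕ, x ^ j = (n : ℝ) ^ ((j : ℝ) / 16) := fun j => by
    rw [hxdef, ← Real.rpow_natCast, ← Real.rpow_mul hn.le]; congr 1; ring
  have h16 : x ^ 16 = n := by rw [hpow]; norm_num
  set b : ℝ := (n : ℝ) ^ (1 / 32 : ℝ) with hb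
  have hb2 : b ^ 2 = x := by
    rw [hb, hxdef, ← Real.rpow_natCast, ← Real.rpow_mul hn.le]; norm_num
  have hb0 : 0 < b := Real.rpow_pos_of_pos hn _
  have hb1 : 1 ≤ b := by nlinarith
  have hbx : b ≤ x := by nlinarith
  have hm : (n : ℝ) ^ (3 / 4 : ℝ) = x ^ 12 := by rw [hpow]; norm_num
  have hsqrt : √(n : ℝ) = x ^ 8 := by rw [hpow, Real.sqrt_eq_rpow]; norm_num
  have hexp : Real.exp (-(1 / 4 * Real.log n)) = (n : ℝ) ^ (-(1 / 4) : ℝ) := by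
    rw [Real.rpow_def_of_pos hn]; congr 1; ring
  have hexp' : Real.exp (-(1 / 4 * Real.log n)) * n = x ^ 12 := by
    rw [hexp, ← hm, ← Real.rpow_add_one hn.ne']; norm_num
  -- The choice `T = V + 37` leaves exactly -n in the first exponent.
  have key := measure_not_opBound_upperMat_le (m := (n : ℝ) ^ (3 / 4 : ℝ)) (T := V + 37)
    (lam := 1 / 4 * Real.log n) hind hY (by linarith : 1 ≤ 2 * b) hB hV hmean hvar
    (Real.rpow_pos_of_pos hn _)
    (by
      calc (n : ℝ) ^ (3 / 4 : ℝ) ≤ (n : ℝ) ^ (1 : ℝ) :=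
            Real.rpow_le_rpow_of_exponent_le (by exact_mod_cast hn0) (by norm_num)
        _ = n := Real.rpow_one _)
    (by linarith) (by linarith)
    (by
      rw [hsqrt, hm]
      have : x ^ 12 = x ^ 8 * (x ^ 3 * x) := by ring
      rw [this]
      gcongr
      nlinarith [pow_le_pow_left₀ (by norm_num) hx 3])
  refine key.trans (le_trans ?_ hfin)
  have e1 : Real.exp (36 * n + V * n - (V + 37) * n) ≤ Real.exp (-1 * x) := by
    apply Real.exp_le_exp.2
    have : x ≤ n := by rw [← h16]; exact le_self_pow₀ hx1 (by norm_num)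
    linarith
  have hlogx : Real.log n ≤ 16 * x := by
    have := Real.log_le_rpow_div hn.le (by norm_num : (0 : ℝ) < 1 / 16)
    rw [hxdef]; linarith
  have e2 : Real.exp (1 / 4 * Real.log n * (16 * (n : ℝ) ^ (3 / 4 : ℝ)) +
      4 * Real.exp (-(1 / 4 * Real.log n)) * n -
        1 / (16 * (2 * b) ^ 4) * ((V + 37) ^ 2 * n - n * (V + 16))) ≤ Real.exp (-1 * x) := by
    apply Real.exp_le_exp.2
    have hb4 : (2 * b) ^ 4 = 16 * x ^ 2 := by rw [← hb2]; ring
    rw [hm, mul_assoc 4, hexp', hb4]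
    have hT : x ^ 16 ≤ (V + 37) ^ 2 * n - n * (V + 16) := by
      rw [h16]
      have : 0 ≤ (V ^ 2 + 73 * V + 1352) * n := by positivity
      nlinarith
    have h3 : x ^ 14 / 256 ≤ 1 / (16 * (16 * x ^ 2)) * ((V + 37) ^ 2 * n - n * (V + 16)) := by
      calc x ^ 14 / 256 = 1 / (16 * (16 * x ^ 2)) * x ^ 16 := by field_simp; norm_num
        _ ≤ _ := by gcongr
    have h4 : 1 / 4 * Real.log n * (16 * x ^ 12) ≤ 64 * x ^ 13 := by
      have : 0 ≤ x ^ 12 := by positivity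
      nlinarith
    have h5 : x ^ 12 ≤ x ^ 13 := pow_le_pow_right₀ hx1 (by norm_num)
    have h6 : x ≤ x ^ 13 := le_self_pow₀ hx1 (by norm_num)
    have h7 : 69 * x ^ 13 ≤ x ^ 14 / 256 := by
      have : 0 ≤ x ^ 13 := by positivity
      rw [pow_succ x 13]; nlinarith
    linarith
  rw [Real.rpow_zero, mul_one]
  linarith

/-! ### Truncation and the spectral norm of the noise -/

/-- An upper bound for the variance of a variable with a stretched exponential tail. -/
noncomputable def tailVar (K s : ℝ) : ℝ :=
  4 * ∫ t in Set.Ioi (0 : ℝ), t ^ (1 : ℝ) * Real.exp (-(K ^ (-s)) * t ^ s)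

theorem tailVar_nonneg (K s : ℝ) : 0 ≤ tailVar K s :=
  mul_nonneg (by norm_num) (setIntegral_nonneg measurableSet_Ioi fun t ht =>
    mul_nonneg (Real.rpow_nonneg (le_of_lt ht) _) (Real.exp_pos _).le)

/-- Layer cake: the second moment is 2 ∫ t P(|X| > t) dt, and the tail bound contributes another
factor 2. -/
theorem second_moment_of_tail {Ω : Type*} [MeasurableSpace Ω] {P : Measure Ω}
    {X : Ω → ℝ} (hX : Measurable X) {K s : ℝ} (hK : 0 < K) (hs : 0 < s)
    (htail : ∀ t : ℝ, 0 ≤ t →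
      P {ω | t < |X ω|} ≤ ENNReal.ofReal (2 * Real.exp (-(t / K) ^ s))) :
    Integrable (fun ω => X ω ^ 2) P ∧ ∫ ω, X ω ^ 2 ∂P ≤ tailVar K s := by
  have hlin : ∫⁻ ω, ENNReal.ofReal (X ω ^ 2) ∂P ≤ ENNReal.ofReal (tailVar K s) := by
    have h := lintegral_rpow_eq_lintegral_meas_lt_mul P (f := fun ω => |X ω|)
      (ae_of_all _ fun _ => abs_nonneg _) hX.abs.aemeasurable (p := 2) two_pos
    have h0 : ∀ ω, |X ω| ^ (2 : ℝ) = X ω ^ 2 := fun ω => by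
      rw [Real.rpow_two, sq_abs]
    simp_rw [h0] at h
    rw [h, tailVar, show (4 : ℝ) = 2 * 2 by norm_num, mul_assoc,
      ENNReal.ofReal_mul (by norm_num), ← integral_const_mul,
      ofReal_integral_eq_lintegral_ofReal]
    · refine mul_le_mul' le_rfl ?_
      refine setLIntegral_mono' measurableSet_Ioi fun t ht => ?_
      have ht : 0 < t := ht
      calc _ ≤ ENNReal.ofReal (2 * Real.exp (-(t / K) ^ s)) * ENNReal.ofReal (t ^ (2 - 1 : ℝ)) := by
            gcongr; exact htail t ht.le
        _ = _ := by
            rw [← ENNReal.ofReal_mul (by positivity), Real.div_rpow ht.le hK.le,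
              Real.rpow_neg hK.le]
            congr 1
            norm_num
            rw [show -(t ^ s / K ^ s) = -((K ^ s)⁻¹ * t ^ s) by rw [div_eq_inv_mul]]
            ring
    · exact (integrableOn_rpow_mul_exp_neg_mul_rpow (by norm_num) hs
        (Real.rpow_pos_of_pos hK _)).const_mul 2
    · refine (ae_restrict_iff' measurableSet_Ioi).2 (ae_of_all _ fun t ht => ?_)
      have ht : 0 < t := ht
      dsimp; positivity
  have hint : Integrable (fun ω => X ω ^ 2) P := by
    refine ⟨(hX.pow_const 2).aestronglyMeasurable, ?_⟩
    rw [hasFiniteIntegral_iff_ofReal (ae_of_all _ fun _ => sq_nonneg _)]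
    exact hlin.trans_lt ENNReal.ofReal_lt_top
  refine ⟨hint, ?_⟩
  rw [integral_eq_lintegral_of_nonneg_ae (ae_of_all _ fun _ => sq_nonneg _)
    hint.aestronglyMeasurable]
  exact ENNReal.toReal_le_of_le_ofReal (tailVar_nonneg K s) hlin

/-- Truncation at level `b`. -/
noncomputable def trunc (b x : ℝ) : ℝ := if |x| ≤ b then x else 0

theorem measurable_trunc (b : ℝ) : Measurable (trunc b) :=
  Measurable.ite (measurableSet_le measurable_id.abs measurable_const) measurable_id
    measurable_const

theorem abs_trunc_le {b : ℝ} (hb : 0 ≤ b) (x : ℝ) : |trunc b x| ≤ b := by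
  unfold trunc; split_ifs with h
  · exact h
  · simpa using hb

theorem trunc_sq_le (b x : ℝ) : trunc b x ^ 2 ≤ x ^ 2 := by
  unfold trunc; split_ifs with h
  · exact le_rfl
  · simpa using sq_nonneg x

/-- The mean of a truncated centered variable. -/
theorem abs_integral_trunc_le {Ω : Type*} [MeasurableSpace Ω] {P : Measure Ω}
    [IsProbabilityMeasure P] {X : Ω → ℝ} (hX : Measurable X) (hint : Integrable X P)
    (hint2 : Integrable (fun ω => X ω ^ 2) P) (hmean : ∫ ω, X ω ∂P = 0) {b q : ℝ} (hb : 0 ≤ b)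
    (hq : 0 < q) :
    |∫ ω, trunc b (X ω) ∂P| ≤ (∫ ω, X ω ^ 2 ∂P) / q + q * P.real {ω | b < |X ω|} := by
  have hti : Integrable (fun ω => trunc b (X ω)) P :=
    integrable_of_abs_le ((measurable_trunc b).comp hX) fun ω => abs_trunc_le hb _
  have hset : MeasurableSet {ω | b < |X ω|} := measurableSet_lt measurable_const hX.abs
  have h1 : ∫ ω, trunc b (X ω) ∂P = ∫ ω, (trunc b (X ω) - X ω) ∂P := by
    rw [integral_sub hti hint, hmean, sub_zero]
  rw [h1]
  refine (abs_integral_le_integral_abs).trans ?_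
  -- The left side vanishes where |X| ≤ b; elsewhere it is |X| ≤ X²/q + q. The free q balances the
  -- second moment against the tail probability.
  have h2 : ∀ ω, |trunc b (X ω) - X ω| ≤
      X ω ^ 2 / q + q * Set.indicator {ω | b < |X ω|} (fun _ => (1 : ℝ)) ω := by
    intro ω
    by_cases h : |X ω| ≤ b
    · simp only [trunc, h, if_true, sub_self, abs_zero]
      exact add_nonneg (by positivity)
        (mul_nonneg hq.le (Set.indicator_nonneg (fun _ _ => zero_le_one) _))
    · rw [Set.indicator_of_mem (show ω ∈ {ω | b < |X ω|} from not_le.1 h)]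
      simp only [trunc, h, if_false, zero_sub, abs_neg, mul_one]
      rw [← sq_abs, ← sub_nonneg]
      have : |X ω| ^ 2 / q + q - |X ω| = ((|X ω| - q / 2) ^ 2 + 3 / 4 * q ^ 2) / q := by
        field_simp; ring
      rw [this]; positivity
  have hi3 : Integrable (Set.indicator {ω | b < |X ω|} fun _ => (1 : ℝ)) P :=
    (integrable_const _).indicator hset
  calc _ ≤ ∫ ω, (X ω ^ 2 / q + q * Set.indicator {ω | b < |X ω|} (fun _ => (1 : ℝ)) ω) ∂P :=
        integral_mono (hti.sub hint).abs ((hint2.div_const q).add (hi3.const_mul q)) h2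
    _ = _ := by
        rw [integral_add (hint2.div_const q) (hi3.const_mul q), integral_div, integral_const_mul,
          integral_indicator_const _ hset]
        simp

theorem upperMat_add {n : ℕ} (y z : UpperPair n → ℝ) :
    upperMat (fun e => y e + z e) = upperMat y + upperMat z := by
  ext i j
  simp only [upperMat, Matrix.add_apply, Matrix.of_apply]
  split_ifs <;> simp

theorem abs_upperMat_le {n : ℕ} {y : UpperPair n → ℝ} {c : ℝ} (hc : 0 ≤ c) (h : ∀ e, |y e| ≤ c)
    (i j : Fin n) : |upperMat y i j| ≤ c := by
  simp only [upperMat, Matrix.of_apply]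
  split_ifs
  · exact h _
  · simpa using hc

theorem eq_upperMat_add {n : ℕ} {W : Matrix (Fin n) (Fin n) ℝ} (hW : W.IsSymm) :
    W = upperMat (fun e => W e.1.1 e.1.2) + (upperMat (fun e => W e.1.1 e.1.2))ᵀ +
      Matrix.diagonal fun i => W i i := by
  ext i j
  simp only [upperMat, Matrix.add_apply, Matrix.of_apply, Matrix.transpose_apply]
  rcases lt_trichotomy i j with h | h | h
  · simp [h, h.not_gt, h.ne]
  · subst h; simp
  · have := hW.apply i j
    simp [h, h.not_gt, h.ne', this]

/-- Symmetric matrices with independent centered entries with stretched exponential tails have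
spectral norm `O(√n)`, with high probability. -/
theorem exists_measure_not_opBound_le {K s : ℝ} (hK : 0 < K) (hs : 0 < s) (d ε : ℝ) (hd : 0 ≤ d) :
    ∃ C > 0, ∀ᶠ n : ℕ in atTop, ∀ (Ω : Type u) [MeasurableSpace Ω] (P : Measure Ω)
      [IsProbabilityMeasure P] (W : Ω → Matrix (Fin n) (Fin n) ℝ),
      (∀ ω, (W ω).IsSymm) → (∀ i j, Measurable fun ω => W ω i j) →
      iIndepFun (fun (e : UpperPair n) ω => W ω e.1.1 e.1.2) P →
      (∀ i j, i < j → Integrable (fun ω => W ω i j) P ∧ ∫ ω, W ω i j ∂P = 0) →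
      (∀ i j, i < j → ∀ t : ℝ, 0 ≤ t →
        P {ω | t < |W ω i j|} ≤ ENNReal.ofReal (2 * Real.exp (-(t / K) ^ s))) →
      (∀ ω i, |W ω i i| ≤ d) →
      P.real {ω | ¬ OpBound (W ω) (C * √n)} ≤ 2 * (n : ℝ) ^ (-ε) := by
  set V := tailVar K s with hVdef
  have hV : 0 ≤ V := tailVar_nonneg K s
  have hKs : 0 < K ^ (-s) := Real.rpow_pos_of_pos hK _
  have hs32 : 0 < s / 32 := by positivity
  -- Two triangles, each the sum of a centered truncated part and a matrix of truncated means, plus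
  -- the diagonal.
  refine ⟨2 * (6 * (V + 37)) + 2 * (V + 1) + d, by positivity, ?_⟩
  filter_upwards [eventually_measure_not_opBound_upperMat_le.{u} V ε hV, eventually_gt_atTop 0,
    eventually_exp_neg_rpow_le 2 2 ε hKs hs32, eventually_exp_neg_rpow_le 2 2 0 hKs hs32]
    with n hupper hn0 htail1 htail2
  intro Ω _ P _ W hsymm hmeas hind hmean htail hdiag
  have hn : (0 : ℝ) < n := Nat.cast_pos.2 hn0
  have hn1 : (1 : ℝ) ≤ n := by exact_mod_cast hn0
  set b : ℝ := (n : ℝ) ^ (1 / 32 : ℝ) with hb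
  have hb0 : 0 < b := Real.rpow_pos_of_pos hn _
  have hbs : (b / K) ^ s = K ^ (-s) * (n : ℝ) ^ (s / 32) := by
    rw [Real.div_rpow hb0.le hK.le, hb, ← Real.rpow_mul hn.le, Real.rpow_neg hK.le,
      div_eq_inv_mul]
    congr 2; ring
  set p : ℝ := 2 * Real.exp (-(b / K) ^ s) with hp
  have hp0 : 0 < p := by positivity
  rw [Real.rpow_two] at htail1 htail2
  -- The bound n^{-ε} pays for the union bound over the truncation events; the bound 1 below
  -- controls the truncated means.
  have hpe : (n : ℝ) ^ 2 * p ≤ (n : ℝ) ^ (-ε) := by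
    rw [hp, hbs, ← neg_mul]; linarith
  have hp1 : (n : ℝ) ^ 2 * p ≤ 1 := by
    rw [hp, hbs, ← neg_mul]
    rw [neg_zero, Real.rpow_zero] at htail2; linarith
  let X : UpperPair n → Ω → ℝ := fun e ω => W ω e.1.1 e.1.2
  have hX : ∀ e, Measurable (X e) := fun e => hmeas _ _
  have hpX : ∀ e, P.real {ω | b < |X e ω|} ≤ p := fun e =>
    ENNReal.toReal_le_of_le_ofReal hp0.le (htail _ _ e.2 b hb0.le)
  have h2 : ∀ e, Integrable (fun ω => X e ω ^ 2) P ∧ ∫ ω, X e ω ^ 2 ∂P ≤ V := fun e =>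
    second_moment_of_tail (hX e) hK hs (htail _ _ e.2)
  let mean : UpperPair n → ℝ := fun e => ∫ ω, trunc b (X e ω) ∂P
  have hti : ∀ e, Integrable (fun ω => trunc b (X e ω)) P := fun e =>
    integrable_of_abs_le ((measurable_trunc b).comp (hX e)) fun ω => abs_trunc_le hb0.le _
  -- With q = n the truncated means are O(1/n), so their matrix has spectral norm O(1).
  have hmean_le : ∀ e, |mean e| ≤ (V + 1) / n := by
    intro e
    refine (abs_integral_trunc_le (hX e) (hmean _ _ e.2).1 (h2 e).1 (hmean _ _ e.2).2 hb0.le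
      hn).trans ?_
    have h3 : n * P.real {ω | b < |X e ω|} ≤ 1 / n := by
      rw [le_div_iff₀ hn]
      have := hpX e
      calc _ = (n : ℝ) ^ 2 * P.real {ω | b < |X e ω|} := by ring
        _ ≤ (n : ℝ) ^ 2 * p := by gcongr
        _ ≤ 1 := hp1
    rw [add_div]
    gcongr
    exact (h2 e).2
  let Y : UpperPair n → Ω → ℝ := fun e ω => trunc b (X e ω) - mean e
  have hYmeas : ∀ e, Measurable (Y e) := fun e =>
    ((measurable_trunc b).comp (hX e)).sub_const _
  have hYbound : ∀ e ω, |Y e ω| ≤ 2 * b := fun e ω => by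
    have h3 : |mean e| ≤ b := by
      refine (abs_integral_le_integral_abs).trans ?_
      calc _ ≤ ∫ _ω, b ∂P := integral_mono (hti e).abs (integrable_const _)
            fun ω => abs_trunc_le hb0.le _
        _ = b := by simp
    calc _ ≤ |trunc b (X e ω)| + |mean e| := abs_sub _ _
      _ ≤ 2 * b := by linarith [abs_trunc_le hb0.le (X e ω)]
  have hYmean : ∀ e, ∫ ω, Y e ω ∂P = 0 := fun e => by
    simp only [Y]
    rw [integral_sub (hti e) (integrable_const _)]
    simp [mean]
  have hti2 : ∀ e, Integrable (fun ω => trunc b (X e ω) ^ 2) P := fun e =>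
    (h2 e).1.mono' (((measurable_trunc b).comp (hX e)).pow_const 2).aestronglyMeasurable
      (ae_of_all _ fun ω => by
        rw [Real.norm_eq_abs, abs_of_nonneg (sq_nonneg _)]; exact trunc_sq_le _ _)
  have hYvar : ∀ e, ∫ ω, Y e ω ^ 2 ∂P ≤ V := fun e => by
    have h3 : ∀ ω, Y e ω ^ 2 = trunc b (X e ω) ^ 2 - (2 * mean e * trunc b (X e ω) - mean e ^ 2) :=
      fun ω => by simp only [Y]; ring
    simp_rw [h3]
    have hlin : Integrable (fun ω => 2 * mean e * trunc b (X e ω)) P := (hti e).const_mul _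
    have hlin' : Integrable (fun ω => 2 * mean e * trunc b (X e ω) - mean e ^ 2) P :=
      hlin.sub (integrable_const _)
    rw [integral_sub (hti2 e) hlin', integral_sub hlin (integrable_const _), integral_const_mul]
    have h4 : ∫ ω, trunc b (X e ω) ^ 2 ∂P ≤ V :=
      (integral_mono (hti2 e) (h2 e).1 fun ω => trunc_sq_le _ _).trans (h2 e).2
    simp only [integral_const, probReal_univ, one_smul]
    have : ∫ ω, trunc b (X e ω) ∂P = mean e := rfl
    rw [this]
    nlinarith [sq_nonneg (mean e)]
  have hYind : iIndepFun Y P :=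
    hind.comp (fun e x => trunc b x - mean e) fun e => (measurable_trunc b).sub_const _
  have hU := hupper Ω P Y hYind hYmeas hYbound hYmean hYvar
  have hsub : {ω | ¬ OpBound (W ω) ((2 * (6 * (V + 37)) + 2 * (V + 1) + d) * √n)} ⊆
      {ω | ¬ OpBound (upperMat fun e => Y e ω) (6 * ((V + 37) * √n))} ∪
        ⋃ e ∈ (Finset.univ : Finset (UpperPair n)), {ω | b < |X e ω|} := by
    intro ω hω
    by_contra hcon
    simp only [Set.mem_union, Set.mem_iUnion, not_or, not_exists, Set.mem_ofPred_eq, not_not,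
      not_lt, Finset.mem_univ, true_implies] at hcon
    obtain ⟨c1, c2⟩ := hcon
    refine hω ?_
    have hXY : upperMat (fun e => W ω e.1.1 e.1.2) =
        upperMat (fun e => Y e ω) + upperMat mean := by
      rw [← upperMat_add]
      congr 1
      ext e
      have : trunc b (X e ω) = X e ω := if_pos (c2 e)
      simp only [Y, this]
      ring
    have hM : OpBound (upperMat mean) (V + 1) := by
      have := OpBound.of_abs_entry_le (abs_upperMat_le (by positivity) hmean_le)
      rwa [div_mul_cancel₀ _ hn.ne'] at this
    have hUW : OpBound (upperMat fun e => W ω e.1.1 e.1.2) (6 * ((V + 37) * √n) + (V + 1)) := by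
      rw [hXY]; exact c1.add hM
    rw [eq_upperMat_add (hsymm ω)]
    refine ((hUW.add hUW.transpose).add (OpBound.diagonal (hdiag ω))).mono ?_
    have h1 : 1 ≤ √(n : ℝ) := Real.one_le_sqrt.2 hn1
    nlinarith
  calc _ ≤ _ := measureReal_mono hsub
    _ ≤ _ := measureReal_union_le _ _
    _ ≤ (n : ℝ) ^ (-ε) + (Finset.univ : Finset (UpperPair n)).card * p := by
        gcongr
        exact measureReal_biUnion_le_card _ _ fun e _ => hpX e
    _ ≤ (n : ℝ) ^ (-ε) + (n : ℝ) ^ 2 * p := by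
        gcongr
        have h1 : Fintype.card (UpperPair n) ≤ n ^ 2 := by
          refine (Fintype.card_subtype_le _).trans_eq ?_
          simp [sq]
        rw [Finset.card_univ]
        exact_mod_cast h1
    _ ≤ _ := by linarith

/-! ### Singular value thresholding -/

theorem orthogonal_mul_transpose {n : ℕ} {U : Matrix (Fin n) (Fin n) ℝ}
    (hU : U ∈ Matrix.orthogonalGroup (Fin n) ℝ) : U * Uᵀ = 1 := by
  simpa [Matrix.star_eq_conjTranspose] using Matrix.mem_orthogonalGroup_iff (A := U) |>.1 hU

theorem transpose_mul_orthogonal {n : ℕ} {U : Matrix (Fin n) (Fin n) ℝ}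
    (hU : U ∈ Matrix.orthogonalGroup (Fin n) ℝ) : Uᵀ * U = 1 := by
  simpa [Matrix.star_eq_conjTranspose] using Matrix.mem_orthogonalGroup_iff' (A := U) |>.1 hU

theorem dotProduct_mulVec_self {m n : Type*} [Fintype m] [Fintype n] (U : Matrix m n ℝ)
    (x : n → ℝ) : U *ᵥ x ⬝ᵥ U *ᵥ x = x ⬝ᵥ (Uᵀ * U) *ᵥ x := by
  rw [← Matrix.mulVec_mulVec, Matrix.dotProduct_mulVec x, Matrix.vecMul_transpose]

theorem OpBound.entry_le {n : ℕ} {X : Matrix (Fin n) (Fin n) ℝ} {c : ℝ} (h : OpBound X c)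
    (i j : Fin n) : X i j ≤ c := by
  have := h (Pi.single i 1) (Pi.single j 1)
  simpa [Matrix.mulVec_single] using this

theorem OpBound.orthogonal_conj {n : ℕ} {X U V : Matrix (Fin n) (Fin n) ℝ} {c : ℝ}
    (h : OpBound X c) (hU : Uᵀ * U = 1) (hV : Vᵀ * V = 1) : OpBound (Uᵀ * X * V) c := by
  intro x y
  have := h (U *ᵥ x) (V *ᵥ y)
  rw [dotProduct_mulVec_self, dotProduct_mulVec_self, hU, hV, Matrix.one_mulVec,
    Matrix.one_mulVec] at this
  refine le_trans (le_of_eq ?_) this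
  rw [← Matrix.mulVec_mulVec, ← Matrix.mulVec_mulVec, Matrix.dotProduct_mulVec,
    Matrix.vecMul_transpose]

/-- The trace inner product with a matrix in singular value form. -/
theorem trace_svd_mul {n : ℕ} (U V X : Matrix (Fin n) (Fin n) ℝ) (d : Fin n → ℝ) :
    ((U * Matrix.diagonal d * Vᵀ)ᵀ * X).trace = ∑ i, d i * (Uᵀ * X * V) i i := by
  rw [Matrix.transpose_mul, Matrix.transpose_mul, Matrix.transpose_transpose,
    Matrix.diagonal_transpose, Matrix.mul_assoc, Matrix.trace_mul_comm, Matrix.mul_assoc,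
    Matrix.mul_assoc, Matrix.trace]
  simp [Matrix.diagonal_mul, Matrix.mul_assoc]

theorem trace_transpose_mul_self {m n : Type*} [Fintype m] [Fintype n] (D E : Matrix m n ℝ) :
    (Dᵀ * E).trace = ∑ i, ∑ j, D i j * E i j := by
  simp only [Matrix.trace, Matrix.diag_apply, Matrix.mul_apply, Matrix.transpose_apply]
  exact Finset.sum_comm

/-- Singular value thresholding of a perturbed matrix: the squared Frobenius error is at most a
multiple of the threshold times (a bound for) the nuclear norm of the signal. -/
theorem sum_sq_svThreshold_sub_le {n : ℕ} {A B E W : Matrix (Fin n) (Fin n) ℝ} {τ N : ℝ}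
    (hτ : 0 < τ) (hA : A = E + W) (hW : OpBound W (τ / 2)) (hB : IsSVThreshold τ A B)
    (hE : ∀ (M : Matrix (Fin n) (Fin n) ℝ) (c : ℝ), 0 ≤ c → OpBound M c →
      (Mᵀ * E).trace ≤ c * N) :
    ∑ i, ∑ j, (B i j - E i j) ^ 2 ≤ 9 / 2 * τ * N := by
  obtain ⟨U, hU, V, hV, σ, hσ, hAσ, hBσ⟩ := hB
  have hUt := orthogonal_mul_transpose hU
  have hVt := orthogonal_mul_transpose hV
  have hU := transpose_mul_orthogonal hU
  have hV := transpose_mul_orthogonal hV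
  have hdiag : ∀ (d : Fin n → ℝ) (c : ℝ), (∀ i, |d i| ≤ c) →
      OpBound (U * Matrix.diagonal d * Vᵀ) c := fun d c hd => by
    have := (OpBound.diagonal hd).orthogonal_conj (U := Uᵀ) (V := Vᵀ)
      (by rwa [Matrix.transpose_transpose]) (by rwa [Matrix.transpose_transpose])
    rwa [Matrix.transpose_transpose] at this
  have hconj : ∀ d : Fin n → ℝ, Uᵀ * (U * Matrix.diagonal d * Vᵀ) * V = Matrix.diagonal d :=
    fun d => by
      rw [← Matrix.mul_assoc, ← Matrix.mul_assoc, hU, Matrix.one_mul, Matrix.mul_assoc, hV,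
        Matrix.mul_one]
  set χ : Fin n → ℝ := fun i => if τ < σ i then 1 else 0 with hχ
  have hχ0 : ∀ i, 0 ≤ χ i := fun i => by simp only [hχ]; split_ifs <;> norm_num
  set S : ℝ := ∑ i, χ i * σ i with hS
  have hBχ : B = U * Matrix.diagonal (fun i => χ i * σ i) * Vᵀ := by
    rw [hBσ]; congr 3; ext i; simp only [hχ]; split_ifs <;> simp
  -- Test A = E + W against UχVᵀ, of spectral norm at most 1. The pairing with A is S, the sum of
  -- the retained singular values. The signal contributes at most N, and the noise at most τ/2 per
  -- retained value, hence at most half of that value, which exceeds τ. So S ≤ 2N.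
  have hS1 : S ≤ N + S / 2 := by
    have h1 := hE _ 1 zero_le_one (hdiag χ 1 fun i => by
      rw [abs_of_nonneg (hχ0 i)]; simp only [hχ]; split_ifs <;> norm_num)
    have h2 : ((U * Matrix.diagonal χ * Vᵀ)ᵀ * A).trace = S := by
      rw [trace_svd_mul, hAσ, hconj]; simp [hS]
    have h3 : ((U * Matrix.diagonal χ * Vᵀ)ᵀ * W).trace ≤ S / 2 := by
      rw [trace_svd_mul, hS, Finset.sum_div]
      refine Finset.sum_le_sum fun i _ => ?_
      have := (hW.orthogonal_conj hU hV).entry_le i i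
      rw [mul_div_assoc]
      by_cases h : τ < σ i
      · have : χ i = 1 := if_pos h
        rw [this]; linarith
      · have : χ i = 0 := if_neg h
        rw [this]; simp
    rw [hA, Matrix.mul_add, Matrix.trace_add] at h2
    linarith
  have hBA : OpBound (B - A) τ := by
    have h1 : B - A = U * Matrix.diagonal (fun i => χ i * σ i - σ i) * Vᵀ := by
      rw [hBχ, hAσ, ← Matrix.sub_mul, ← Matrix.mul_sub, Matrix.diagonal_sub]
    rw [h1]
    refine hdiag _ _ fun i => ?_
    by_cases h : τ < σ i
    · have : χ i = 1 := if_pos h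
      rw [this]; simpa using hτ.le
    · have : χ i = 0 := if_neg h
      rw [this]; simpa [abs_of_nonneg (hσ i)] using not_lt.1 h
  have hD : OpBound (B - E) (3 / 2 * τ) := by
    have h1 : B - E = (B - A) + W := by rw [hA]; abel
    rw [h1]
    exact (hBA.add hW).mono (by linarith)
  -- The squared error is ⟨B - E, B⟩ - ⟨B - E, E⟩. Each part is at most 3τ/2, a bound for the
  -- spectral norm of B - E, times a nuclear norm bound: S ≤ 2N for B and N for E, which makes
  -- 9τN/2.
  have hDB : ((B - E)ᵀ * B).trace ≤ 3 / 2 * τ * S := by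
    rw [← Matrix.trace_transpose, Matrix.transpose_mul, Matrix.transpose_transpose, hBχ,
      trace_svd_mul, ← hBχ, hS, Finset.mul_sum]
    refine Finset.sum_le_sum fun i _ => ?_
    have := (hD.orthogonal_conj hU hV).entry_le i i
    have h2 : 0 ≤ χ i * σ i := mul_nonneg (hχ0 i) (hσ i)
    nlinarith
  have hDE := hE (-(B - E)) _ (by positivity) hD.neg
  have hsum : ∑ i, ∑ j, (B i j - E i j) ^ 2 = ((B - E)ᵀ * B).trace + ((-(B - E))ᵀ * E).trace := by
    rw [Matrix.transpose_neg, Matrix.neg_mul, Matrix.trace_neg, ← sub_eq_add_neg,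
      ← Matrix.trace_sub, ← Matrix.mul_sub, trace_transpose_mul_self]
    simp [sq]
  rw [hsum]
  nlinarith

/-! ### Nuclear norm of the signal, by duality with the spectral norm -/

theorem OpBound.row_sq_le {n : ℕ} {M : Matrix (Fin n) (Fin n) ℝ} {c : ℝ} (hc : 0 ≤ c)
    (h : OpBound M c) (i : Fin n) : ∑ j, M i j ^ 2 ≤ c ^ 2 := by
  have h1 := h (Pi.single i 1) (M i)
  have h2 : (Pi.single i 1 : Fin n → ℝ) ⬝ᵥ M *ᵥ M i = M i ⬝ᵥ M i := by
    simp [Matrix.mulVec]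
  have h3 : M i ⬝ᵥ M i = ∑ j, M i j ^ 2 := by simp [dotProduct, sq]
  have h4 : (Pi.single i 1 : Fin n → ℝ) ⬝ᵥ Pi.single i 1 = 1 := by simp
  rw [h2, h4, Real.sqrt_one, mul_one, h3] at h1
  have h5 : 0 ≤ ∑ j, M i j ^ 2 := Finset.sum_nonneg fun _ _ => sq_nonneg _
  have h6 := Real.sq_sqrt h5
  have h7 := Real.sqrt_nonneg (∑ j, M i j ^ 2)
  rcases h7.eq_or_lt with h8 | h8
  · rw [← h8] at h6; nlinarith
  · have : √(∑ j, M i j ^ 2) ≤ c := by nlinarith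
    nlinarith

/-- Matrices whose rows are nearly constant on the cells of a partition have small nuclear norm. -/
theorem trace_le_of_cells {n : ℕ} {κ : Type*} [Fintype κ] [DecidableEq κ]
    {M E : Matrix (Fin n) (Fin n) ℝ}
    {c b δ : ℝ} (hc : 0 ≤ c) (hM : OpBound M c) (hδ : 0 ≤ δ)
    (hb : 0 ≤ b) (cell : Fin n → κ) (f : κ → Fin n → ℝ)
    (hE : ∀ i j, |E i j - f (cell i) j| ≤ δ) (hf : ∀ a j, |f a j| ≤ b) :
    (Mᵀ * E).trace ≤ c * (b * (n * √(Fintype.card κ)) + δ * (n * √n)) := by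
  have hn0 : (0 : ℝ) ≤ n := Nat.cast_nonneg n
  have hnorm : ∀ (g : Fin n → ℝ) (r : ℝ), 0 ≤ r → (∀ j, |g j| ≤ r) → √(g ⬝ᵥ g) ≤ r * √n := by
    intro g r hr hg
    rw [← Real.sqrt_sq hr, ← Real.sqrt_mul (sq_nonneg r)]
    apply Real.sqrt_le_sqrt
    calc g ⬝ᵥ g ≤ ∑ _j : Fin n, r ^ 2 := Finset.sum_le_sum fun j _ => by
          rw [← sq, ← sq_abs]; exact pow_le_pow_left₀ (abs_nonneg _) (hg j) 2
      _ = r ^ 2 * n := by simp [mul_comm]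
  rw [trace_transpose_mul_self]
  -- Replacing each row by the vector of its cell leaves an error matrix and a sum over cells. The
  -- error costs cδ√n per row, because the rows of M have length at most c.
  have hsplit : ∑ i, ∑ j, M i j * E i j = ∑ i, ∑ j, M i j * (E i j - f (cell i) j) +
      ∑ a, (fun i => if cell i = a then (1 : ℝ) else 0) ⬝ᵥ M *ᵥ f a := by
    have h1 : ∑ a, (fun i => if cell i = a then (1 : ℝ) else 0) ⬝ᵥ M *ᵥ f a =
        ∑ i, ∑ j, M i j * f (cell i) j := by
      simp only [dotProduct, Matrix.mulVec]
      rw [Finset.sum_comm]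
      refine Finset.sum_congr rfl fun i _ => ?_
      simp
    rw [h1, ← Finset.sum_add_distrib]
    refine Finset.sum_congr rfl fun i _ => ?_
    rw [← Finset.sum_add_distrib]
    exact Finset.sum_congr rfl fun j _ => by ring
  have hrest : ∑ i, ∑ j, M i j * (E i j - f (cell i) j) ≤ c * (δ * (n * √n)) := by
    have hrow : ∀ i, ∑ j, M i j * (E i j - f (cell i) j) ≤ c * (δ * √n) := by
      intro i
      refine (dotProduct_le_sqrt (M i) fun j => E i j - f (cell i) j).trans ?_
      have h1 : √(M i ⬝ᵥ M i) ≤ c := by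
        rw [← Real.sqrt_sq hc]
        apply Real.sqrt_le_sqrt
        refine le_trans (le_of_eq ?_) (hM.row_sq_le hc i)
        simp [dotProduct, sq]
      have h2 := hnorm (fun j => E i j - f (cell i) j) δ hδ (hE i)
      gcongr
    calc _ ≤ ∑ _i : Fin n, c * (δ * √n) := Finset.sum_le_sum fun i _ => hrow i
      _ = _ := by simp; ring
  have hmain : ∑ a, (fun i => if cell i = a then (1 : ℝ) else 0) ⬝ᵥ M *ᵥ f a ≤
      c * (b * (n * √(Fintype.card κ))) := by
    let s : κ → ℝ := fun a => √((fun i => if cell i = a then (1 : ℝ) else 0) ⬝ᵥ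
      fun i => if cell i = a then (1 : ℝ) else 0)
    have h1 : ∀ a, (fun i => if cell i = a then (1 : ℝ) else 0) ⬝ᵥ M *ᵥ f a ≤
        c * (b * √n) * s a := fun a => by
      refine (hM _ _).trans ?_
      have := hnorm (f a) b hb (hf a)
      calc _ ≤ c * s a * (b * √n) := by gcongr
        _ = _ := by ring
    -- `s a` is the square root of the number of indices in cell `a`; these numbers add up to n, and
    -- Cauchy–Schwarz bounds the sum of the roots.
    have h2 : ∑ a, s a ≤ √(Fintype.card κ) * √n := by
      have := dotProduct_le_sqrt (fun _ : κ => (1 : ℝ)) s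
      have h3 : s ⬝ᵥ s = n := by
        calc s ⬝ᵥ s = ∑ a, ∑ i, (if cell i = a then (1 : ℝ) else 0) := by
              refine Finset.sum_congr rfl fun a _ => ?_
              simp only [s]
              rw [Real.mul_self_sqrt (dotProduct_self_nonneg' _)]
              refine Finset.sum_congr rfl fun i _ => ?_
              by_cases h : cell i = a <;> simp [h]
          _ = n := by rw [Finset.sum_comm]; simp
      rw [h3] at this
      simpa [dotProduct] using this
    calc _ ≤ ∑ a, c * (b * √n) * s a := Finset.sum_le_sum fun a _ => h1 a
      _ = c * (b * √n) * ∑ a, s a := by rw [Finset.mul_sum]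
      _ ≤ c * (b * √n) * (√(Fintype.card κ) * √n) := by gcongr
      _ = c * (b * ((√n * √n) * √(Fintype.card κ))) := by ring
      _ = _ := by rw [Real.mul_self_sqrt hn0]
  rw [hsplit]
  linarith

/-- A bounded set of points is covered by a grid. -/
theorem exists_grid {n : ℕ} {ι : Type*} [Fintype ι] (y : Fin n → ι → ℝ) {b h : ℝ}
    (hh : 0 < h) (hy : ∀ i l, |y i l| ≤ b) :
    ∃ cell : Fin n → (ι → Fin (⌊2 * b / h⌋₊ + 1)), ∀ i i', cell i = cell i' →
      ∀ l, |y i l - y i' l| ≤ h := by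
  refine ⟨fun i l => ⟨⌊(y i l + b) / h⌋₊, ?_⟩, ?_⟩
  · rw [Nat.lt_succ_iff]
    apply Nat.floor_le_floor
    gcongr
    linarith [(abs_le.1 (hy i l)).2]
  · intro i i' hcell l
    have h1 := congrArg Fin.val (congrFun hcell l)
    dsimp only at h1
    have hpos : ∀ i, 0 ≤ (y i l + b) / h := fun i =>
      div_nonneg (by linarith [(abs_le.1 (hy i l)).1]) hh.le
    have a1 := Nat.floor_le (hpos i)
    have a2 := Nat.lt_floor_add_one ((y i l + b) / h)
    have b1 := Nat.floor_le (hpos i')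
    have b2 := Nat.lt_floor_add_one ((y i' l + b) / h)
    rw [h1] at a1 a2
    have e1 : |(y i l + b) / h - (y i' l + b) / h| ≤ 1 := abs_le.2 ⟨by linarith, by linarith⟩
    rw [← sub_div, add_sub_add_right_eq_sub, abs_div, abs_of_pos hh, div_le_one hh] at e1
    exact e1

theorem abs_thetaMat_le {n k : ℕ} {Z : Matrix (Fin n) (Fin k) ℝ} {α : Fin n → ℝ} {M : ℝ}
    (hZ : ∀ i l, |Z i l| ≤ M) (hα : ∀ i, |α i| ≤ M) (i j : Fin n) :
    |thetaMat Z α i j| ≤ 2 * M + k * M ^ 2 := by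
  have h1 : |Z i ⬝ᵥ Z j| ≤ k * M ^ 2 := by
    rw [dotProduct]
    refine (Finset.abs_sum_le_sum_abs _ _).trans ?_
    calc _ ≤ ∑ _l : Fin k, M ^ 2 := Finset.sum_le_sum fun l _ => by
          rw [abs_mul, sq]
          have := hZ i l
          have := hZ j l
          gcongr
          exact (abs_nonneg _).trans (hZ i l)
      _ = _ := by simp
  have h2 := hα i
  have h3 := hα j
  rw [abs_le] at *
  simp only [thetaMat, Matrix.of_apply]
  constructor <;> linarith

theorem abs_thetaMat_sub_le {n k : ℕ} {Z : Matrix (Fin n) (Fin k) ℝ} {α : Fin n → ℝ} {M h : ℝ}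
    (hZ : ∀ i l, |Z i l| ≤ M) {i i' : Fin n} (hz : ∀ l, |Z i l - Z i' l| ≤ h)
    (ha : |α i - α i'| ≤ h) (j : Fin n) :
    |thetaMat Z α i j - thetaMat Z α i' j| ≤ (1 + k * M) * h := by
  have h1 : |(Z i - Z i') ⬝ᵥ Z j| ≤ k * (h * M) := by
    rw [dotProduct]
    refine (Finset.abs_sum_le_sum_abs _ _).trans ?_
    calc _ ≤ ∑ _l : Fin k, h * M := Finset.sum_le_sum fun l _ => by
          rw [abs_mul]
          have := hZ j l
          have := hz l
          rw [Pi.sub_apply]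
          gcongr
          exact (abs_nonneg _).trans (hz l)
      _ = _ := by simp
  have e : thetaMat Z α i j - thetaMat Z α i' j = (α i - α i') + (Z i - Z i') ⬝ᵥ Z j := by
    simp only [thetaMat, Matrix.of_apply, sub_dotProduct]; ring
  rw [e]
  refine (abs_add_le _ _).trans ?_
  linarith

/-- The nuclear norm of a smooth function of a latent space matrix. -/
theorem exists_nuclear_bound (k : ℕ) {g : ℝ → ℝ} {M L G : ℝ} (hM : 0 ≤ M) (hL : 0 ≤ L)
    (hG : 0 ≤ G)
    (hlip : ∀ x y, |x| ≤ 2 * M + k * M ^ 2 → |y| ≤ 2 * M + k * M ^ 2 → |g x - g y| ≤ L * |x - y|)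
    (hbd : ∀ x, |x| ≤ 2 * M + k * M ^ 2 → |g x| ≤ G) :
    ∃ C > 0, ∀ n ≥ 1, ∀ (Z : Matrix (Fin n) (Fin k) ℝ) (α : Fin n → ℝ),
      (∀ i l, |Z i l| ≤ M) → (∀ i, |α i| ≤ M) →
      ∀ (X : Matrix (Fin n) (Fin n) ℝ) (c : ℝ), 0 ≤ c → OpBound X c →
        (Xᵀ * (thetaMat Z α).map g).trace ≤
          c * (C * (n : ℝ) ^ (3 / 2 - 1 / ((k : ℝ) + 3))) := by
  refine ⟨G * √((2 * M + 1) ^ (k + 1)) + L * (1 + k * M) + 1, by positivity, ?_⟩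
  intro n hn Z α hZ hα X c hc hX
  have hn0 : (0 : ℝ) < n := by exact_mod_cast hn
  have hn1 : (1 : ℝ) ≤ n := by exact_mod_cast hn
  -- A grid of side n^{-a} in dimension k+1 has O(n^{a(k+1)}) cells. The cell term is of order
  -- n^{1+a(k+1)/2} and the Lipschitz error of order n^{3/2-a}; they balance when a(k+3) = 1.
  set a : ℝ := 1 / ((k : ℝ) + 3) with ha
  have ha0 : 0 < a := by positivity
  set h : ℝ := (n : ℝ) ^ (-a) with hh
  have hh0 : 0 < h := Real.rpow_pos_of_pos hn0 _
  obtain ⟨cell, hcell⟩ := exists_grid (ι := Fin k ⊕ Unit)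
    (fun i l => Sum.elim (Z i) (fun _ => α i) l) hh0 (b := M)
    (fun i l => by rcases l with l | l <;> simp [hZ, hα])
  -- Each inhabited cell gets the row of a representative; the value on empty cells plays no role.
  let f : (Fin k ⊕ Unit → Fin (⌊2 * M / h⌋₊ + 1)) → Fin n → ℝ := fun a j =>
    if ha : ∃ i, cell i = a then g (thetaMat Z α ha.choose j) else 0
  have key := trace_le_of_cells (E := (thetaMat Z α).map g) (f := f)
    (δ := L * ((1 + k * M) * h)) hc hX (by positivity) hG cell
    (by
      intro i j
      have hex : ∃ i', cell i' = cell i := ⟨i, rfl⟩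
      have hs := hcell _ _ hex.choose_spec
      simp only [f, hex, dif_pos, Matrix.map_apply]
      refine (hlip _ _ (abs_thetaMat_le hZ hα _ _) (abs_thetaMat_le hZ hα _ _)).trans ?_
      gcongr
      rw [abs_sub_comm]
      exact abs_thetaMat_sub_le hZ (fun l => hs (Sum.inl l)) (hs (Sum.inr ())) j)
    (by
      intro a j
      simp only [f]
      split_ifs
      · exact hbd _ (abs_thetaMat_le hZ hα _ _)
      · simpa using hG)
  refine key.trans ?_
  gcongr
  have hcard : (Fintype.card (Fin k ⊕ Unit → Fin (⌊2 * M / h⌋₊ + 1)) : ℝ) ≤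
      (2 * M + 1) ^ (k + 1) * (n : ℝ) ^ (a * (k + 1)) := by
    have h1 : ((⌊2 * M / h⌋₊ + 1 : ℕ) : ℝ) ≤ (2 * M + 1) * (n : ℝ) ^ a := by
      have h2 : 2 * M / h = 2 * M * (n : ℝ) ^ a := by
        rw [hh, Real.rpow_neg hn0.le, div_inv_eq_mul]
      have h3 := Nat.floor_le (show 0 ≤ 2 * M / h by positivity)
      have h4 : 1 ≤ (n : ℝ) ^ a := Real.one_le_rpow hn1 ha0.le
      push_cast
      rw [h2] at h3 ⊢
      linarith
    simp only [Fintype.card_pi, Finset.prod_const, Fintype.card_fin, Finset.card_univ,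
      Fintype.card_sum, Fintype.card_unit]
    rw [Nat.cast_pow]
    calc _ ≤ ((2 * M + 1) * (n : ℝ) ^ a) ^ (k + 1) := by gcongr
      _ = _ := by
        rw [mul_pow, Real.rpow_mul hn0.le, ← Real.rpow_natCast ((n : ℝ) ^ a)]
        push_cast; rfl
  have hak : a * (k + 3) = 1 := by rw [ha]; field_simp
  have e1 : n * √(Fintype.card (Fin k ⊕ Unit → Fin (⌊2 * M / h⌋₊ + 1))) ≤
      √((2 * M + 1) ^ (k + 1)) * (n : ℝ) ^ (3 / 2 - a) := by
    calc _ ≤ n * √((2 * M + 1) ^ (k + 1) * (n : ℝ) ^ (a * (k + 1))) := by gcongr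
      _ = √((2 * M + 1) ^ (k + 1)) * ((n : ℝ) ^ (1 : ℝ) * (n : ℝ) ^ (a * (k + 1) * (1 / 2))) := by
        rw [Real.sqrt_mul (by positivity), Real.rpow_one, Real.sqrt_eq_rpow ((n : ℝ) ^ _),
          ← Real.rpow_mul hn0.le]
        ring
      _ = _ := by
        rw [← Real.rpow_add hn0]
        congr 2
        linarith
  have e2 : L * ((1 + k * M) * h) * (n * √n) = L * (1 + k * M) * (n : ℝ) ^ (3 / 2 - a) := by
    have : (n : ℝ) ^ (3 / 2 - a) = n * √n * h := by
      rw [hh, Real.sqrt_eq_rpow, sub_eq_add_neg, Real.rpow_add hn0,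
        show (3 / 2 : ℝ) = 1 + 1 / 2 by norm_num, Real.rpow_add hn0, Real.rpow_one]
    rw [this]; ring
  rw [e2]
  have e3 : 0 ≤ (n : ℝ) ^ (3 / 2 - a) := by positivity
  calc _ ≤ G * (√((2 * M + 1) ^ (k + 1)) * (n : ℝ) ^ (3 / 2 - a)) +
        L * (1 + k * M) * (n : ℝ) ^ (3 / 2 - a) := by gcongr
    _ ≤ _ := by nlinarith

/-! ### Order statistics -/

section OrderStat

open Finset

variable {n : ℕ} {E : Matrix (Fin n) (Fin n) ℝ}

/-- The number of entries `≤ x`. -/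
noncomputable def countLe (E : Matrix (Fin n) (Fin n) ℝ) (x : ℝ) : ℕ :=
  (univ.filter fun e : Fin n × Fin n => E e.1 e.2 ≤ x).card

theorem orderStat_set_bddBelow {m : ℕ} (hm : 1 ≤ m) : BddBelow {x | m ≤ countLe E x} := by
  refine ⟨-∑ i, ∑ j, |E i j|, fun x hx => ?_⟩
  have hpos : 0 < countLe E x := lt_of_lt_of_le hm hx
  obtain ⟨e, he⟩ := Finset.card_pos.1 hpos
  have h1 := (Finset.mem_filter.1 he).2
  have h2 : |E e.1 e.2| ≤ ∑ i, ∑ j, |E i j| :=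
    (single_le_sum (f := fun j => |E e.1 j|) (fun _ _ => abs_nonneg _) (mem_univ e.2)).trans
      (single_le_sum (f := fun i => ∑ j, |E i j|)
        (fun _ _ => sum_nonneg fun _ _ => abs_nonneg _) (mem_univ e.1))
  linarith [neg_abs_le (E e.1 e.2)]

theorem orderStat_set_nonempty {m : ℕ} (hm : m ≤ n ^ 2) : {x | m ≤ countLe E x}.Nonempty := by
  refine ⟨∑ i, ∑ j, |E i j|, ?_⟩
  have : (univ.filter fun e : Fin n × Fin n => E e.1 e.2 ≤ ∑ i, ∑ j, |E i j|) = univ := by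
    refine filter_true_of_mem fun e _ => (le_abs_self _).trans ?_
    exact (single_le_sum (f := fun j => |E e.1 j|) (fun _ _ => abs_nonneg _) (mem_univ e.2)).trans
      (single_le_sum (f := fun i => ∑ j, |E i j|)
        (fun _ _ => sum_nonneg fun _ _ => abs_nonneg _) (mem_univ e.1))
  change m ≤ Finset.card _
  rw [this]
  simpa [sq] using hm

theorem countLe_lt_of_lt_orderStat {m : ℕ} (hm : 1 ≤ m) {x : ℝ} (hx : x < orderStat E m) :
    countLe E x < m := by
  by_contra h
  exact absurd (csInf_le (orderStat_set_bddBelow hm) (not_lt.1 h)) (not_le.2 hx)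

/-- The order statistic is attained: at least `m` entries are `≤ E_(m)`. -/
theorem le_countLe_orderStat {m : ℕ} (hm : m ≤ n ^ 2) : m ≤ countLe E (orderStat E m) := by
  -- all entries in a right neighbourhood of `x = E_(m)` are `≤ x`
  set x := orderStat E m with hx
  obtain ⟨y, hxy, hy⟩ : ∃ y, x < y ∧ ∀ e : Fin n × Fin n, E e.1 e.2 < y → E e.1 e.2 ≤ x := by
    by_cases hne : (univ.filter fun e : Fin n × Fin n => x < E e.1 e.2).Nonempty
    · obtain ⟨e₀, he₀, hmin⟩ := exists_min_image _ (fun e : Fin n × Fin n => E e.1 e.2) hne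
      refine ⟨E e₀.1 e₀.2, (mem_filter.1 he₀).2, fun e he => ?_⟩
      by_contra h
      exact absurd (hmin e (mem_filter.2 ⟨mem_univ _, not_le.1 h⟩)) (not_le.2 he)
    · refine ⟨x + 1, by linarith, fun e _ => ?_⟩
      by_contra h
      exact hne ⟨e, mem_filter.2 ⟨mem_univ _, not_le.1 h⟩⟩
  obtain ⟨z, hz, hzy⟩ := exists_lt_of_csInf_lt (orderStat_set_nonempty (E := E) hm) hxy
  refine hz.trans (card_le_card fun e he => ?_)
  exact mem_filter.2 ⟨mem_univ _, hy e ((mem_filter.1 he).2.trans_lt hzy)⟩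

theorem orderStat_mono {m m' : ℕ} (hm : 1 ≤ m) (hmm : m ≤ m') (hm' : m' ≤ n ^ 2) :
    orderStat E m ≤ orderStat E m' := by
  by_contra h
  have h1 := countLe_lt_of_lt_orderStat hm (not_le.1 h)
  have h2 := le_countLe_orderStat (E := E) hm'
  omega

theorem countLe_add_card_lt (x : ℝ) :
    countLe E x + (univ.filter fun e : Fin n × Fin n => x < E e.1 e.2).card = n ^ 2 := by
  have := card_filter_add_card_filter_not (s := (univ : Finset (Fin n × Fin n)))
    (p := fun e => E e.1 e.2 ≤ x)
  simp only [not_le] at this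
  rw [countLe, this]
  simp [sq]

/-- Let x be the largest entry below E_(m). The entries counted are those `≤ x`, and x < E_(m)
forces fewer than m of them. -/
theorem card_lt_orderStat_lt {m : ℕ} (hm : 1 ≤ m) :
    (univ.filter fun e : Fin n × Fin n => E e.1 e.2 < orderStat E m).card < m := by
  by_cases hne : (univ.filter fun e : Fin n × Fin n => E e.1 e.2 < orderStat E m).Nonempty
  · obtain ⟨e₀, he₀, hmax⟩ := exists_max_image _ (fun e : Fin n × Fin n => E e.1 e.2) hne
    refine lt_of_le_of_lt (card_le_card fun e he => ?_)
      (countLe_lt_of_lt_orderStat hm (mem_filter.1 he₀).2)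
    exact mem_filter.2 ⟨mem_univ _, hmax e he⟩
  · rw [not_nonempty_iff_eq_empty.1 hne, card_empty]; exact hm

end OrderStat

open Finset in
/-- The adaptive projection maps into a fixed neighbourhood of the range of the signal, and only
increases the squared error by a multiple of the trimming quantile. -/
theorem adaptiveProj_spec {n γ : ℕ} {μ : ℝ → ℝ} {B S : Matrix (Fin n) (Fin n) ℝ} {a b η : ℝ}
    (hη : 0 < η) (hS : ∀ i j, S i j ∈ Set.Icc a b)
    (hrange : Set.Icc (a - η) (b + η) ⊆ Set.range μ) (hγ : 1 ≤ γ) (hγ2 : 2 * γ ≤ n ^ 2)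
    (herr : ∑ i, ∑ j, (B i j - S i j) ^ 2 < γ * η ^ 2) :
    (∀ i j, adaptiveProj μ γ B i j ∈ Set.Icc (a - η) (b + η)) ∧
      ∑ i, ∑ j, (adaptiveProj μ γ B i j - S i j) ^ 2 ≤
        ∑ i, ∑ j, (B i j - S i j) ^ 2 + 2 * γ * (b - a + η) ^ 2 := by
  -- Markov's inequality: an entry off by at least η uses up η² of the squared error.
  have hcard : ∀ s : Finset (Fin n × Fin n),
      (∀ e ∈ s, η ≤ |B e.1 e.2 - S e.1 e.2|) → s.card < γ := by
    intro s hs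
    by_contra hcon
    push Not at hcon
    have h1 : (s.card : ℝ) * η ^ 2 ≤ ∑ e ∈ s, (B e.1 e.2 - S e.1 e.2) ^ 2 := by
      rw [← nsmul_eq_mul, ← Finset.sum_const]
      refine sum_le_sum fun e he => ?_
      rw [← sq_abs (B e.1 e.2 - S e.1 e.2)]
      exact pow_le_pow_left₀ hη.le (hs e he) 2
    have h2 : ∑ e ∈ s, (B e.1 e.2 - S e.1 e.2) ^ 2 ≤ ∑ i, ∑ j, (B i j - S i j) ^ 2 := by
      rw [← Finset.sum_product', univ_product_univ]
      exact sum_le_sum_of_subset_of_nonneg (subset_univ _) fun _ _ _ => sq_nonneg _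
    have h3 : (γ : ℝ) * η ^ 2 ≤ s.card * η ^ 2 := by gcongr
    linarith
  set lo := orderStat B γ with hlo
  set hi := orderStat B (n ^ 2 - γ) with hhi
  have hγn : γ ≤ n ^ 2 - γ := by omega
  have hlohi : lo ≤ hi := orderStat_mono hγ hγn (Nat.sub_le _ _)
  -- Otherwise the γ entries `≤ lo` would all lie more than η below the signal. The upper quantile
  -- is symmetric.
  have hlo1 : a - η ≤ lo := by
    by_contra h
    push Not at h
    have h1 := le_countLe_orderStat (E := B) (m := γ) (by omega)
    refine absurd (hcard _ fun e he => ?_) (not_lt.2 h1)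
    have h2 := (mem_filter.1 he).2
    have h3 := (hS e.1 e.2).1
    rw [abs_sub_comm]
    refine le_trans ?_ (le_abs_self _)
    linarith
  have hhi2 : hi ≤ b + η := by
    by_contra h
    push Not at h
    have h1 := card_lt_orderStat_lt (E := B) (m := n ^ 2 - γ) (by omega)
    have h4 := card_filter_add_card_filter_not (s := (univ : Finset (Fin n × Fin n)))
      (p := fun e => B e.1 e.2 < hi)
    have h5 : (univ : Finset (Fin n × Fin n)).card = n ^ 2 := by simp [sq]
    have h6 := hcard (univ.filter fun e : Fin n × Fin n => ¬ B e.1 e.2 < hi) fun e he => by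
      have h2 := not_lt.1 (mem_filter.1 he).2
      have h3 := (hS e.1 e.2).2
      refine le_trans ?_ (le_abs_self _)
      linarith
    rw [← hhi] at h1
    omega
  have hadm : ∀ l, 1 ≤ l → l ≤ n ^ 2 → orderStat B l ∈ Set.Icc (a - η) (b + η) →
      l ∈ admissibleIndices μ B := fun l h1 h2 h3 => ⟨h1, h2, hrange h3⟩
  -- Both trimming indices are admissible, so l₁ ≤ γ and n² - γ ≤ l₂, and the second interval in the
  -- adaptive intersection imposes no constraint.
  have hγadm : γ ∈ admissibleIndices μ B :=
    hadm _ hγ (by omega) ⟨hlo1, hlohi.trans hhi2⟩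
  have hγadm' : n ^ 2 - γ ∈ admissibleIndices μ B :=
    hadm _ (by omega) (by omega) ⟨hlo1.trans hlohi, hhi2⟩
  have hbdd : BddAbove (admissibleIndices μ B) := ⟨n ^ 2, fun l hl => hl.2.1⟩
  have elo : adaptiveLo μ γ B = lo := by
    refine max_eq_left (orderStat_mono ?_ (Nat.sInf_le hγadm) (by omega))
    exact (Nat.sInf_mem ⟨_, hγadm⟩).1
  have ehi : adaptiveHi μ γ B = hi := by
    refine min_eq_left (orderStat_mono (by omega) (le_csSup hbdd hγadm') ?_)
    exact (Nat.sSup_mem ⟨_, hγadm⟩ hbdd).2.1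
  have eproj : ∀ i j, adaptiveProj μ γ B i j = max lo (min hi (B i j)) := fun i j => by
    simp only [adaptiveProj, Matrix.map_apply, elo, ehi]
  have hmem : ∀ i j, adaptiveProj μ γ B i j ∈ Set.Icc (a - η) (b + η) := fun i j => by
    rw [eproj]
    exact ⟨hlo1.trans (le_max_left _ _),
      max_le (hlohi.trans hhi2) ((min_le_left _ _).trans hhi2)⟩
  refine ⟨hmem, ?_⟩
  set c := (b - a + η) ^ 2 with hc
  -- Entries in `[lo, hi]` do not move. A clipped entry lands in [a-η, b+η], at distance at most
  -- b-a+η from the signal, and at most γ entries are clipped on each side.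
  have hpt : ∀ i j, (adaptiveProj μ γ B i j - S i j) ^ 2 ≤ (B i j - S i j) ^ 2 +
      ((if B i j < lo then c else 0) + (if hi < B i j then c else 0)) := by
    intro i j
    have h0 : (adaptiveProj μ γ B i j - S i j) ^ 2 ≤ c := by
      rw [hc, ← sq_abs]
      refine pow_le_pow_left₀ (abs_nonneg _) (abs_le.2 ?_) 2
      have h1 := hmem i j
      have h2 := hS i j
      exact ⟨by linarith [h1.1, h2.2], by linarith [h1.2, h2.1]⟩
    have hc0 : 0 ≤ c := sq_nonneg _
    have hsq := sq_nonneg (B i j - S i j)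
    by_cases h1 : B i j < lo
    · rw [if_pos h1]; split_ifs <;> linarith
    by_cases h2 : hi < B i j
    · rw [if_neg h1, if_pos h2]; linarith
    rw [if_neg h1, if_neg h2, eproj, min_eq_right (not_lt.1 h2), max_eq_right (not_lt.1 h1)]
    linarith
  have hclo : ∑ i, ∑ j, (if B i j < lo then c else 0) ≤ γ * c := by
    rw [← Finset.sum_product', univ_product_univ, ← sum_filter, sum_const, nsmul_eq_mul]
    have := (card_lt_orderStat_lt (E := B) hγ).le
    gcongr
  have hchi : ∑ i, ∑ j, (if hi < B i j then c else 0) ≤ γ * c := by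
    rw [← Finset.sum_product', univ_product_univ, ← sum_filter, sum_const, nsmul_eq_mul]
    have h1 := countLe_add_card_lt (E := B) hi
    have h2 := le_countLe_orderStat (E := B) (m := n ^ 2 - γ) (Nat.sub_le _ _)
    rw [← hhi] at h2
    have : (univ.filter fun e : Fin n × Fin n => hi < B e.1 e.2).card ≤ γ := by omega
    gcongr
  calc _ ≤ ∑ i, ∑ j, ((B i j - S i j) ^ 2 +
      ((if B i j < lo then c else 0) + (if hi < B i j then c else 0))) :=
        sum_le_sum fun i _ => sum_le_sum fun j _ => hpt i j
    _ ≤ _ := by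
      simp only [sum_add_distrib]
      linarith

/-! ### The additive parameters and the residual matrix -/

/-- `(n I + 1 1ᵀ)⁻¹` in closed form. -/
theorem alphaInit_apply {n : ℕ} (hn : 0 < n) (T : Matrix (Fin n) (Fin n) ℝ) (i : Fin n) :
    alphaInit T i = (∑ j, T i j) / n - (∑ i', ∑ j, T i' j) / (2 * n ^ 2) := by
  have hn' : (n : ℝ) ≠ 0 := Nat.cast_ne_zero.2 hn.ne'
  set J : Matrix (Fin n) (Fin n) ℝ := Matrix.of fun _ _ => (1 : ℝ) with hJ
  have hJJ : J * J = (n : ℝ) • J := by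
    ext i j; simp [hJ, Matrix.mul_apply]
  have hinv : ((n : ℝ) • (1 : Matrix (Fin n) (Fin n) ℝ) + J)⁻¹ =
      (n : ℝ)⁻¹ • (1 : Matrix (Fin n) (Fin n) ℝ) - (2 * (n : ℝ) ^ 2)⁻¹ • J := by
    refine Matrix.inv_eq_right_inv ?_
    rw [Matrix.add_mul, Matrix.mul_sub, Matrix.mul_sub]
    simp only [Matrix.smul_mul, Matrix.mul_smul, Matrix.one_mul, Matrix.mul_one, hJJ]
    ext i j
    simp only [Matrix.sub_apply, Matrix.add_apply, Matrix.smul_apply, smul_eq_mul, hJ,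
      Matrix.of_apply]
    field_simp
    ring
  rw [alphaInit, hinv, Matrix.sub_mulVec, Matrix.smul_mulVec, Matrix.smul_mulVec]
  simp only [Pi.sub_apply, Pi.smul_apply, Matrix.one_mulVec, smul_eq_mul, Matrix.mulVec,
    dotProduct, mul_one, hJ, Matrix.of_apply, one_mul]
  rw [div_eq_inv_mul, div_eq_inv_mul]

/-- The rows of the residual matrix sum to zero. -/
theorem residual_row_sum {n : ℕ} (hn : 0 < n) (T : Matrix (Fin n) (Fin n) ℝ) (i : Fin n) :
    ∑ j, residual T (alphaInit T) i j = 0 := by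
  have hn' : (n : ℝ) ≠ 0 := Nat.cast_ne_zero.2 hn.ne'
  simp only [residual, Matrix.of_apply, Finset.sum_sub_distrib, Finset.sum_const, Finset.card_univ,
    Fintype.card_fin, nsmul_eq_mul, alphaInit_apply hn]
  rw [← Finset.sum_div]
  field_simp
  ring

/-- Since the columns of Z sum to zero, Θ1 = nα + (1ᵀα)1 = (nI + 11ᵀ)α. -/
theorem alphaInit_thetaMat {n k : ℕ} (hn : 0 < n) {Z : Matrix (Fin n) (Fin k) ℝ}
    (hZ : ∀ j, ∑ i, Z i j = 0) (α : Fin n → ℝ) : alphaInit (thetaMat Z α) = α := by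
  have hn' : (n : ℝ) ≠ 0 := Nat.cast_ne_zero.2 hn.ne'
  have hrow : ∀ i, ∑ j, thetaMat Z α i j = n * α i + ∑ j, α j := fun i => by
    have h0 : ∑ j, Z i ⬝ᵥ Z j = 0 := by
      simp only [dotProduct]
      rw [Finset.sum_comm]
      simp [← Finset.mul_sum, hZ]
    simp [thetaMat, Finset.sum_add_distrib, h0]
  ext i
  rw [alphaInit_apply hn]
  simp only [hrow, Finset.sum_add_distrib, Finset.sum_const, Finset.card_univ, Fintype.card_fin,
    nsmul_eq_mul, ← Finset.mul_sum]
  field_simp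
  ring

theorem alphaInit_sub {n : ℕ} (hn : 0 < n) (T S : Matrix (Fin n) (Fin n) ℝ) :
    alphaInit T - alphaInit S = alphaInit (T - S) := by
  ext i
  simp only [Pi.sub_apply, alphaInit_apply hn, Matrix.sub_apply, Finset.sum_sub_distrib]
  ring

/-- The map `T ↦ (n I + 1 1ᵀ)⁻¹ T 1` is bounded by `n^{-1/2}` times a constant. -/
theorem sum_sq_alphaInit_le {n : ℕ} (hn : 0 < n) (T : Matrix (Fin n) (Fin n) ℝ) :
    ∑ i, alphaInit T i ^ 2 ≤ 3 / n * ∑ i, ∑ j, T i j ^ 2 := by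
  have hn' : (0 : ℝ) < n := Nat.cast_pos.2 hn
  set F := ∑ i, ∑ j, T i j ^ 2 with hF
  have hrow : ∀ i, (∑ j, T i j) ^ 2 ≤ n * ∑ j, T i j ^ 2 := fun i => by
    have := sq_sum_le_card_mul_sum_sq (s := Finset.univ) (f := T i)
    simpa using this
  have hall : (∑ i, ∑ j, T i j) ^ 2 ≤ n ^ 2 * F := by
    have h1 := sq_sum_le_card_mul_sum_sq (s := Finset.univ) (f := fun i => ∑ j, T i j)
    have h2 : ∑ i, (∑ j, T i j) ^ 2 ≤ n * F := by
      rw [hF, Finset.mul_sum]; exact Finset.sum_le_sum fun i _ => hrow i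
    simp only [Finset.card_univ, Fintype.card_fin] at h1
    nlinarith
  have hpt : ∀ i, alphaInit T i ^ 2 ≤ 2 / n * ∑ j, T i j ^ 2 + F / (2 * n ^ 2) := fun i => by
    rw [alphaInit_apply hn]
    have h1 : ((∑ j, T i j) / n) ^ 2 ≤ (∑ j, T i j ^ 2) / n := by
      rw [div_pow, div_le_div_iff₀ (by positivity) hn']
      nlinarith [hrow i]
    have h2 : ((∑ i', ∑ j, T i' j) / (2 * n ^ 2)) ^ 2 ≤ F / (4 * n ^ 2) := by
      rw [div_pow, div_le_div_iff₀ (by positivity) (by positivity)]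
      nlinarith [hall, sq_nonneg (n : ℝ)]
    have h3 : F / (2 * (n : ℝ) ^ 2) = 2 * (F / (4 * n ^ 2)) := by field_simp; norm_num
    have h4 : 2 / (n : ℝ) * ∑ j, T i j ^ 2 = 2 * ((∑ j, T i j ^ 2) / n) := by ring
    rw [h3, h4]
    nlinarith [sq_nonneg ((∑ j, T i j) / n + (∑ i', ∑ j, T i' j) / (2 * n ^ 2))]
  calc _ ≤ ∑ i, (2 / n * ∑ j, T i j ^ 2 + F / (2 * n ^ 2)) := Finset.sum_le_sum fun i _ => hpt i
    _ = 2 / n * F + n * (F / (2 * n ^ 2)) := by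
        rw [Finset.sum_add_distrib, ← Finset.mul_sum]; simp [hF]
    _ = 5 / 2 / n * F := by field_simp; ring
    _ ≤ _ := by
        have : 0 ≤ F := Finset.sum_nonneg fun _ _ => Finset.sum_nonneg fun _ _ => sq_nonneg _
        gcongr; norm_num

theorem abs_alphaInit_le {n : ℕ} (hn : 0 < n) {T : Matrix (Fin n) (Fin n) ℝ} {b : ℝ}
    (hT : ∀ i j, |T i j| ≤ b) (i : Fin n) : |alphaInit T i| ≤ 2 * b := by
  have hn' : (0 : ℝ) < n := Nat.cast_pos.2 hn
  have hb : 0 ≤ b := (abs_nonneg _).trans (hT i i)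
  have hrow : ∀ i, |∑ j, T i j| ≤ n * b := fun i =>
    (Finset.abs_sum_le_sum_abs _ _).trans ((Finset.sum_le_sum fun j _ => hT i j).trans_eq
      (by simp))
  have hall : |∑ i, ∑ j, T i j| ≤ n * (n * b) :=
    (Finset.abs_sum_le_sum_abs _ _).trans ((Finset.sum_le_sum fun j _ => hrow j).trans_eq
      (by simp))
  rw [alphaInit_apply hn]
  refine (abs_sub _ _).trans ?_
  rw [abs_div, abs_div, abs_of_pos hn', abs_of_pos (show (0 : ℝ) < 2 * n ^ 2 by positivity)]
  have h1 : |∑ j, T i j| / n ≤ b := by rw [div_le_iff₀ hn']; linarith [hrow i]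
  have h2 : |∑ i, ∑ j, T i j| / (2 * n ^ 2) ≤ b := by
    rw [div_le_iff₀ (by positivity)]; nlinarith [hall, mul_nonneg hb (sq_nonneg (n : ℝ))]
  linarith

/-! ### Frobenius norm, polar factors and eigenvalue bounds -/

theorem OpBound.quadForm_le {n : Type*} [Fintype n] {M : Matrix n n ℝ} {c : ℝ} (h : OpBound M c)
    (v : n → ℝ) : v ⬝ᵥ M *ᵥ v ≤ c * (v ⬝ᵥ v) := by
  have := h v v
  rwa [mul_assoc, Real.mul_self_sqrt (dotProduct_self_nonneg' v)] at this

section Frobenius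

open scoped Matrix.Norms.Frobenius

theorem frobNorm_eq_norm {m n : Type*} [Fintype m] [Fintype n] (X : Matrix m n ℝ) :
    frobNorm X = ‖X‖ := by
  rw [Matrix.frobenius_norm_def, frobNorm, Real.sqrt_eq_rpow]
  simp

theorem norm_sq_eq_sum {m n : Type*} [Fintype m] [Fintype n] (X : Matrix m n ℝ) :
    ‖X‖ ^ 2 = ∑ i, ∑ j, X i j ^ 2 := by
  have h : frobNorm X ^ 2 = ∑ i, ∑ j, X i j ^ 2 :=
    Real.sq_sqrt (Finset.sum_nonneg fun _ _ => Finset.sum_nonneg fun _ _ => sq_nonneg _)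
  rw [← h, frobNorm_eq_norm]

theorem norm_sq_eq_trace {m n : Type*} [Fintype m] [Fintype n] (X : Matrix m n ℝ) :
    ‖X‖ ^ 2 = (Xᵀ * X).trace := by
  rw [norm_sq_eq_sum, trace_transpose_mul_self]; simp [sq]

theorem norm_orthogonal_mul {n : ℕ} {m : Type*} [Fintype m] {U : Matrix (Fin n) (Fin n) ℝ}
    (hU : Uᵀ * U = 1) (X : Matrix (Fin n) m ℝ) : ‖U * X‖ = ‖X‖ := by
  rw [← sq_eq_sq₀ (norm_nonneg _) (norm_nonneg _), norm_sq_eq_trace, norm_sq_eq_trace,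
    Matrix.transpose_mul, Matrix.mul_assoc, ← Matrix.mul_assoc Uᵀ, hU, Matrix.one_mul]

theorem norm_mul_orthogonal {n : ℕ} {m : Type*} [Fintype m] {U : Matrix (Fin n) (Fin n) ℝ}
    (hU : U * Uᵀ = 1) (X : Matrix m (Fin n) ℝ) : ‖X * U‖ = ‖X‖ := by
  rw [← Matrix.frobenius_norm_transpose, Matrix.transpose_mul,
    norm_orthogonal_mul (by rwa [Matrix.transpose_transpose]), Matrix.frobenius_norm_transpose]

theorem abs_entry_le_norm {m n : Type*} [Fintype m] [Fintype n] (X : Matrix m n ℝ) (i : m)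
    (j : n) : |X i j| ≤ ‖X‖ := by
  rw [← sq_le_sq₀ (abs_nonneg _) (norm_nonneg _), norm_sq_eq_sum, sq_abs]
  exact (Finset.single_le_sum (f := fun j => X i j ^ 2) (fun _ _ => sq_nonneg _)
    (Finset.mem_univ j)).trans (Finset.single_le_sum (f := fun i => ∑ j, X i j ^ 2)
      (fun _ _ => Finset.sum_nonneg fun _ _ => sq_nonneg _) (Finset.mem_univ i))

theorem opBound_norm {n : ℕ} (X : Matrix (Fin n) (Fin n) ℝ) : OpBound X ‖X‖ := by
  intro u v
  refine (dotProduct_le_sqrt _ _).trans ?_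
  have h : √(X *ᵥ v ⬝ᵥ X *ᵥ v) ≤ ‖X‖ * √(v ⬝ᵥ v) := by
    rw [← Real.sqrt_sq (norm_nonneg X), ← Real.sqrt_mul (sq_nonneg _)]
    apply Real.sqrt_le_sqrt
    rw [norm_sq_eq_sum, Finset.sum_mul]
    refine Finset.sum_le_sum fun i _ => ?_
    have := Finset.sum_mul_sq_le_sq_mul_sq Finset.univ (X i) v
    simpa [dotProduct, Matrix.mulVec, sq] using this
  calc _ ≤ √(u ⬝ᵥ u) * (‖X‖ * √(v ⬝ᵥ v)) := by gcongr
    _ = _ := by ring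

/-- An almost orthogonal matrix is close to an orthogonal matrix (polar decomposition). -/
theorem exists_orthogonal_near {k : ℕ} {B : Matrix (Fin k) (Fin k) ℝ} (h : ‖B * Bᵀ - 1‖ < 1) :
    ∃ Q ∈ Matrix.orthogonalGroup (Fin k) ℝ, ‖B - Q‖ ≤ ‖B * Bᵀ - 1‖ := by
  obtain ⟨O, hO, e, -, he⟩ := exists_eigen (X := B * Bᵀ) (Matrix.isSymm_mul_transpose_self B)
  have hOt := orthogonal_mul_transpose hO
  have hO := transpose_mul_orthogonal hO
  have hmul : ∀ a b : Fin k → ℝ, O * Matrix.diagonal a * Oᵀ * (O * Matrix.diagonal b * Oᵀ) =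
      O * Matrix.diagonal (fun i => a i * b i) * Oᵀ := fun a b => by
    rw [← Matrix.diagonal_mul_diagonal]
    simp only [Matrix.mul_assoc]
    rw [← Matrix.mul_assoc Oᵀ O, hO, Matrix.one_mul]
  have htr : ∀ a : Fin k → ℝ, (O * Matrix.diagonal a * Oᵀ)ᵀ = O * Matrix.diagonal a * Oᵀ :=
    fun a => by simp [Matrix.transpose_mul, Matrix.mul_assoc]
  have hone : O * Matrix.diagonal (fun _ => (1 : ℝ)) * Oᵀ = 1 := by simp [hOt]
  have hnorm : ∀ a : Fin k → ℝ, ‖O * Matrix.diagonal a * Oᵀ‖ ^ 2 = ∑ i, a i ^ 2 := fun a => by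
    rw [norm_mul_orthogonal (by rwa [Matrix.transpose_transpose]), norm_orthogonal_mul hO,
      norm_sq_eq_sum]
    refine Finset.sum_congr rfl fun i _ => ?_
    rw [Finset.sum_eq_single i]
    · simp
    · intro j _ hj; simp [Matrix.diagonal_apply_ne' _ hj]
    · simp
  have hB1 : B * Bᵀ - 1 = O * Matrix.diagonal (fun i => e i - 1) * Oᵀ := by
    rw [he, ← hone, ← Matrix.sub_mul, ← Matrix.mul_sub, Matrix.diagonal_sub]
  have hρ : ‖B * Bᵀ - 1‖ ^ 2 = ∑ i, (e i - 1) ^ 2 := by rw [hB1, hnorm]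
  have hpos : ∀ i, 0 < e i := by
    intro i
    have h1 : (e i - 1) ^ 2 ≤ ‖B * Bᵀ - 1‖ ^ 2 := by
      rw [hρ]
      exact Finset.single_le_sum (f := fun i => (e i - 1) ^ 2) (fun _ _ => sq_nonneg _)
        (Finset.mem_univ i)
    have h2 := (abs_lt_of_sq_lt_sq (h1.trans_lt
      (by nlinarith [norm_nonneg (B * Bᵀ - 1)] : _ < (1 : ℝ) ^ 2)) zero_le_one)
    linarith [(abs_lt.1 h2).1]
  set r : Fin k → ℝ := fun i => √(e i) with hr
  have hr0 : ∀ i, 0 < r i := fun i => Real.sqrt_pos.2 (hpos i)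
  have hrr : ∀ i, r i * r i = e i := fun i => Real.mul_self_sqrt (hpos i).le
  -- Polar factor Q = (BBᵀ)^{-1/2}B; the inverse root exists because the eigenvalues e of BBᵀ are
  -- strictly within 1 of 1. The distance from B to Q is governed by |√e - 1| ≤ |e - 1|.
  set Q := O * Matrix.diagonal (fun i => (r i)⁻¹) * Oᵀ * B with hQ
  have hBQ : B = O * Matrix.diagonal r * Oᵀ * Q := by
    rw [hQ, ← Matrix.mul_assoc, hmul]
    have : (fun i => r i * (r i)⁻¹) = fun _ => (1 : ℝ) := by
      ext i; exact mul_inv_cancel₀ (hr0 i).ne'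
    rw [this, hone, Matrix.one_mul]
  have hQQ : Q * Qᵀ = 1 := by
    rw [hQ, Matrix.transpose_mul, htr, Matrix.mul_assoc _ B, ← Matrix.mul_assoc B, he, hmul, hmul,
      ← hone]
    congr 3
    ext i
    have := (hr0 i).ne'
    rw [← hrr i]; field_simp
  refine ⟨Q, ?_, ?_⟩
  · rw [Matrix.mem_orthogonalGroup_iff]
    simpa [Matrix.star_eq_conjTranspose] using hQQ
  · have h1 : B - Q = O * Matrix.diagonal (fun i => r i - 1) * Oᵀ * Q := by
      conv_lhs => rw [hBQ]
      rw [← Matrix.diagonal_sub, Matrix.mul_sub, Matrix.sub_mul, Matrix.sub_mul, hone,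
        Matrix.one_mul]
    rw [← sq_le_sq₀ (norm_nonneg _) (norm_nonneg _), hρ, h1, norm_mul_orthogonal hQQ, hnorm]
    refine Finset.sum_le_sum fun i _ => ?_
    have := hr0 i
    rw [← hrr i]
    have h2 : (r i * r i - 1) ^ 2 = (r i - 1) ^ 2 * (r i + 1) ^ 2 := by ring
    rw [h2]
    have h3 : 1 ≤ (r i + 1) ^ 2 := by nlinarith
    nlinarith [sq_nonneg (r i - 1)]

theorem quadForm_eigen {n : ℕ} (U : Matrix (Fin n) (Fin n) ℝ) (d : Fin n → ℝ) (v : Fin n → ℝ) :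
    v ⬝ᵥ (U * Matrix.diagonal d * Uᵀ) *ᵥ v = ∑ i, d i * (Uᵀ *ᵥ v) i ^ 2 := by
  rw [← Matrix.mulVec_mulVec, ← Matrix.mulVec_mulVec, Matrix.dotProduct_mulVec,
    ← Matrix.mulVec_transpose, dotProduct]
  refine Finset.sum_congr rfl fun i _ => ?_
  rw [Matrix.mulVec_diagonal]; ring

theorem exists_ne_zero_of_card_lt {p q : ℕ} (h : p < q) (A : Matrix (Fin p) (Fin q) ℝ) :
    ∃ w : Fin q → ℝ, w ≠ 0 ∧ A *ᵥ w = 0 := by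
  have := LinearMap.ker_ne_bot_of_finrank_lt (f := Matrix.mulVecLin A) (by simpa using h)
  obtain ⟨w, hw, hw0⟩ := Submodule.exists_mem_ne_zero_of_ne_bot this
  exact ⟨w, hw0, by simpa using hw⟩

section Eigen

variable {n k : ℕ} {U : Matrix (Fin n) (Fin n) ℝ} {d : Fin n → ℝ} {Z : Matrix (Fin n) (Fin k) ℝ}

/-- Lower bound for the leading eigenvalues of a perturbation of `Z Zᵀ`. -/
theorem le_eigenvalue (hUt : U * Uᵀ = 1) (hd : Antitone d)
    {m : ℝ} (hm : 0 < m) (hdiag : (Zᵀ * Z).IsDiag) (hlow : ∀ l, m ≤ (Zᵀ * Z) l l)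
    {i : Fin n} (hi : (i : ℕ) < k) :
    m - ‖U * Matrix.diagonal d * Uᵀ - Z * Zᵀ‖ ≤ d i := by
  -- Min-max by hand: i < k linear conditions leave a nonzero `w` such that v = Zw is orthogonal to
  -- the first i eigenvectors. At v the perturbed form is at most `d i` times |v|², and that of ZZᵀ
  -- at least m times |v|².
  obtain ⟨w, hw0, hw⟩ := exists_ne_zero_of_card_lt hi
    (Matrix.of fun (p : Fin i) (l : Fin k) => (Uᵀ * Z) (Fin.castLE i.2.le p) l)
  set v := Z *ᵥ w with hv
  have hzero : ∀ p : Fin n, p < i → (Uᵀ *ᵥ v) p = 0 := by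
    intro p hp
    have := congrFun hw ⟨p, hp⟩
    rw [hv, Matrix.mulVec_mulVec]
    exact this
  have hvv : v ⬝ᵥ v = ∑ l, (Zᵀ * Z) l l * w l ^ 2 := by
    rw [hv, dotProduct_mulVec_self]
    conv_lhs => rw [← hdiag.diagonal_diag]
    simp only [dotProduct, Matrix.mulVec_diagonal, Matrix.diag_apply]
    exact Finset.sum_congr rfl fun l _ => by ring
  have hGG : v ⬝ᵥ (Z * Zᵀ) *ᵥ v = ∑ l, ((Zᵀ * Z) l l * w l) ^ 2 := by
    have h1 : v ⬝ᵥ (Z * Zᵀ) *ᵥ v = Zᵀ *ᵥ v ⬝ᵥ Zᵀ *ᵥ v := by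
      rw [dotProduct_mulVec_self, Matrix.transpose_transpose]
    rw [h1, hv, Matrix.mulVec_mulVec]
    conv_lhs => rw [← hdiag.diagonal_diag]
    simp only [dotProduct, Matrix.mulVec_diagonal, Matrix.diag_apply]
    exact Finset.sum_congr rfl fun l _ => by ring
  have hvpos : 0 < v ⬝ᵥ v := by
    obtain ⟨l, hl⟩ := Function.ne_iff.1 hw0
    have hl' : 0 < w l ^ 2 := sq_pos_of_ne_zero hl
    rw [hvv]
    refine Finset.sum_pos' (fun l _ => mul_nonneg (hm.le.trans (hlow l)) (sq_nonneg _))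
      ⟨l, Finset.mem_univ _, mul_pos (hm.trans_le (hlow l)) hl'⟩
  have hGlow : m * (v ⬝ᵥ v) ≤ v ⬝ᵥ (Z * Zᵀ) *ᵥ v := by
    rw [hvv, hGG, Finset.mul_sum]
    refine Finset.sum_le_sum fun l _ => ?_
    have h1 := hlow l
    have h2 : 0 ≤ (Zᵀ * Z) l l * w l ^ 2 := mul_nonneg (hm.le.trans h1) (sq_nonneg _)
    nlinarith
  have hup : v ⬝ᵥ (U * Matrix.diagonal d * Uᵀ) *ᵥ v ≤ d i * (v ⬝ᵥ v) := by
    rw [quadForm_eigen]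
    have : v ⬝ᵥ v = ∑ p, (Uᵀ *ᵥ v) p ^ 2 := by
      have h1 := dotProduct_mulVec_self Uᵀ v
      rw [Matrix.transpose_transpose, hUt, Matrix.one_mulVec] at h1
      rw [← h1]; simp [dotProduct, sq]
    rw [this, Finset.mul_sum]
    refine Finset.sum_le_sum fun p _ => ?_
    by_cases hp : p < i
    · rw [hzero p hp]; simp
    · exact mul_le_mul_of_nonneg_right (hd (not_lt.1 hp)) (sq_nonneg _)
  have hΔ := (opBound_norm (U * Matrix.diagonal d * Uᵀ - Z * Zᵀ)).neg.quadForm_le v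
  rw [Matrix.neg_mulVec, Matrix.sub_mulVec,
    dotProduct_neg, dotProduct_sub] at hΔ
  have : (m - ‖U * Matrix.diagonal d * Uᵀ - Z * Zᵀ‖) * (v ⬝ᵥ v) ≤ d i * (v ⬝ᵥ v) := by linarith
  exact le_of_mul_le_mul_right this hvpos

/-- Upper bound for the trailing eigenvalues of a perturbation of `Z Zᵀ`. -/
theorem eigenvalue_le (hU : Uᵀ * U = 1) (hd : Antitone d) {i : Fin n} (hi : k ≤ (i : ℕ)) :
    d i ≤ ‖U * Matrix.diagonal d * Uᵀ - Z * Zᵀ‖ := by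
  -- Dually, the span of the first i+1 > k eigenvectors contains a nonzero v with Zᵀv = 0.
  obtain ⟨w, hw0, hw⟩ := exists_ne_zero_of_card_lt (Nat.lt_succ_of_le hi)
    (Matrix.of fun (l : Fin k) (p : Fin (i + 1)) => (Zᵀ * U) l (Fin.castLE i.2 p))
  let y : Fin n → ℝ := fun p => if h : (p : ℕ) < i + 1 then w ⟨p, h⟩ else 0
  have hyc : ∀ p : Fin (i + 1), y (Fin.castLE i.2 p) = w p := fun p => dif_pos p.2
  have hy0 : ∀ p : Fin n, ¬ (p : ℕ) < i + 1 → y p = 0 := fun p hp => dif_neg hp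
  have hy : ∀ f : Fin n → ℝ, ∑ p, f p * y p = ∑ p : Fin (i + 1), f (Fin.castLE i.2 p) * w p := by
    intro f
    have h1 : ∑ p : Fin (i + 1), f (Fin.castLE i.2 p) * w p =
        ∑ p ∈ Finset.univ.image (Fin.castLE i.2), f p * y p := by
      rw [Finset.sum_image fun a _ b _ h => Fin.castLE_injective _ h]
      exact Finset.sum_congr rfl fun p _ => by rw [hyc]
    rw [h1]
    symm
    refine Finset.sum_subset (Finset.subset_univ _) fun p _ hp => ?_
    rw [hy0 p fun h => hp (Finset.mem_image.2 ⟨⟨p, h⟩, Finset.mem_univ _, rfl⟩), mul_zero]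
  set v := U *ᵥ y with hv
  have hZv : Zᵀ *ᵥ v = 0 := by
    ext l
    rw [hv, Matrix.mulVec_mulVec]
    have := congrFun hw l
    simp only [Matrix.mulVec, dotProduct] at this ⊢
    rw [hy]; exact this
  have hUv : Uᵀ *ᵥ v = y := by rw [hv, Matrix.mulVec_mulVec, hU, Matrix.one_mulVec]
  have hvv : v ⬝ᵥ v = ∑ p, y p ^ 2 := by
    rw [hv, dotProduct_mulVec_self, hU, Matrix.one_mulVec]; simp [dotProduct, sq]
  have hvpos : 0 < v ⬝ᵥ v := by
    obtain ⟨p, hp⟩ := Function.ne_iff.1 hw0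
    rw [hvv]
    refine Finset.sum_pos' (fun _ _ => sq_nonneg _) ⟨Fin.castLE i.2 p, Finset.mem_univ _, ?_⟩
    rw [hyc]
    exact sq_pos_of_ne_zero hp
  have hlow : d i * (v ⬝ᵥ v) ≤ v ⬝ᵥ (U * Matrix.diagonal d * Uᵀ) *ᵥ v := by
    rw [quadForm_eigen, hUv, hvv, Finset.mul_sum]
    refine Finset.sum_le_sum fun p _ => ?_
    by_cases hp : (p : ℕ) < i + 1
    · exact mul_le_mul_of_nonneg_right (hd (Nat.lt_succ_iff.1 hp)) (sq_nonneg _)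
    · simp [hy0 p hp]
  have hG : v ⬝ᵥ (Z * Zᵀ) *ᵥ v = 0 := by rw [← Matrix.mulVec_mulVec, hZv]; simp
  have hΔ := (opBound_norm (U * Matrix.diagonal d * Uᵀ - Z * Zᵀ)).quadForm_le v
  rw [Matrix.sub_mulVec, dotProduct_sub, hG] at hΔ
  exact le_of_mul_le_mul_right (by linarith) hvpos

end Eigen

end Frobenius

/-! ### Perturbation of spectral square roots -/

section Procrustes

open scoped Matrix.Norms.Frobenius

theorem norm_le_of_abs_entry_le {m n : Type*} [Fintype m] [Fintype n] {A Y : Matrix m n ℝ} {c : ℝ}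
    (hc : 0 ≤ c) (h : ∀ i j, |A i j| ≤ c * |Y i j|) : ‖A‖ ≤ c * ‖Y‖ := by
  rw [← sq_le_sq₀ (norm_nonneg _) (by positivity), mul_pow, norm_sq_eq_sum, norm_sq_eq_sum,
    Finset.mul_sum]
  refine Finset.sum_le_sum fun i _ => ?_
  rw [Finset.mul_sum]
  refine Finset.sum_le_sum fun j _ => ?_
  rw [← sq_abs, ← sq_abs (Y i j), ← mul_pow]
  exact pow_le_pow_left₀ (abs_nonneg _) (h i j) 2

theorem sum_fin_split {n k : ℕ} (hkn : k ≤ n) (f : Fin n → ℝ) :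
    ∑ i, f i = ∑ j : Fin k, f (Fin.castLE hkn j) + ∑ i : Fin n, if (i : ℕ) < k then 0 else f i := by
  have h1 : ∑ j : Fin k, f (Fin.castLE hkn j) = ∑ i : Fin n, if (i : ℕ) < k then f i else 0 := by
    rw [← Finset.sum_filter, ← Finset.sum_image (s := Finset.univ) (g := Fin.castLE hkn)
      fun a _ b _ h => Fin.castLE_injective _ h]
    refine Finset.sum_congr (Finset.ext fun i => ?_) fun _ _ => rfl
    simp only [Finset.mem_image, Finset.mem_univ, true_and, Finset.mem_filter]
    constructor
    · rintro ⟨j, rfl⟩; exact j.2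
    · exact fun h => ⟨⟨i, h⟩, rfl⟩
  rw [h1, ← Finset.sum_add_distrib]
  refine Finset.sum_congr rfl fun i _ => ?_
  split_ifs <;> simp

/-- The norm of a matrix in terms of its first rows and the remaining ones. -/
theorem norm_sq_split {n k l : ℕ} (hkn : k ≤ n) (Y : Matrix (Fin n) (Fin l) ℝ) :
    ‖Y‖ ^ 2 = ‖Y.submatrix (Fin.castLE hkn) id‖ ^ 2 +
      ‖(Matrix.of fun i j => if (i : ℕ) < k then 0 else Y i j : Matrix (Fin n) (Fin l) ℝ)‖ ^ 2 := by
  rw [norm_sq_eq_sum, norm_sq_eq_sum, norm_sq_eq_sum, sum_fin_split hkn]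
  congr 1
  refine Finset.sum_congr rfl fun i _ => ?_
  simp only [Matrix.of_apply]
  split_ifs <;> simp

theorem norm_submatrix_castLE_le {n k l : ℕ} (hkn : k ≤ n) (Y : Matrix (Fin n) (Fin l) ℝ) :
    ‖Y.submatrix (Fin.castLE hkn) id‖ ≤ ‖Y‖ := by
  rw [← sq_le_sq₀ (norm_nonneg _) (norm_nonneg _), norm_sq_split hkn Y]
  linarith [sq_nonneg ‖(Matrix.of fun i j => if (i : ℕ) < k then 0 else Y i j :
    Matrix (Fin n) (Fin l) ℝ)‖]

theorem procrustesDist_le {n k : ℕ} (Zhat Z : Matrix (Fin n) (Fin k) ℝ)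
    {Q : Matrix (Fin k) (Fin k) ℝ} (hQ : Q ∈ Matrix.orthogonalGroup (Fin k) ℝ) :
    procrustesDist Zhat Z ≤ ‖Zhat - Z * Q‖ := by
  rw [← frobNorm_eq_norm]
  exact ciInf_le ⟨0, by rintro _ ⟨Q, rfl⟩; exact Real.sqrt_nonneg _⟩
    (⟨Q, hQ⟩ : Matrix.orthogonalGroup (Fin k) ℝ)

/-- Perturbation of the positively truncated square root of a Gram matrix `Z Zᵀ` with diagonal
`Zᵀ Z`: the leading eigenvalues stay positive, and the Procrustes distance is linear in the
perturbation. -/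
theorem topSqrt_perturbation {n k : ℕ} (hkn : k ≤ n) {U X : Matrix (Fin n) (Fin n) ℝ}
    {d : Fin n → ℝ} {Z : Matrix (Fin n) (Fin k) ℝ} (hUt : U * Uᵀ = 1) (hU : Uᵀ * U = 1)
    (hd : Antitone d) (hX : X = U * Matrix.diagonal d * Uᵀ) {m M δ : ℝ} (hm : 0 < m)
    (hM : 0 ≤ M) (hdiag : (Zᵀ * Z).IsDiag) (hlow : ∀ l, m ≤ (Zᵀ * Z) l l)
    (hup : ∀ l, (Zᵀ * Z) l l ≤ M) (hδ : ‖X - Z * Zᵀ‖ ≤ δ) (hδm : δ ≤ m / 2)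
    (hρ : 4 * (k * M) * δ / m ^ 2 < 1) :
    (∀ j : Fin k, m / 2 ≤ d (Fin.castLE hkn j)) ∧
      procrustesDist (Matrix.of fun i j => √(d (Fin.castLE hkn j)) * U i (Fin.castLE hkn j)) Z ≤
        √(k * M + m) * (4 * (k * M) * δ / m ^ 2) + 2 / m * (δ * √(k * M)) := by
  have hlead : ∀ j : Fin k, m / 2 ≤ d (Fin.castLE hkn j) := fun j => by
    have := le_eigenvalue hUt hd hm hdiag hlow (i := Fin.castLE hkn j) (by simp)
    rw [← hX] at this
    linarith
  refine ⟨hlead, ?_⟩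
  have hδ0 : 0 ≤ δ := (norm_nonneg _).trans hδ
  set b := √(k * M) with hb
  have hb0 : 0 ≤ b := Real.sqrt_nonneg _
  have hbb : b * b = k * M := Real.mul_self_sqrt (by positivity)
  set lam : Fin k → ℝ := fun l => (Zᵀ * Z) l l with hlam
  have hΛ : Zᵀ * Z = Matrix.diagonal lam := hdiag.diagonal_diag.symm
  have hZ : ‖Z‖ ≤ b := by
    refine Real.le_sqrt_of_sq_le ?_
    rw [norm_sq_eq_trace, Matrix.trace]
    calc _ ≤ ∑ _l : Fin k, M := Finset.sum_le_sum fun l _ => hup l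
      _ = _ := by simp
  set V := Uᵀ * Z with hV
  have hUU : Uᵀᵀ * Uᵀ = 1 := by rwa [Matrix.transpose_transpose]
  have hVn : ‖V‖ ≤ b := by rwa [hV, norm_orthogonal_mul hUU]
  have hVV : Vᵀ * V = Matrix.diagonal lam := by
    rw [hV, Matrix.transpose_mul, Matrix.transpose_transpose, Matrix.mul_assoc,
      ← Matrix.mul_assoc U, hUt, Matrix.one_mul, hΛ]
  -- R = DV - VΛ, entrywise R i l = (d i - lam l) V i l. Only the gap between the trailing `d i ≤
  -- m/2` and `lam l ≥ m` is ever divided by, so no separation among the leading eigenvalues is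
  -- required.
  set R := Uᵀ * ((X - Z * Zᵀ) * Z) with hR
  have hRn : ‖R‖ ≤ δ * b := by
    rw [hR, norm_orthogonal_mul hUU]
    exact (Matrix.frobenius_norm_mul _ _).trans (mul_le_mul hδ hZ (norm_nonneg _) hδ0)
  have hReq : R = Matrix.diagonal d * V - V * Matrix.diagonal lam := by
    rw [hR, Matrix.sub_mul, Matrix.mul_sub, hX, ← hΛ, hV]
    simp only [Matrix.mul_assoc]
    rw [← Matrix.mul_assoc Uᵀ U, hU, Matrix.one_mul]
  have hRent : ∀ i l, R i l = (d i - lam l) * V i l := fun i l => by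
    rw [hReq]; simp; ring
  -- the trailing rows of `V`
  set Vb : Matrix (Fin n) (Fin k) ℝ :=
    Matrix.of fun i l => if (i : ℕ) < k then 0 else V i l with hVb
  have hVbn : ‖Vb‖ ≤ 2 / m * (δ * b) := by
    refine (norm_le_of_abs_entry_le (Y := R) (by positivity) fun i l => ?_).trans
      (mul_le_mul_of_nonneg_left hRn (by positivity))
    simp only [hVb, Matrix.of_apply]
    split_ifs with h
    · rw [abs_zero]; positivity
    · have h1 := eigenvalue_le (Z := Z) hU hd (not_lt.1 h)
      rw [← hX] at h1
      have h2 : m ≤ lam l := hlow l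
      have h3 : m / 2 ≤ |d i - lam l| := by
        rw [abs_sub_comm]; exact le_trans (by linarith) (le_abs_self _)
      rw [hRent, abs_mul]
      calc |V i l| = 2 / m * (m / 2 * |V i l|) := by field_simp
        _ ≤ 2 / m * (|d i - lam l| * |V i l|) := by gcongr
  have hVbn' : ‖Vb‖ ≤ b := by
    refine (norm_le_of_abs_entry_le (Y := V) zero_le_one fun i l => ?_).trans
      (by rw [one_mul]; exact hVn)
    simp only [hVb, Matrix.of_apply]
    split_ifs <;> simp
  -- the leading rows of `V`
  set T : Matrix (Fin k) (Fin k) ℝ := V.submatrix (Fin.castLE hkn) id with hT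
  set RT : Matrix (Fin k) (Fin k) ℝ := R.submatrix (Fin.castLE hkn) id with hRT
  have hTn : ‖T‖ ≤ b := (norm_submatrix_castLE_le hkn V).trans hVn
  have hRTn : ‖RT‖ ≤ δ * b := (norm_submatrix_castLE_le hkn R).trans hRn
  have hsplit : Matrix.diagonal lam = Tᵀ * T + Vbᵀ * Vb := by
    rw [← hVV]
    ext l l'
    simp only [Matrix.mul_apply, Matrix.add_apply, Matrix.transpose_apply]
    rw [sum_fin_split hkn]
    congr 1
    refine Finset.sum_congr rfl fun i _ => ?_
    simp only [hVb, Matrix.of_apply]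
    split_ifs <;> simp
  set D : Fin k → ℝ := fun j => d (Fin.castLE hkn j) with hD
  have hD0 : ∀ j, 0 < D j := fun j => (half_pos hm).trans_le (hlead j)
  set r : Fin k → ℝ := fun j => √(D j) with hr
  have hr0 : ∀ j, 0 < r j := fun j => Real.sqrt_pos.2 (hD0 j)
  have hrr : ∀ j, r j * r j = D j := fun j => Real.mul_self_sqrt (hD0 j).le
  -- B is the rotation aligning Z with the estimate, up to orthogonalization: D^{1/2}Bᵀ is the
  -- leading block T of UᵀZ.
  set B : Matrix (Fin k) (Fin k) ℝ := Tᵀ * Matrix.diagonal (fun j => (r j)⁻¹) with hB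
  have hBB : B * Bᵀ = Tᵀ * (Matrix.diagonal (fun j => (D j)⁻¹) * T) := by
    rw [hB, Matrix.transpose_mul, Matrix.transpose_transpose, Matrix.diagonal_transpose,
      Matrix.mul_assoc, ← Matrix.mul_assoc (Matrix.diagonal _), Matrix.diagonal_mul_diagonal]
    congr 3
    ext j
    rw [← mul_inv, hrr]
  have hRTeq : Matrix.diagonal (fun j => (D j)⁻¹) * RT =
      T - Matrix.diagonal (fun j => (D j)⁻¹) * T * Matrix.diagonal lam := by
    ext j l
    simp only [hRT, Matrix.sub_apply, Matrix.diagonal_mul, Matrix.mul_diagonal,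
      Matrix.submatrix_apply, id, hRent, hT]
    have := (hD0 j).ne'
    change (D j)⁻¹ * ((D j - lam l) * _) = _
    field_simp
  -- Combining TᵀT = Λ - VbᵀVb with D⁻¹RT = T - D⁻¹TΛ gives (1 - BBᵀ)Λ = VbᵀVb + TᵀD⁻¹RT, and both
  -- terms on the right have bounds linear in δ.
  have hmain : B * Bᵀ - 1 = -((Vbᵀ * Vb + Tᵀ * (Matrix.diagonal (fun j => (D j)⁻¹) * RT)) *
      Matrix.diagonal fun l => (lam l)⁻¹) := by
    have h1 : Vbᵀ * Vb + Tᵀ * (Matrix.diagonal (fun j => (D j)⁻¹) * RT) =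
        (1 - B * Bᵀ) * Matrix.diagonal lam := by
      rw [hRTeq, Matrix.mul_sub, Matrix.sub_mul, Matrix.one_mul, hBB]
      have e : Tᵀ * T = Matrix.diagonal lam - Vbᵀ * Vb := eq_sub_of_add_eq hsplit.symm
      rw [e]
      simp only [Matrix.mul_assoc]
      abel
    have h2 : Matrix.diagonal lam * Matrix.diagonal (fun l => (lam l)⁻¹) = 1 := by
      rw [Matrix.diagonal_mul_diagonal, ← Matrix.diagonal_one]
      congr 1
      ext l
      exact mul_inv_cancel₀ (hm.trans_le (hlow l)).ne'
    rw [h1, Matrix.mul_assoc (1 - B * Bᵀ), h2, Matrix.mul_one, neg_sub]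
  have hBBn : ‖B * Bᵀ - 1‖ ≤ 4 * (k * M) * δ / m ^ 2 := by
    rw [hmain, norm_neg]
    have e1 : ‖Matrix.diagonal (fun j => (D j)⁻¹) * RT‖ ≤ 2 / m * (δ * b) := by
      refine (norm_le_of_abs_entry_le (Y := RT) (by positivity) fun j l => ?_).trans
        (mul_le_mul_of_nonneg_left hRTn (by positivity))
      rw [Matrix.diagonal_mul, abs_mul, abs_of_pos (inv_pos.2 (hD0 j))]
      gcongr
      rw [← inv_div]
      exact inv_anti₀ (half_pos hm) (hlead j)
    have e2 : ‖Vbᵀ * Vb‖ ≤ b * (2 / m * (δ * b)) := by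
      refine (Matrix.frobenius_norm_mul _ _).trans ?_
      rw [Matrix.frobenius_norm_transpose]
      exact mul_le_mul hVbn' hVbn (norm_nonneg _) hb0
    have e3 : ‖Tᵀ * (Matrix.diagonal (fun j => (D j)⁻¹) * RT)‖ ≤ b * (2 / m * (δ * b)) := by
      refine (Matrix.frobenius_norm_mul _ _).trans ?_
      rw [Matrix.frobenius_norm_transpose]
      exact mul_le_mul hTn e1 (norm_nonneg _) hb0
    refine (norm_le_of_abs_entry_le (c := 1 / m)
      (Y := Vbᵀ * Vb + Tᵀ * (Matrix.diagonal (fun j => (D j)⁻¹) * RT)) (by positivity)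
      fun j l => ?_).trans ?_
    · rw [Matrix.mul_diagonal, abs_mul, abs_of_pos (inv_pos.2 (hm.trans_le (hlow l))), mul_comm,
        one_div]
      gcongr
      exact hlow l
    · calc _ ≤ 1 / m * (b * (2 / m * (δ * b)) + b * (2 / m * (δ * b))) := by
            gcongr; exact (norm_add_le _ _).trans (add_le_add e2 e3)
        _ = 4 * (b * b) * δ / m ^ 2 := by field_simp; ring
        _ = _ := by rw [hbb]
  obtain ⟨Q, hQ, hBQ⟩ := exists_orthogonal_near (hBBn.trans_lt hρ)
  have hQt := orthogonal_mul_transpose hQ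
  have hQ' := transpose_mul_orthogonal hQ
  refine (procrustesDist_le _ Z hQ).trans ?_
  have hrmax : ∀ j, r j ≤ √(k * M + m) := fun j => by
    apply Real.sqrt_le_sqrt
    have h1 : ‖Uᵀ * X * U‖ = ‖X‖ := by
      rw [norm_mul_orthogonal hUt, norm_orthogonal_mul hUU]
    have h2 : Uᵀ * X * U = Matrix.diagonal d := by
      rw [hX]
      simp only [Matrix.mul_assoc]
      rw [hU, Matrix.mul_one, ← Matrix.mul_assoc, hU, Matrix.one_mul]
    have h3 := abs_entry_le_norm (Uᵀ * X * U) (Fin.castLE hkn j) (Fin.castLE hkn j)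
    rw [h1, h2, Matrix.diagonal_apply_eq] at h3
    have h4 : ‖X‖ ≤ ‖X - Z * Zᵀ‖ + ‖Z * Zᵀ‖ := by
      simpa using norm_add_le (X - Z * Zᵀ) (Z * Zᵀ)
    have h5 : ‖Z * Zᵀ‖ ≤ k * M := by
      rw [← hbb]
      refine (Matrix.frobenius_norm_mul _ _).trans ?_
      rw [Matrix.frobenius_norm_transpose]
      exact mul_le_mul hZ hZ (norm_nonneg _) hb0
    have h6 := le_abs_self (d (Fin.castLE hkn j))
    change d (Fin.castLE hkn j) ≤ _
    linarith
  -- In the eigenbasis the error splits: the leading rows are D^{1/2}(1 - BᵀQ) = D^{1/2}(Q - B)ᵀQ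
  -- and the trailing rows are -VbQ.
  set Y := Uᵀ * (Matrix.of (fun i j => r j * U i (Fin.castLE hkn j)) - Z * Q) with hY
  have hYn : ‖Matrix.of (fun i j => r j * U i (Fin.castLE hkn j)) - Z * Q‖ = ‖Y‖ := by
    rw [hY, norm_orthogonal_mul hUU]
  have hYent : ∀ i j, Y i j = (if i = Fin.castLE hkn j then r j else 0) - (V * Q) i j := by
    intro i j
    rw [hY, Matrix.mul_sub, Matrix.sub_apply, hV, Matrix.mul_assoc]
    congr 1
    have h1 : (Uᵀ * U) i (Fin.castLE hkn j) = if i = Fin.castLE hkn j then 1 else 0 := by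
      rw [hU, Matrix.one_apply]
    rw [Matrix.mul_apply] at h1 ⊢
    simp only [Matrix.of_apply]
    rw [show (if i = Fin.castLE hkn j then r j else 0) =
      r j * if i = Fin.castLE hkn j then 1 else 0 by split_ifs <;> simp, ← h1, Finset.mul_sum]
    exact Finset.sum_congr rfl fun p _ => by ring
  have htop : Y.submatrix (Fin.castLE hkn) id = Matrix.diagonal r * ((Q - B)ᵀ * Q) := by
    have hTB : Matrix.diagonal r * Bᵀ = T := by
      rw [hB, Matrix.transpose_mul, Matrix.transpose_transpose, Matrix.diagonal_transpose,
        ← Matrix.mul_assoc, Matrix.diagonal_mul_diagonal]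
      have : (fun j => r j * (r j)⁻¹) = fun _ => (1 : ℝ) := by
        ext j; exact mul_inv_cancel₀ (hr0 j).ne'
      rw [this, Matrix.diagonal_one, Matrix.one_mul]
    rw [Matrix.transpose_sub, Matrix.sub_mul, hQ', Matrix.mul_sub, Matrix.mul_one,
      ← Matrix.mul_assoc, hTB]
    ext j l
    simp only [Matrix.submatrix_apply, id, hYent, Matrix.sub_apply, Matrix.diagonal_apply,
      Fin.castLE_inj]
    congr 1
    split_ifs with h
    · rw [h]
    · rfl
  have hbot : (Matrix.of fun i j => if (i : ℕ) < k then 0 else Y i j :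
      Matrix (Fin n) (Fin k) ℝ) = -(Vb * Q) := by
    ext i j
    simp only [Matrix.of_apply, Matrix.neg_apply, hYent]
    by_cases h : (i : ℕ) < k
    · simp [h, Matrix.mul_apply, hVb]
    · have : i ≠ Fin.castLE hkn j := fun h' => h (by rw [h']; exact j.2)
      simp [h, this, Matrix.mul_apply, hVb]
  have htopn : ‖Y.submatrix (Fin.castLE hkn) id‖ ≤
      √(k * M + m) * (4 * (k * M) * δ / m ^ 2) := by
    rw [htop]
    refine (norm_le_of_abs_entry_le (c := √(k * M + m)) (Y := (Q - B)ᵀ * Q) (Real.sqrt_nonneg _)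
      fun j l => ?_).trans ?_
    · rw [Matrix.diagonal_mul, abs_mul, abs_of_pos (hr0 j)]
      gcongr
      exact hrmax j
    · rw [norm_mul_orthogonal hQt, Matrix.frobenius_norm_transpose, norm_sub_rev]
      gcongr
      exact hBQ.trans hBBn
  have hbotn : ‖(Matrix.of fun i j => if (i : ℕ) < k then 0 else Y i j :
      Matrix (Fin n) (Fin k) ℝ)‖ ≤ 2 / m * (δ * b) := by
    rw [hbot, norm_neg, norm_mul_orthogonal hQt]
    exact hVbn
  change ‖Matrix.of (fun i j => r j * U i (Fin.castLE hkn j)) - Z * Q‖ ≤ _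
  rw [hYn]
  have hsq := norm_sq_split hkn Y
  refine le_trans (abs_le_of_sq_le_sq' (b := ‖Y.submatrix (Fin.castLE hkn) id‖ +
    ‖(Matrix.of fun i j => if (i : ℕ) < k then 0 else Y i j : Matrix (Fin n) (Fin k) ℝ)‖) ?_
    (by positivity)).2 (add_le_add htopn hbotn)
  rw [hsq]
  have := mul_nonneg (norm_nonneg (Y.submatrix (Fin.castLE hkn) id)) (norm_nonneg
    (Matrix.of fun i j => if (i : ℕ) < k then 0 else Y i j : Matrix (Fin n) (Fin k) ℝ))
  nlinarith

end Procrustes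

/-! ### Rows and column sums of the spectral factor -/

/-- The rows of a positively truncated square root are controlled by the rows of the matrix. -/
theorem sq_sqrt_mul_eigenvector_le {n : ℕ} {U X : Matrix (Fin n) (Fin n) ℝ} {d : Fin n → ℝ}
    (hU : Uᵀ * U = 1) (hX : X = U * Matrix.diagonal d * Uᵀ) {m : ℝ} (hm : 0 < m)
    {j : Fin n} (hj : m ≤ d j) (i : Fin n) :
    (√(d j) * U i j) ^ 2 ≤ 1 / m * ∑ l, X i l ^ 2 := by
  have h1 : ∑ l, X i l * U l j = d j * U i j := by
    have : (X * U) i j = d j * U i j := by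
      rw [hX, Matrix.mul_assoc, hU, Matrix.mul_one, Matrix.mul_diagonal, mul_comm]
    rw [← this, Matrix.mul_apply]
  have h2 : ∑ l, U l j ^ 2 = 1 := by
    have := congrFun (congrFun hU j) j
    simpa [Matrix.mul_apply, sq] using this
  have h3 := Finset.sum_mul_sq_le_sq_mul_sq Finset.univ (X i) fun l => U l j
  rw [h1, h2, mul_one] at h3
  have hd : 0 < d j := hm.trans_le hj
  rw [mul_pow, Real.sq_sqrt hd.le]
  have h4 : d j * U i j ^ 2 = (d j * U i j) ^ 2 / d j := by field_simp
  rw [h4, one_div, ← div_eq_inv_mul]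
  have h5 : 0 ≤ ∑ l, X i l ^ 2 := Finset.sum_nonneg fun _ _ => sq_nonneg _
  gcongr

/-- An eigenvector of a symmetric matrix for a nonzero eigenvalue is orthogonal to the kernel, which
here contains 1. Applied to the residual, whose rows sum to zero because the estimate of α solves
(nI + 11ᵀ)α = T1, it centers the estimated factor. -/
theorem eigenvector_sum_eq_zero {n : ℕ} {U X : Matrix (Fin n) (Fin n) ℝ} {d : Fin n → ℝ}
    (hU : Uᵀ * U = 1) (hX : X = U * Matrix.diagonal d * Uᵀ) (hrow : ∀ i, ∑ l, X i l = 0)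
    {j : Fin n} (hj : d j ≠ 0) : ∑ i, U i j = 0 := by
  have hsymm : ∀ i l, X i l = X l i := fun i l => by
    have : Xᵀ = X := by rw [hX]; simp [Matrix.transpose_mul, Matrix.mul_assoc]
    conv_lhs => rw [← this]
    rfl
  have h1 : ∀ i, ∑ l, X i l * U l j = d j * U i j := fun i => by
    have : (X * U) i j = d j * U i j := by
      rw [hX, Matrix.mul_assoc, hU, Matrix.mul_one, Matrix.mul_diagonal, mul_comm]
    rw [← this, Matrix.mul_apply]
  have h2 : d j * ∑ i, U i j = 0 := by
    rw [Finset.mul_sum]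
    simp_rw [← h1]
    rw [Finset.sum_comm]
    refine Finset.sum_eq_zero fun l _ => ?_
    rw [← Finset.sum_mul]
    simp_rw [hsymm _ l]
    rw [hrow, zero_mul]
  exact (mul_eq_zero.1 h2).resolve_left hj

/-! ### Tuning parameters -/

theorem isLittleO_natCast_rpow {a b : ℝ} (hab : a < b) :
    (fun n : ℕ => (n : ℝ) ^ a) =o[atTop] fun n : ℕ => (n : ℝ) ^ b := by
  refine isLittleO_of_tendsto' ?_ ?_
  · filter_upwards [eventually_ge_atTop 1] with n hn h
    have : (0 : ℝ) < n := by exact_mod_cast hn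
    exact absurd h (by positivity)
  · refine ((tendsto_rpow_neg_atTop (sub_pos.2 hab)).comp
      (tendsto_natCast_atTop_atTop (R := ℝ))).congr' ?_
    filter_upwards [eventually_ge_atTop 1] with n hn
    have : (0 : ℝ) < n := by exact_mod_cast hn
    rw [Function.comp_apply, neg_sub, Real.rpow_sub this]

/-- The point is the lower bound on γ: lowering the exponent in the bound on τ by ς gives τ_n
n^{3/2-1/(k+3)} = o(n^{2-ς}), the order of γ_n. -/
theorem tuningCondition_of_isTheta {k : ℕ} {ς : ℝ} (hς : ς ∈ Set.Ioo (0 : ℝ) (1 / ((k : ℝ) + 3)))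
    {τ : ℕ → ℝ} {γ : ℕ → ℕ} (hpos : ∀ᶠ n in atTop, 0 < τ n)
    (hlow : (fun n : ℕ => (n : ℝ) ^ (1 / 2 : ℝ)) =o[atTop] τ)
    (hup : τ =o[atTop] fun n : ℕ => (n : ℝ) ^ (1 / 2 + 1 / ((k : ℝ) + 3) - ς))
    (hγ : (fun n => (γ n : ℝ)) =Θ[atTop] fun n : ℕ => (n : ℝ) ^ (2 - ς)) :
    TuningCondition k τ γ := by
  have hmono : ∀ {a b : ℝ}, a ≤ b →
      (fun n : ℕ => (n : ℝ) ^ a) =O[atTop] fun n : ℕ => (n : ℝ) ^ b := fun {a b} hab => by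
    refine IsBigO.of_bound 1 ?_
    filter_upwards [eventually_ge_atTop 1] with n hn
    have h1 : (1 : ℝ) ≤ n := by exact_mod_cast hn
    rw [one_mul, Real.norm_of_nonneg (by positivity), Real.norm_of_nonneg (by positivity)]
    exact Real.rpow_le_rpow_of_exponent_le h1 hab
  refine ⟨hpos, hlow, hup.trans_isBigO (hmono (by linarith [hς.1])), ?_, ?_⟩
  · have h1 := hup.mul_isBigO
      (isBigO_refl (fun n : ℕ => (n : ℝ) ^ (3 / 2 - 1 / ((k : ℝ) + 3))) atTop)
    refine h1.trans_isBigO (IsBigO.trans ?_ hγ.2)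
    refine EventuallyEq.isBigO ?_
    filter_upwards [eventually_ge_atTop 1] with n hn
    rw [← Real.rpow_add (by exact_mod_cast hn)]
    congr 1
    ring
  · refine hγ.1.trans_isLittleO ?_
    refine (isLittleO_natCast_rpow (a := 2 - ς) (b := 2) (by linarith [hς.1])).congr (fun n => rfl) fun n => ?_
    simp

theorem exists_tuningCondition {k : ℕ} {ς : ℝ} (hς : ς ∈ Set.Ioo (0 : ℝ) (1 / ((k : ℝ) + 3))) :
    ∃ (τ : ℕ → ℝ) (γ : ℕ → ℕ), TuningCondition k τ γ ∧
      (fun n => (γ n : ℝ)) =Θ[atTop] fun n : ℕ => (n : ℝ) ^ (2 - ς) := by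
  have hk3 : 1 / ((k : ℝ) + 3) ≤ 1 := by
    rw [div_le_one (by positivity)]
    linarith [k.cast_nonneg (α := ℝ)]
  have hΘ : (fun n : ℕ => ((⌈(n : ℝ) ^ (2 - ς)⌉₊ : ℕ) : ℝ)) =Θ[atTop]
      fun n : ℕ => (n : ℝ) ^ (2 - ς) := by
    constructor
    · refine IsBigO.of_bound 2 ?_
      filter_upwards [eventually_ge_atTop 1] with n hn
      have h1 : (1 : ℝ) ≤ n := by exact_mod_cast hn
      rw [Real.norm_of_nonneg (by positivity), Real.norm_of_nonneg (by positivity)]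
      have h2 : (1 : ℝ) ≤ (n : ℝ) ^ (2 - ς) :=
        Real.one_le_rpow h1 (by linarith [hς.2])
      have := (Nat.ceil_lt_add_one (zero_le_one.trans h2)).le
      linarith
    · refine IsBigO.of_bound 1 (Eventually.of_forall fun n => ?_)
      rw [one_mul, Real.norm_of_nonneg (by positivity), Real.norm_of_nonneg (by positivity)]
      exact Nat.le_ceil _
  -- The exponent of τ is the midpoint of the admissible interval from 1/2 to 1/2 + 1/(k+3) - ς.
  refine ⟨fun n => (n : ℝ) ^ (1 / 2 + (1 / ((k : ℝ) + 3) - ς) / 2), fun n => ⌈(n : ℝ) ^ (2 - ς)⌉₊,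
    tuningCondition_of_isTheta hς ?_ (isLittleO_natCast_rpow (by linarith [hς.2]))
    (isLittleO_natCast_rpow (by linarith [hς.2])) hΘ, hΘ⟩
  filter_upwards [eventually_ge_atTop 1] with n hn
  have : (0 : ℝ) < n := by exact_mod_cast hn
  positivity

/-! ### Consequences of the condition on the true parameters -/

section TwoToInf

variable {m n : Type*} [Fintype m] [Fintype n]

theorem norm_mulVec_le_of_abs_entry_le {X : Matrix m n ℝ} {b : ℝ} (hb : 0 ≤ b)
    (hX : ∀ i j, |X i j| ≤ b) {v : EuclideanSpace ℝ n} (hv : v ∈ Metric.sphere (0 : _) 1) :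
    ‖X *ᵥ v.ofLp‖ ≤ Fintype.card n * b := by
  refine (pi_norm_le_iff_of_nonneg (by positivity)).2 fun i => ?_
  rw [Matrix.mulVec, dotProduct]
  refine (norm_sum_le _ _).trans ?_
  have : ∀ j ∈ Finset.univ, ‖X i j * v.ofLp j‖ ≤ b := fun j _ => by
    rw [norm_mul]
    have h1 : ‖v.ofLp j‖ ≤ 1 := (PiLp.norm_apply_le v j).trans_eq (by simpa using hv)
    calc _ ≤ b * 1 := mul_le_mul (hX i j) h1 (norm_nonneg _) hb
      _ = b := mul_one b
  refine (Finset.sum_le_sum this).trans_eq ?_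
  simp

theorem twoToInfNorm_le_of_abs_entry_le [Nonempty n] {X : Matrix m n ℝ} {b : ℝ} (hb : 0 ≤ b)
    (hX : ∀ i j, |X i j| ≤ b) : twoToInfNorm X ≤ Fintype.card n * b := by
  refine csSup_le ((NormedSpace.sphere_nonempty.2 zero_le_one).image _) ?_
  rintro _ ⟨v, hv, rfl⟩
  exact norm_mulVec_le_of_abs_entry_le hb hX hv

theorem abs_entry_le_twoToInfNorm [DecidableEq n] (X : Matrix m n ℝ) (i : m) (j : n) :
    |X i j| ≤ twoToInfNorm X := by
  obtain ⟨b, hb0, hb⟩ : ∃ b, 0 ≤ b ∧ ∀ i j, |X i j| ≤ b :=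
    ⟨∑ i, ∑ j, |X i j|, by positivity, fun i j =>
      (Finset.single_le_sum (f := fun j => |X i j|) (fun _ _ => abs_nonneg _)
        (Finset.mem_univ j)).trans
      (Finset.single_le_sum (f := fun i => ∑ j, |X i j|)
        (fun _ _ => Finset.sum_nonneg fun _ _ => abs_nonneg _) (Finset.mem_univ i))⟩
  have hbdd : BddAbove
      ((fun v : EuclideanSpace ℝ n => ‖X *ᵥ v.ofLp‖) '' Metric.sphere 0 1) := by
    refine ⟨Fintype.card n * b, ?_⟩
    rintro _ ⟨v, hv, rfl⟩
    exact norm_mulVec_le_of_abs_entry_le hb0 hb hv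
  refine le_trans ?_ (le_csSup hbdd ⟨EuclideanSpace.single j 1, by simp, rfl⟩)
  refine le_trans ?_ (norm_le_pi_norm _ i)
  simp

end TwoToInf

/-- The smallest singular value of a nonnegative diagonal matrix is at most each diagonal entry. -/
theorem sigmaMin_diagonal_le {k : ℕ} {g : Fin k → ℝ} (hg : ∀ i, 0 ≤ g i) (l : Fin k) :
    sigmaMin (Matrix.diagonal g) ≤ g l := by
  set H := Matrix.isHermitian_conjTranspose_mul_self (Matrix.diagonal g) with hH
  have hmem : g l ^ 2 ∈ spectrum ℝ ((Matrix.diagonal g)ᴴ * Matrix.diagonal g) := by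
    rw [Matrix.diagonal_conjTranspose, Matrix.diagonal_mul_diagonal, spectrum_diagonal]
    exact ⟨l, by simp [sq]⟩
  rw [H.spectrum_real_eq_range_eigenvalues] at hmem
  obtain ⟨i, hi⟩ := hmem
  refine (ciInf_le (Set.finite_range _).bddBelow i).trans ?_
  rw [hi, Real.sqrt_sq (hg l)]

namespace TrueParameterCondition

variable {M₁ M₂ : ℝ} {n k : ℕ} {Z : Matrix (Fin n) (Fin k) ℝ} {α : Fin n → ℝ}

theorem abs_entry_le (h : TrueParameterCondition M₁ M₂ Z α) (i l) : |Z i l| ≤ M₁ :=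
  (abs_entry_le_twoToInfNorm Z i l).trans h.bound_Z

theorem abs_degree_le (h : TrueParameterCondition M₁ M₂ Z α) (i) : |α i| ≤ M₁ :=
  (norm_le_pi_norm α i).trans h.bound_α

theorem gram_diag_le (h : TrueParameterCondition M₁ M₂ Z α) (l) : (Zᵀ * Z) l l ≤ n * M₁ ^ 2 := by
  rw [Matrix.mul_apply]
  refine (Finset.sum_le_sum (g := fun _ => M₁ ^ 2) fun i _ => ?_).trans_eq (by simp)
  rw [Matrix.transpose_apply, ← sq]
  exact sq_le_sq' (abs_le.1 (h.abs_entry_le i l)).1 (abs_le.1 (h.abs_entry_le i l)).2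

theorem le_gram_diag (h : TrueParameterCondition M₁ M₂ Z α) (hn : 0 < n) (l) :
    n * M₂ ≤ (Zᵀ * Z) l l := by
  have hd : (n : ℝ)⁻¹ • (Zᵀ * Z) = Matrix.diagonal fun l => (n : ℝ)⁻¹ * (Zᵀ * Z) l l := by
    ext i j
    by_cases hij : i = j
    · subst hij; simp
    · rw [Matrix.diagonal_apply_ne _ hij, Matrix.smul_apply, h.gram_diag hij, smul_zero]
  have hg : ∀ l, 0 ≤ (n : ℝ)⁻¹ * (Zᵀ * Z) l l := fun l => by
    refine mul_nonneg (by positivity) ?_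
    rw [Matrix.mul_apply]
    exact Finset.sum_nonneg fun i _ => by rw [Matrix.transpose_apply]; exact mul_self_nonneg _
  have h1 := h.well_conditioned
  rw [hd] at h1
  have h2 := h1.trans (sigmaMin_diagonal_le hg l)
  have hn' : (0 : ℝ) < n := by exact_mod_cast hn
  rwa [inv_mul_eq_div, le_div_iff₀ hn', mul_comm] at h2

end TrueParameterCondition

/-! ### The link function -/

/-- On a compact parameter range the inverse of the mean function is Lipschitz on a neighbourhood of
the image. -/
theorem LinkCondition.exists_inverse_bounds {F : EdgeFamily} (h : LinkCondition F) {b : ℝ}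
    (hb : 0 < b) :
    ∃ η > 0, ∃ κ > 0, ∃ L ≥ 0, F.mean (-b) ≤ F.mean b ∧
      (∀ x, |x| ≤ b → F.mean x ∈ Set.Icc (F.mean (-b)) (F.mean b)) ∧
      Set.Icc (F.mean (-b) - η) (F.mean b + η) ⊆ Set.range F.mean ∧
      (∀ y ∈ Set.Icc (F.mean (-b) - η) (F.mean b + η), |Function.invFun F.mean y| ≤ b + 1) ∧
      (∀ x, |x| ≤ b → ∀ y ∈ Set.Icc (F.mean (-b) - η) (F.mean b + η),
        |Function.invFun F.mean y - x| ≤ κ * |y - F.mean x|) ∧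
      (∀ x y, |x| ≤ b → |y| ≤ b → |F.mean x - F.mean y| ≤ L * |x - y|) ∧
      (∀ x, |x| ≤ b → |F.mean x| ≤ |F.mean (-b)| + |F.mean b|) := by
  have hdiff : Differentiable ℝ F.mean := h.contDiff.differentiable one_ne_zero
  have hmono : StrictMono F.mean := by
    refine strictMono_of_deriv_pos fun x => ?_
    obtain ⟨κ, hκ, _, _, hx⟩ := h.bounds (|x| + 1) (by positivity)
    exact hκ.trans_le (hx x ⟨by linarith [neg_abs_le x], by linarith [le_abs_self x]⟩).1
  obtain ⟨κ₄, hκ₄, κ₅, hκ₅, hκ⟩ := h.bounds (b + 1) (by positivity)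
  have hcont : Continuous F.mean := hdiff.continuous
  -- With this η the neighbourhood of [μ(-b), μ(b)] stays inside μ([-b-1, b+1]); hence the
  -- derivative bounds are taken at radius b+1.
  set η := min (F.mean (-b) - F.mean (-b - 1)) (F.mean (b + 1) - F.mean b) with hη
  have hη0 : 0 < η := lt_min (sub_pos.2 (hmono (by linarith))) (sub_pos.2 (hmono (by linarith)))
  have hsub : ∀ y ∈ Set.Icc (F.mean (-b) - η) (F.mean b + η),
      y ∈ F.mean '' Set.Icc (-b - 1) (b + 1) := fun y hy => by
    refine intermediate_value_Icc (by linarith) hcont.continuousOn ⟨?_, ?_⟩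
    · linarith [hy.1, min_le_left (F.mean (-b) - F.mean (-b - 1)) (F.mean (b + 1) - F.mean b)]
    · linarith [hy.2, min_le_right (F.mean (-b) - F.mean (-b - 1)) (F.mean (b + 1) - F.mean b)]
  have hinv : ∀ x, Function.invFun F.mean (F.mean x) = x :=
    Function.leftInverse_invFun hmono.injective
  have hIcc : ∀ x, |x| ≤ b → F.mean x ∈ Set.Icc (F.mean (-b)) (F.mean b) := fun x hx =>
    ⟨hmono.monotone (abs_le.1 hx).1, hmono.monotone (abs_le.1 hx).2⟩
  refine ⟨η, hη0, κ₄⁻¹, by positivity, κ₅, hκ₅.le, hmono.monotone (by linarith), hIcc,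
    fun y hy => ?_, fun y hy => ?_, fun x hx y hy => ?_, fun x y hx hy => ?_, fun x hx => ?_⟩
  · obtain ⟨x, -, rfl⟩ := hsub y hy
    exact ⟨x, rfl⟩
  · obtain ⟨x, hx, rfl⟩ := hsub y hy
    rw [hinv, abs_le]
    exact ⟨by linarith [hx.1], hx.2⟩
  · obtain ⟨z, hz, rfl⟩ := hsub y hy
    rw [hinv, inv_mul_eq_div, le_div_iff₀ hκ₄]
    have hx' := abs_le.1 hx
    have key : ∀ u v, u ∈ Set.Icc (-b - 1) (b + 1) → v ∈ Set.Icc (-b - 1) (b + 1) → u ≤ v →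
        κ₄ * (v - u) ≤ F.mean v - F.mean u := fun u v hu hv huv =>
      (convex_Icc (-b - 1) (b + 1)).mul_sub_le_image_sub_of_le_deriv hcont.continuousOn
        hdiff.differentiableOn
        (fun w hw => (hκ w (by rw [interior_Icc] at hw; exact ⟨by linarith [hw.1], hw.2.le⟩)).1)
        u hu v hv huv
    have hx2 : x ∈ Set.Icc (-b - 1) (b + 1) := ⟨by linarith, by linarith⟩
    rcases le_total x z with hxz | hxz
    · rw [abs_of_nonneg (sub_nonneg.2 hxz), abs_of_nonneg (sub_nonneg.2 (hmono.monotone hxz)),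
        mul_comm]
      exact key x z hx2 hz hxz
    · rw [abs_of_nonpos (sub_nonpos.2 hxz), abs_of_nonpos (sub_nonpos.2 (hmono.monotone hxz))]
      linarith [key z x hz hx2 hxz]
  · have := (convex_Icc (-b) b).norm_image_sub_le_of_norm_deriv_le (f := F.mean) (C := κ₅)
      (fun w _ => hdiff w) (fun w hw => ?_) (abs_le.1 hy) (abs_le.1 hx)
    · simpa using this
    · have := hκ w ⟨by linarith [hw.1], by linarith [hw.2]⟩
      rw [Real.norm_of_nonneg (hκ₄.le.trans this.1)]
      exact this.2
  · have := hIcc x hx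
    rw [abs_le]
    constructor <;> linarith [this.1, this.2, neg_abs_le (F.mean (-b)), le_abs_self (F.mean b),
      abs_nonneg (F.mean (-b)), abs_nonneg (F.mean b)]

/-! ### From the estimated parameter matrix to the estimated factors -/

section Factors

open scoped Matrix.Norms.Frobenius

/-- The difference is (T - Θ) - β1ᵀ - 1βᵀ, where β is the error in α. Each β term has squared norm
n‖β‖² ≤ 3‖T - Θ‖², so 21 = 3(1 + 3 + 3). -/
theorem norm_residual_alphaInit_sub_le {n k : ℕ} (hn : 0 < n) {Z : Matrix (Fin n) (Fin k) ℝ}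
    {α : Fin n → ℝ} (hZ : ∀ j, ∑ i, Z i j = 0) (T : Matrix (Fin n) (Fin n) ℝ) :
    ‖residual T (alphaInit T) - Z * Zᵀ‖ ^ 2 ≤ 21 * ∑ i, ∑ j, (T i j - thetaMat Z α i j) ^ 2 := by
  have hn' : (0 : ℝ) < n := Nat.cast_pos.2 hn
  set R := ∑ i, ∑ j, (T i j - thetaMat Z α i j) ^ 2 with hR
  set β := fun i => alphaInit T i - α i with hβ
  have hα : ∑ i, β i ^ 2 ≤ 3 / n * R := by
    have := sum_sq_alphaInit_le hn (T - thetaMat Z α)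
    rw [← alphaInit_sub hn, alphaInit_thetaMat hn hZ] at this
    simpa using this
  rw [norm_sq_eq_sum]
  have hent : ∀ i j, (residual T (alphaInit T) - Z * Zᵀ) i j ^ 2 ≤
      3 * ((T i j - thetaMat Z α i j) ^ 2 + β i ^ 2 + β j ^ 2) := fun i j => by
    have e : (residual T (alphaInit T) - Z * Zᵀ) i j =
        (T i j - thetaMat Z α i j) - β i - β j := by
      simp only [residual, thetaMat, hβ, Matrix.sub_apply, Matrix.of_apply, Matrix.mul_apply,
        Matrix.transpose_apply, dotProduct]
      ring
    rw [e]
    nlinarith [sq_nonneg (T i j - thetaMat Z α i j + β i), sq_nonneg (β i - β j),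
      sq_nonneg (T i j - thetaMat Z α i j + β j)]
  calc ∑ i, ∑ j, (residual T (alphaInit T) - Z * Zᵀ) i j ^ 2
      ≤ ∑ i, ∑ j, 3 * ((T i j - thetaMat Z α i j) ^ 2 + β i ^ 2 + β j ^ 2) :=
        Finset.sum_le_sum fun i _ => Finset.sum_le_sum fun j _ => hent i j
    _ = 3 * (R + 2 * (n * ∑ i, β i ^ 2)) := by
        simp only [← Finset.mul_sum, Finset.sum_add_distrib, Finset.sum_const, Finset.card_univ,
          Fintype.card_fin, nsmul_eq_mul, hR]
        ring
    _ ≤ 3 * (R + 2 * (n * (3 / n * R))) := by gcongr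
    _ = 21 * R := by field_simp; ring

/-- The Gram matrix is diagonal with entries between nM₂ and nM₁², so with δ of order √R the bound
of `topSqrt_perturbation` is of order δ/√n. The restriction R ≤ ρn² encodes its two smallness
conditions, one for each argument of the minimum σ. -/
theorem exists_factor_bounds (k : ℕ) {M₁ M₂ c : ℝ} (hM₁ : 0 < M₁) (hM₂ : 0 < M₂) (hc : 0 < c) :
    ∃ C > 0, ∃ ρ > 0, ∀ n : ℕ, 0 < n → k ≤ n →
      ∀ (Z : Matrix (Fin n) (Fin k) ℝ) (α : Fin n → ℝ), TrueParameterCondition M₁ M₂ Z α →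
      ∀ (T : Matrix (Fin n) (Fin n) ℝ) (Zr : Matrix (Fin n) (Fin k) ℝ) (R : ℝ),
        (∀ i j, |T i j| ≤ c) → ∑ i, ∑ j, (T i j - thetaMat Z α i j) ^ 2 ≤ R →
        R ≤ ρ * (n : ℝ) ^ 2 → IsTopSqrt (residual T (alphaInit T)) Zr →
        (∀ j, ∑ i, Zr i j = 0) ∧ distSq Zr (alphaInit T) Z α ≤ C * (R / n) ∧
          twoToInfNorm (joinCols Zr (alphaInit T)) ≤ C := by
  set σ := min (M₂ / 2) (M₂ ^ 2 / (4 * (k * M₁ ^ 2) + 1)) with hσ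
  have hσ0 : 0 < σ := by positivity
  set c₁ := √(k * M₁ ^ 2 + M₂) * (4 * (k * M₁ ^ 2) / M₂ ^ 2) + 2 / M₂ * √(k * M₁ ^ 2) with hc₁
  have hc₁0 : 0 ≤ c₁ := by positivity
  -- The estimate of α is at most 2c, so residual entries are at most 5c and the squared length of a
  -- row at most 25c²n; dividing by the eigenvalue bound nM₂/2 gives 50c²/M₂.
  set b := √(50 / M₂) * c + 2 * c with hb
  have hb0 : 0 < b := by positivity
  refine ⟨(21 * c₁ ^ 2 + 3) + (k + 1) * b, by positivity, σ ^ 2 / 21, by positivity,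
    fun n hn hkn Z α hZα T Zr R hT hTR hRn hZr => ?_⟩
  have hn' : (0 : ℝ) < n := Nat.cast_pos.2 hn
  have hR0 : 0 ≤ R :=
    (Finset.sum_nonneg fun _ _ => Finset.sum_nonneg fun _ _ => sq_nonneg _).trans hTR
  obtain ⟨U, hUm, d, hd, hX, hZrd⟩ := hZr
  have hUt := orthogonal_mul_transpose hUm
  have hU := transpose_mul_orthogonal hUm
  set X := residual T (alphaInit T) with hXdef
  set δ := √(21 * R) with hδ
  have hδ0 : 0 ≤ δ := Real.sqrt_nonneg _
  have hδsq : δ ^ 2 = 21 * R := Real.sq_sqrt (by positivity)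
  have hδX : ‖X - Z * Zᵀ‖ ≤ δ := Real.le_sqrt_of_sq_le
    ((norm_residual_alphaInit_sub_le (α := α) hn hZα.centered T).trans (by linarith))
  have hδn : δ ≤ σ * n := by
    refine Real.sqrt_le_iff.2 ⟨by positivity, ?_⟩
    rw [mul_pow]
    linarith
  have hm : 0 < n * M₂ := by positivity
  have hδm : δ ≤ n * M₂ / 2 := by
    have : σ * n ≤ M₂ / 2 * n := by gcongr; exact min_le_left _ _
    linarith
  have hρ : 4 * (k * (n * M₁ ^ 2)) * δ / (n * M₂) ^ 2 < 1 := by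
    rw [div_lt_one (by positivity)]
    have h1 : σ * (4 * (k * M₁ ^ 2) + 1) ≤ M₂ ^ 2 :=
      (le_div_iff₀ (by positivity)).1 (min_le_right _ _)
    calc 4 * (k * (n * M₁ ^ 2)) * δ ≤ 4 * (k * (n * M₁ ^ 2)) * (σ * n) := by gcongr
      _ = n ^ 2 * (σ * (4 * (k * M₁ ^ 2))) := by ring
      _ < n ^ 2 * M₂ ^ 2 := by
          gcongr
          linarith
      _ = _ := by ring
  obtain ⟨hlead, hdist⟩ := topSqrt_perturbation hkn hUt hU hd hX hm (by positivity) hZα.gram_diag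
    (hZα.le_gram_diag hn) hZα.gram_diag_le hδX hδm hρ
  have hD0 : ∀ j : Fin k, 0 < d (Fin.castLE hkn j) := fun j => (half_pos hm).trans_le (hlead j)
  have hZre : Zr = Matrix.of fun i j => √(d (Fin.castLE hkn j)) * U i (Fin.castLE hkn j) := by
    ext i j
    rw [hZrd, dif_pos (j.2.trans_le hkn), Matrix.of_apply]
    change √(max (d (Fin.castLE hkn j)) 0) * _ = _
    rw [max_eq_left (hD0 j).le]
    rfl
  rw [← hZre] at hdist
  have hα : ∑ i, (alphaInit T i - α i) ^ 2 ≤ 3 / n * R := by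
    have := sum_sq_alphaInit_le hn (T - thetaMat Z α)
    rw [← alphaInit_sub hn, alphaInit_thetaMat hn hZα.centered] at this
    refine (by simpa using this : _ ≤ _).trans ?_
    gcongr
  refine ⟨fun j => ?_, ?_, ?_⟩
  · simp only [hZre, Matrix.of_apply]
    rw [← Finset.mul_sum, eigenvector_sum_eq_zero hU hX (residual_row_sum hn T) (hD0 j).ne',
      mul_zero]
  · have hp0 : 0 ≤ procrustesDist Zr Z := Real.iInf_nonneg fun Q => Real.sqrt_nonneg _
    have hp : procrustesDist Zr Z ≤ c₁ * (δ / √n) := by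
      refine hdist.trans_eq ?_
      have e1 : √(k * (n * M₁ ^ 2) + n * M₂) = √n * √(k * M₁ ^ 2 + M₂) := by
        rw [← Real.sqrt_mul hn'.le]; congr 1; ring
      have e2 : √(k * (n * M₁ ^ 2)) = √n * √(k * M₁ ^ 2) := by
        rw [← Real.sqrt_mul hn'.le]; congr 1; ring
      have e3 : (n : ℝ) = √n * √n := (Real.mul_self_sqrt hn'.le).symm
      have hs : 0 < √(n : ℝ) := Real.sqrt_pos.2 hn'
      rw [e1, e2, hc₁]
      generalize √(k * M₁ ^ 2 + M₂) = p
      generalize √(k * M₁ ^ 2) = q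
      generalize hN : √(n : ℝ) = N at *
      rw [e3]
      field_simp
    have hp2 : procrustesDist Zr Z ^ 2 ≤ 21 * c₁ ^ 2 * (R / n) := by
      refine (pow_le_pow_left₀ hp0 hp 2).trans_eq ?_
      rw [mul_pow, div_pow, hδsq, Real.sq_sqrt hn'.le]
      ring
    have h0 : 0 ≤ (k + 1) * b * (R / n) := by positivity
    rw [distSq]
    calc _ ≤ 21 * c₁ ^ 2 * (R / n) + 3 / n * R := add_le_add hp2 hα
      _ = (21 * c₁ ^ 2 + 3) * (R / n) := by ring
      _ ≤ _ := by rw [add_mul _ _ (R / (n : ℝ))]; linarith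
  · have hαb := abs_alphaInit_le hn hT
    have hXb : ∀ i l, |X i l| ≤ 5 * c := fun i l => by
      rw [hXdef, residual, Matrix.of_apply]
      have h1 := abs_le.1 (hT i l)
      have h2 := abs_le.1 (hαb i)
      have h3 := abs_le.1 (hαb l)
      rw [abs_le]
      constructor <;> linarith [h1.1, h1.2, h2.1, h2.2, h3.1, h3.2]
    have hZb : ∀ i j, |Zr i j| ≤ √(50 / M₂) * c := fun i j => by
      refine abs_le_of_sq_le_sq ?_ (by positivity)
      rw [mul_pow, Real.sq_sqrt (by positivity), hZre, Matrix.of_apply]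
      refine (sq_sqrt_mul_eigenvector_le hU hX (half_pos hm) (hlead j) i).trans ?_
      have : ∑ l, X i l ^ 2 ≤ n * (5 * c) ^ 2 := by
        refine (Finset.sum_le_sum (g := fun _ => (5 * c) ^ 2) fun l _ => ?_).trans_eq (by simp)
        exact sq_le_sq' (abs_le.1 (hXb i l)).1 (abs_le.1 (hXb i l)).2
      calc _ ≤ 1 / (n * M₂ / 2) * (n * (5 * c) ^ 2) := by gcongr
        _ = _ := by field_simp; ring
    have hent : ∀ i j, |joinCols Zr (alphaInit T) i j| ≤ b := fun i j => by
      have h2 : 0 ≤ √(50 / M₂) * c := by positivity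
      rcases j with j | j
      · simp only [joinCols, Matrix.fromCols_apply_inl]
        linarith [hZb i j]
      · simp only [joinCols, Matrix.fromCols_apply_inr, Matrix.replicateCol_apply]
        linarith [hαb i]
    refine (twoToInfNorm_le_of_abs_entry_le hb0.le hent).trans ?_
    have : (0 : ℝ) ≤ 21 * c₁ ^ 2 + 3 := by positivity
    simp only [Fintype.card_sum, Fintype.card_fin, Fintype.card_unit, Nat.cast_add, Nat.cast_one]
    linarith

end Factors

/-! ### Accuracy on the noise event and its probability -/

/-- On the event that the noise is dominated by the threshold, the estimator is accurate. -/
theorem exists_isRASVT_bounds {k : ℕ} {F : EdgeFamily} (hlink : LinkCondition F) {M₁ M₂ : ℝ}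
    (hM₁ : 0 < M₁) (hM₂ : 0 < M₂) {τ : ℕ → ℝ} {γ : ℕ → ℕ} (hτγ : TuningCondition k τ γ) :
    ∃ C > 0, ∀ᶠ n : ℕ in atTop, ∀ (Z : Matrix (Fin n) (Fin k) ℝ) (α : Fin n → ℝ),
      TrueParameterCondition M₁ M₂ Z α → ∀ (A : Matrix (Fin n) (Fin n) ℝ)
      (Zr : Matrix (Fin n) (Fin k) ℝ) (αr : Fin n → ℝ),
      OpBound (A - (thetaMat Z α).map F.mean) (τ n / 2) →
      IsRASVT F.mean (τ n) (γ n) A Zr αr →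
        (∀ j, ∑ i, Zr i j = 0) ∧ distSq Zr αr Z α ≤ C * γ n / n ∧
          twoToInfNorm (joinCols Zr αr) ≤ C := by
  set b := 2 * M₁ + k * M₁ ^ 2 with hb
  have hb0 : 0 < b := by positivity
  obtain ⟨η, hη, κ, hκ, L, hL, hab, hIcc, hrange, hinv, hlip', hlip, hbd⟩ :=
    hlink.exists_inverse_bounds hb0
  obtain ⟨C₁, hC₁, hnuc⟩ := exists_nuclear_bound k hM₁.le hL (by positivity) hlip hbd
  obtain ⟨C₂, hC₂, ρ, hρ, hfac⟩ := exists_factor_bounds k hM₁ hM₂ (c := b + 1) (by positivity)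
  set w := F.mean b - F.mean (-b) + η with hw
  set D := κ ^ 2 * (η ^ 2 + 2 * w ^ 2) with hD
  have hD0 : 0 < D := by positivity
  refine ⟨C₂ * (D + 1), by positivity, ?_⟩
  -- This constant brings the thresholding error 9/2 · τC₁N below γη²/2, strictly within the budget
  -- γη² of `adaptiveProj_spec`. In the next bound, 1/2 keeps the two quantiles in order and ρ/D
  -- makes the error Dγ admissible for `exists_factor_bounds`.
  have hlow := hτγ.γ_lower.bound (c := η ^ 2 / (9 * C₁)) (by positivity)
  have hup := hτγ.γ_upper.bound (c := min (1 / 2) (ρ / D)) (by positivity)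
  filter_upwards [hlow, hup, hτγ.τ_pos, eventually_ge_atTop 1, eventually_ge_atTop k] with
    n hlow hup hτ hn hkn Z α hZα A Zr αr hW hras
  obtain ⟨E, hE, T, hT, rfl, hZr⟩ := hras
  have hn' : (0 : ℝ) < n := Nat.cast_pos.2 hn
  set N := (n : ℝ) ^ (3 / 2 - 1 / ((k : ℝ) + 3)) with hN
  have hN0 : 0 < N := by positivity
  rw [Real.norm_of_nonneg (by positivity), Real.norm_of_nonneg (by positivity)] at hlow hup
  have hγ0 : (0 : ℝ) < γ n := by
    by_contra h
    have h0 : (γ n : ℝ) = 0 := le_antisymm (not_lt.1 h) (by positivity)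
    rw [h0, mul_zero] at hlow
    exact absurd hlow (not_le.2 (by positivity))
  have hγ1 : 1 ≤ γ n := by exact_mod_cast hγ0
  have hγ2 : 2 * γ n ≤ n ^ 2 := by
    have : (γ n : ℝ) ≤ 1 / 2 * n ^ 2 := hup.trans (by gcongr; exact min_le_left _ _)
    have : (2 * γ n : ℝ) ≤ n ^ 2 := by linarith
    exact_mod_cast this
  have hθ : ∀ i j, |thetaMat Z α i j| ≤ b := abs_thetaMat_le hZα.abs_entry_le hZα.abs_degree_le
  set S := (thetaMat Z α).map F.mean with hS
  have hES : ∑ i, ∑ j, (E i j - S i j) ^ 2 ≤ γ n * η ^ 2 / 2 := by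
    have h := sum_sq_svThreshold_sub_le (N := C₁ * N) hτ (add_sub_cancel S A).symm hW hE
      fun X c hc hX => hnuc n hn Z α hZα.abs_entry_le hZα.abs_degree_le X c hc hX
    refine h.trans ?_
    calc 9 / 2 * τ n * (C₁ * N) = 9 / 2 * C₁ * (τ n * N) := by ring
      _ ≤ 9 / 2 * C₁ * (η ^ 2 / (9 * C₁) * γ n) := by gcongr
      _ = _ := by field_simp
  have hlt : (γ n : ℝ) * η ^ 2 / 2 < γ n * η ^ 2 := half_lt_self (by positivity)
  obtain ⟨hmem, herr⟩ := adaptiveProj_spec hη (fun i j => hIcc _ (hθ i j)) hrange hγ1 hγ2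
    (hES.trans_lt hlt)
  have hTc : ∀ i j, |T i j| ≤ b + 1 := fun i j => by
    rw [hT, Matrix.map_apply]; exact hinv _ (hmem i j)
  have hTR : ∑ i, ∑ j, (T i j - thetaMat Z α i j) ^ 2 ≤ D * γ n := by
    calc ∑ i, ∑ j, (T i j - thetaMat Z α i j) ^ 2
        ≤ ∑ i, ∑ j, κ ^ 2 * (adaptiveProj F.mean (γ n) E i j - S i j) ^ 2 := by
          refine Finset.sum_le_sum fun i _ => Finset.sum_le_sum fun j _ => ?_
          rw [← mul_pow, ← sq_abs, ← sq_abs (κ * _), abs_mul, abs_of_pos hκ]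
          refine pow_le_pow_left₀ (abs_nonneg _) ?_ 2
          rw [hT]
          exact hlip' _ (hθ i j) _ (hmem i j)
      _ = κ ^ 2 * ∑ i, ∑ j, (adaptiveProj F.mean (γ n) E i j - S i j) ^ 2 := by
          simp only [Finset.mul_sum]
      _ ≤ κ ^ 2 * (γ n * η ^ 2 + 2 * γ n * w ^ 2) := by
          gcongr
          exact herr.trans (add_le_add_left (hES.trans hlt.le) _)
      _ = D * γ n := by rw [hD]; ring
  obtain ⟨h1, h2, h3⟩ := hfac n hn hkn Z α hZα T Zr (D * γ n) hTc hTR (by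
    calc D * γ n ≤ D * (ρ / D * n ^ 2) := by
          gcongr
          exact hup.trans (by gcongr; exact min_le_right _ _)
      _ = _ := by field_simp) hZr
  refine ⟨h1, h2.trans ?_, h3.trans ?_⟩
  · calc C₂ * (D * γ n / n) ≤ C₂ * ((D + 1) * γ n / n) := by
          gcongr
          linarith
      _ = C₂ * (D + 1) * γ n / n := by ring
  · nlinarith

/-- Properties that hold for all outputs on the event that the noise is dominated by the threshold
hold with high probability. -/
theorem rasvtHighProb_of_opBound {k : ℕ} {F : EdgeFamily} (hlink : LinkCondition F)
    {M₁ M₂ K s : ℝ} (hM₁ : 0 < M₁) (hK : 0 < K) (hs : 0 < s) {τ : ℕ → ℝ} {γ : ℕ → ℕ}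
    (hτγ : TuningCondition k τ γ) (ε : ℝ)
    {Good : ∀ n : ℕ, Matrix (Fin n) (Fin k) ℝ → (Fin n → ℝ) →
      Matrix (Fin n) (Fin k) ℝ → (Fin n → ℝ) → Prop}
    (hgood : ∀ᶠ n : ℕ in atTop, ∀ (Z : Matrix (Fin n) (Fin k) ℝ) (α : Fin n → ℝ),
      TrueParameterCondition M₁ M₂ Z α → ∀ (A : Matrix (Fin n) (Fin n) ℝ)
      (Zr : Matrix (Fin n) (Fin k) ℝ) (αr : Fin n → ℝ),
      OpBound (A - (thetaMat Z α).map F.mean) (τ n / 2) →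
      IsRASVT F.mean (τ n) (γ n) A Zr αr → Good n Z α Zr αr) :
    RASVTHighProb.{u} k F M₁ M₂ K s τ γ ε Good := by
  set b := 2 * M₁ + k * M₁ ^ 2 with hb
  obtain ⟨η, hη, κ, hκ, L, hL, -, -, -, -, -, -, hbd⟩ :=
    hlink.exists_inverse_bounds (b := b) (by positivity)
  obtain ⟨C, hC, hnoise⟩ := exists_measure_not_opBound_le.{u} hK hs
    (|F.mean (-b)| + |F.mean b|) ε (by positivity)
  have hlow := hτγ.τ_lower.bound (c := 1 / (2 * C)) (by positivity)
  obtain ⟨N, hN⟩ := eventually_atTop.1 (hgood.and (hnoise.and (hlow.and hτγ.τ_pos)))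
  refine ⟨N, 2, two_pos, fun n hn Z α Ω _ P _ A hZα hA _ htail => ?_⟩
  obtain ⟨hgood, hnoise, hlow, hτ⟩ := hN n hn
  have hθ : ∀ i j, |thetaMat Z α i j| ≤ b := abs_thetaMat_le hZα.abs_entry_le hZα.abs_degree_le
  have hCτ : C * √n ≤ τ n / 2 := by
    rw [Real.norm_of_nonneg (by positivity), Real.norm_of_nonneg hτ.le, ← Real.sqrt_eq_rpow] at hlow
    calc C * √n ≤ C * (1 / (2 * C) * τ n) := by gcongr
      _ = _ := by field_simp
  set W : Ω → Matrix (Fin n) (Fin n) ℝ := fun ω => A ω - (thetaMat Z α).map F.mean with hW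
  have hWm : ∀ i j, Measurable fun ω => W ω i j := fun i j =>
    (hA.measurable_entry i j).sub_const _
  have hsymm : ∀ ω, (W ω).IsSymm := fun ω => by
    ext i j
    have h1 := (hA.symm ω).apply i j
    have h2 : thetaMat Z α j i = thetaMat Z α i j := by
      simp only [thetaMat, Matrix.of_apply, dotProduct_comm (Z j)]; ring
    simp only [hW, Matrix.transpose_apply, Matrix.sub_apply, Matrix.map_apply, h1, h2]
  have hindep : iIndepFun (fun (e : UpperPair n) ω => W ω e.1.1 e.1.2) P :=
    hA.indep.comp (fun e x => x - F.mean (thetaMat Z α e.1.1 e.1.2))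
      fun e => measurable_id.sub_const _
  have hmean : ∀ i j, i < j → Integrable (fun ω => W ω i j) P ∧ ∫ ω, W ω i j ∂P = 0 :=
    fun i j hij => by
      have hlaw := hA.law_entry i j hij
      have hint : Integrable (fun ω => A ω i j) P := by
        have := hlink.integrable (thetaMat Z α i j)
        rw [← hlaw] at this
        exact this.comp_measurable (hA.measurable_entry i j)
      have hmu : ∫ ω, A ω i j ∂P = F.mean (thetaMat Z α i j) := by
        rw [EdgeFamily.mean, ← hlaw]
        exact (integral_map (hA.measurable_entry i j).aemeasurable
          measurable_id.aestronglyMeasurable).symm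
      refine ⟨hint.sub (integrable_const _), ?_⟩
      change ∫ ω, (A ω i j - F.mean (thetaMat Z α i j)) ∂P = 0
      rw [integral_sub hint (integrable_const _), hmu]
      simp
  -- The diagonal of A is zero, so that of W is -μ(Θ_ii): not centered, but bounded.
  have hprob := hnoise Ω P W hsymm hWm hindep hmean htail fun ω i => by
    simp only [hW, Matrix.sub_apply, hA.diag_zero, zero_sub, abs_neg, Matrix.map_apply]
    exact hbd _ (hθ i i)
  -- Inclusion in the event of large noise suffices, as monotonicity does not ask the set of bad
  -- outcomes to be measurable.
  refine (measure_mono fun ω => ?_).trans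
    ((ofReal_measureReal (measure_ne_top P _)).symm.trans_le (ENNReal.ofReal_le_ofReal hprob))
  rintro ⟨Zr, αr, hras, hbad⟩ hω
  exact hbad (hgood Z α hZα (A ω) Zr αr (hω.mono hCτ) hras)

end LatentSpace

theorem theorem3 (k : ℕ) (hk : 1 ≤ k) (F : EdgeFamily) (M₁ M₂ K s : ℝ)
    (hM₁ : 0 < M₁) (hM₂ : 0 < M₂) (hK : 0 < K) (hs : 0 < s)
    (hedge : EdgewiseCondition F) (hlink : LinkCondition F) :
    -- error bound and row-wise boundedness
    (∀ (τ : ℕ → ℝ) (γ : ℕ → ℕ), TuningCondition k τ γ → ∀ ε : ℝ, 0 < ε → ∃ C > 0,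
      RASVTHighProb.{u} k F M₁ M₂ K s τ γ ε fun n Z α Zr αr =>
        distSq Zr αr Z α ≤ C * γ n / n ∧ twoToInfNorm (joinCols Zr αr) ≤ C) ∧
    -- the initialization requirements hold as soon as `γ_n ≲ n^{2 - ς}`
    (∀ (τ : ℕ → ℝ) (γ : ℕ → ℕ), TuningCondition k τ γ → ∀ ς ∈ Set.Ioo (0 : ℝ) (1 / 2),
      ((fun n => (γ n : ℝ)) =O[atTop] fun n : ℕ => (n : ℝ) ^ (2 - ς)) →
      ∀ ε : ℝ, 0 < ε → ∃ C > 0, ∃ b₀ > 0,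
      RASVTHighProb.{u} k F M₁ M₂ K s τ γ ε fun n Z α Zr αr =>
        (∀ j, ∑ i, Zr i j = 0) ∧ distSq Zr αr Z α ≤ C * (n : ℝ) ^ (1 - ς) ∧
          twoToInfNorm (joinCols Zr αr) ≤ b₀) ∧
    -- such tuning parameters exist, with the following explicit choices
    (∀ ς ∈ Set.Ioo (0 : ℝ) (1 / ((k : ℝ) + 3)),
      (∃ (τ : ℕ → ℝ) (γ : ℕ → ℕ), TuningCondition k τ γ ∧
        (fun n => (γ n : ℝ)) =Θ[atTop] fun n : ℕ => (n : ℝ) ^ (2 - ς)) ∧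
      ∀ (τ : ℕ → ℝ) (γ : ℕ → ℕ), (∀ᶠ n in atTop, 0 < τ n) →
        ((fun n : ℕ => (n : ℝ) ^ (1 / 2 : ℝ)) =o[atTop] τ) →
        (τ =o[atTop] fun n : ℕ => (n : ℝ) ^ (1 / 2 + 1 / ((k : ℝ) + 3) - ς)) →
        ((fun n => (γ n : ℝ)) =Θ[atTop] fun n : ℕ => (n : ℝ) ^ (2 - ς)) →
        TuningCondition k τ γ) := by
  refine ⟨fun τ γ hτγ ε _ => ?_, fun τ γ hτγ ς _ hγ ε _ => ?_, fun ς hς =>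
    ⟨exists_tuningCondition hς, fun τ γ => tuningCondition_of_isTheta hς⟩⟩
  · obtain ⟨C, hC, h⟩ := exists_isRASVT_bounds hlink hM₁ hM₂ hτγ
    refine ⟨C, hC, rasvtHighProb_of_opBound hlink hM₁ hK hs hτγ ε ?_⟩
    filter_upwards [h] with n hn Z α hZα A Zr αr hW hras
    exact (hn Z α hZα A Zr αr hW hras).2
  · obtain ⟨C, hC, h⟩ := exists_isRASVT_bounds hlink hM₁ hM₂ hτγ
    obtain ⟨c, hc, hcγ⟩ := hγ.exists_pos
    refine ⟨C * c, by positivity, C, hC, rasvtHighProb_of_opBound hlink hM₁ hK hs hτγ ε ?_⟩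
    filter_upwards [h, hcγ.bound, eventually_ge_atTop 1] with n hn hγn hn1 Z α hZα A Zr αr hW hras
    obtain ⟨h1, h2, h3⟩ := hn Z α hZα A Zr αr hW hras
    refine ⟨h1, h2.trans ?_, h3⟩
    have hn' : (0 : ℝ) < n := by exact_mod_cast hn1
    rw [Real.norm_of_nonneg (by positivity), Real.norm_of_nonneg (by positivity)] at hγn
    have e : (n : ℝ) ^ (1 - ς) = (n : ℝ) ^ (2 - ς) / n := by
      rw [← Real.rpow_sub_one hn'.ne']; congr 1; ring
    rw [e, ← mul_div_assoc, mul_assoc]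
    gcongr
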